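/- Let $S$ be an oriented smooth surface and $f:S\to S^5(1)\subset\mathbb R^6$ a smooth minimal immersion whose ellipse of curvature $\{II(X,X): X \text{ a unit tangent vector}\}$ is, at every point, neither degenerate (a point or a segment) nor a circle. Write $(\cdot,\cdot)$ for the complex bilinear extension of the inner product of $\mathbb R^6$, and, for a complex coordinate $z=x+iy$ compatible with the orientation and the conformal structure induced by $f$, put $\partial=\partial/\partial z$, $f_1=\partial f$ and $f_2=II(\partial,\partial)=a-ib$ with $a,b$ real. The coordinate is called adapted if $(f_2,f_2)=-1$; then there is $\phi\ge 0$ with $|a|=\sinh\phi$, $|b|=\cosh\phi$. Let $N$ be the unit vector for which $\{f,\partial f/\partial x,\partial f/\partial y,II(\tfrac{\partial}{\partial x},\tfrac{\partial}{\partial x}),II(\tfrac{\partial}{\partial x},\tfrac{\partial}{\partial y}),N\}$ is positively oriented and $N$ is orthogonal to the other five vectors. The $(\pm)$transforms of $f$ with respect to $z$ are $$f^{\pm}=-\frac1{\cosh\phi}\frac b{|b|}\pm\tanh\phi\,N ,$$ where $\tanh\phi\,N$ is read as $0$ at a point where $\phi=0$. Let $\{f^p\}_{p\in\mathbb Z}$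 be a sequence of maps $S\to\mathbb R^6$ determined by $f$: $f^0=f$, and each point of $S$ has a neighbourhood with an adapted coordinate $z$ for $f$ with respect to which $f^{p+1}=(f^p)^+$ for all $p\ge0$ and $f^{p-1}=(f^p)^-$ for all $p\le 0$. Let $\alpha^p=(\partial f_2^p,N^p)$ (with $N^p$ read as $0$ at the points where $\phi^p=0$) and $\gamma^{p+1}=(\partial f_1^p,f_1^{p+1})$. Suppose that $f^q=A\circ f^r$ for some integers $q,r$ and some $A\in O(6)$ with $\det A=-1$. If $q-r$ is even, then there is an integer $s$ such that $\alpha^s$ vanishes identically in every adapted coordinate for $f^s$. If $q-r$ is odd, then there is an integer $s$ such that $\gamma^{s+1}$ vanishes identically in every adapted coordinate for $f^s$. -/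

import Mathlib

open scoped Manifold ContDiff InnerProductSpace

noncomputable section

namespace MinimalSphere

/-- Euclidean 6-space. -/
abbrev E6 : Type := EuclideanSpace ℝ (Fin 6)

/-- The inclusion of `ℝ⁶` in `ℂ⁶`. On `ℂ⁶ = Fin 6 → ℂ` the complex bilinear extension
of the Euclidean inner product is the dot product `u ⬝ᵥ v`. -/
def toC (v : E6) : Fin 6 → ℂ := fun i => (v i : ℂ)

/-- The operator `∂ = ∂/∂z = (∂/∂x - i ∂/∂y)/2` on `ℂ⁶`-valued functions. -/
def dz (h : ℂ → Fin 6 → ℂ) (w : ℂ) : Fin 6 → ℂ :=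
  (1 / 2 : ℂ) • (fderiv ℝ h w 1 - Complex.I • fderiv ℝ h w Complex.I)

/-! ### Local differential geometry of a map `g` from a coordinate domain in `ℂ` to `S⁵ ⊆ ℝ⁶` -/

/-- The second fundamental form in `S⁵` of an immersion `g`: the component of the second
derivative orthogonal to the position vector and to the tangent plane. -/
def secondFF (g : ℂ → E6) (w X Y : ℂ) : E6 :=
  (Submodule.span ℝ {g w} ⊔ LinearMap.range (fderiv ℝ g w).toLinearMap)ᗮ.starProjection
    (fderiv ℝ (fderiv ℝ g) w X Y)

/-- The ellipse of curvature: the image of the unit circle of the tangent plane. -/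
def ellipse (g : ℂ → E6) (w : ℂ) : Set E6 :=
  {v | ∃ X : ℂ, ‖fderiv ℝ g w X‖ = 1 ∧ v = secondFF g w X X}

/-- The ellipse of curvature is not degenerate: it is neither a point nor a segment. -/
def EllipseNondegenerate (g : ℂ → E6) (w : ℂ) : Prop :=
  Module.finrank ℝ (Submodule.span ℝ (ellipse g w)) = 2

/-- The ellipse of curvature (which is centred at the origin) is a circle. -/
def EllipseCircular (g : ℂ → E6) (w : ℂ) : Prop :=
  ∃ r : ℝ, ∀ v ∈ ellipse g w, ‖v‖ = r

/-- `f₁ = ∂ f`. -/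
def f1 (g : ℂ → E6) (w : ℂ) : Fin 6 → ℂ := dz (fun u => toC (g u)) w

/-- The real part `a` of `II(∂, ∂) = a - i b`. -/
def aVec (g : ℂ → E6) (w : ℂ) : E6 :=
  (1 / 4 : ℝ) • (secondFF g w 1 1 - secondFF g w Complex.I Complex.I)

/-- Minus the imaginary part, `b`, of `II(∂, ∂) = a - i b`. -/
def bVec (g : ℂ → E6) (w : ℂ) : E6 := (1 / 2 : ℝ) • secondFF g w 1 Complex.I

/-- `f₂ = II(∂, ∂)`, with `II` extended complex bilinearly. -/
def f2 (g : ℂ → E6) (w : ℂ) : Fin 6 → ℂ := toC (aVec g w) - Complex.I • toC (bVec g w)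

/-- The function `φ ≥ 0` with `|a| = sinh φ`; in an adapted coordinate, `|b| = cosh φ`. -/
def phi (g : ℂ → E6) (w : ℂ) : ℝ := Real.arsinh ‖aVec g w‖

/-- The vector product of `g, ∂g/∂x, ∂g/∂y, II(∂x, ∂x), II(∂x, ∂y)` in `ℝ⁶`: its inner product
with a vector `v` is the determinant of these five vectors followed by `v`. -/
def crossVec (g : ℂ → E6) (w : ℂ) : E6 :=
  WithLp.toLp 2 fun k : Fin 6 => Matrix.det (Matrix.of fun i j : Fin 6 =>
    (![g w, fderiv ℝ g w 1, fderiv ℝ g w Complex.I, secondFF g w 1 1,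
      secondFF g w 1 Complex.I, EuclideanSpace.single k (1 : ℝ)] i) j)

/-- The unit normal `N` orthogonal to the plane of the ellipse of curvature, for which
`g, ∂g/∂x, ∂g/∂y, II(∂x, ∂x), II(∂x, ∂y), N` is positively oriented. (It is `0` where these five
vectors are dependent, that is, in an adapted coordinate, where `a = 0`.) -/
def normal (g : ℂ → E6) (w : ℂ) : E6 := ‖crossVec g w‖⁻¹ • crossVec g w

/-- The (+)transform `-(1 / cosh φ) b / |b| + tanh φ N`. -/
def plusTransform (g : ℂ → E6) (w : ℂ) : E6 :=
  -((1 / Real.cosh (phi g w)) • (‖bVec g w‖⁻¹ • bVec g w)) + Real.tanh (phi g w) • normal g w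

/-- The (-)transform `-(1 / cosh φ) b / |b| - tanh φ N`. -/
def minusTransform (g : ℂ → E6) (w : ℂ) : E6 :=
  -((1 / Real.cosh (phi g w)) • (‖bVec g w‖⁻¹ • bVec g w)) - Real.tanh (phi g w) • normal g w

/-- The invariant `α = (∂ f₂, N)`. -/
def alpha (g : ℂ → E6) (w : ℂ) : ℂ := dz (f2 g) w ⬝ᵥ toC (normal g w)

/-- The invariant `γ = (∂ f₁, h₁)` of a pair of maps `g`, `h` (with `h` the (+)transform
of `g`), where `f₁ = ∂ g` and `h₁ = ∂ h`. -/
def gamma (g h : ℂ → E6) (w : ℂ) : ℂ := dz (f1 g) w ⬝ᵥ f1 h w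

/-! ### Oriented surfaces, minimal immersions, and the sequence of transforms -/

variable {S : Type*} [TopologicalSpace S] [ChartedSpace ℂ S]

/-- The given atlas of the surface `S` is an oriented atlas. -/
def IsOrientedAtlas (S : Type*) [TopologicalSpace S] [ChartedSpace ℂ S] : Prop :=
  ∀ e ∈ atlas ℂ S, ∀ e' ∈ atlas ℂ S, ∀ w ∈ (e.symm.trans e').source,
    0 < LinearMap.det (fderiv ℝ (e.symm.trans e') w).toLinearMap

/-- `z` is a smooth coordinate on an open subset of `S`, compatible with the orientation. -/
def IsOrientedCoordinate (z : OpenPartialHomeomorph S ℂ) : Prop :=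
  z ∈ IsManifold.maximalAtlas 𝓘(ℝ, ℂ) ∞ S ∧
  ∀ e ∈ atlas ℂ S, ∀ w ∈ (e.symm.trans z).source,
    0 < LinearMap.det (fderiv ℝ (e.symm.trans z) w).toLinearMap

/-- `f` is a smooth minimal immersion of the surface `S` into the unit sphere of `ℝ⁶`.
The conditions in charts do not depend on the chart. -/
structure IsMinimalImmersion (f : S → E6) : Prop where
  smooth : ContMDiff 𝓘(ℝ, ℂ) 𝓘(ℝ, E6) ∞ f
  norm_eq_one : ∀ x, ‖f x‖ = 1
  immersion : ∀ z ∈ IsManifold.maximalAtlas 𝓘(ℝ, ℂ) ∞ S, ∀ w ∈ z.target,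
    Function.Injective (fderiv ℝ (f ∘ z.symm) w)
  /-- The mean curvature vector in the sphere vanishes. -/
  minimal : ∀ z ∈ IsManifold.maximalAtlas 𝓘(ℝ, ℂ) ∞ S, ∀ w ∈ z.target, ∀ X Y : ℂ,
    ‖fderiv ℝ (f ∘ z.symm) w X‖ = 1 → ‖fderiv ℝ (f ∘ z.symm) w Y‖ = 1 →
    ⟪fderiv ℝ (f ∘ z.symm) w X, fderiv ℝ (f ∘ z.symm) w Y⟫_ℝ = 0 →
    secondFF (f ∘ z.symm) w X X + secondFF (f ∘ z.symm) w Y Y = 0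

/-- The ellipse of curvature of `f` is nowhere degenerate and nowhere a circle. -/
def HasNondegenerateNoncircularEllipse (f : S → E6) : Prop :=
  ∀ z ∈ IsManifold.maximalAtlas 𝓘(ℝ, ℂ) ∞ S, ∀ w ∈ z.target,
    EllipseNondegenerate (f ∘ z.symm) w ∧ ¬ EllipseCircular (f ∘ z.symm) w

/-- `z` is an adapted complex coordinate for `f`: it is oriented and isothermal for the metric
induced by `f` (a complex coordinate of the Riemann surface `S`), and `(f₂, f₂) = -1`. -/
def IsAdapted (f : S → E6) (z : OpenPartialHomeomorph S ℂ) : Prop :=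
  IsOrientedCoordinate z ∧ ∀ w ∈ z.target,
    f1 (f ∘ z.symm) w ⬝ᵥ f1 (f ∘ z.symm) w = 0 ∧ f2 (f ∘ z.symm) w ⬝ᵥ f2 (f ∘ z.symm) w = -1

/-- `F` is the sequence of maps determined by `f`: `F 0 = f`, and, near every point, there is an
adapted complex coordinate `z` for `f` in which `F 1, F 2, …` arise from `f` by repeating the
(+)construction and `F (-1), F (-2), …` by repeating the (-)construction. (An adapted coordinate
is unique up to translations and rotations by multiples of `π / 2`; a rotation by `π / 2` replaces
`b` by `-b`, so that `z` has to be the same for all the maps of the sequence.) -/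
def IsTransformSequence (f : S → E6) (F : ℤ → S → E6) : Prop :=
  F 0 = f ∧ ∀ x : S, ∃ z : OpenPartialHomeomorph S ℂ, x ∈ z.source ∧ IsAdapted f z ∧
    ∀ p : ℕ, ∀ y ∈ z.source,
      F ((p : ℤ) + 1) y = plusTransform (F (p : ℤ) ∘ z.symm) (z y) ∧
      F (-(p : ℤ) - 1) y = minusTransform (F (-(p : ℤ)) ∘ z.symm) (z y)

end MinimalSphere

end

open MinimalSphere

/-! In an adapted coordinate, complexify and write `f₂ = a - i b`. Call a real unit normal field `K`
of a minimal surface `G` polar if `(K, f₂) = i`, that is, `(K, a) = 0` and `(K, b) = -1`. The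
vectors `G, ∂G/∂x, ∂G/∂y, a, b` leave one free direction in `ℝ⁶` where `a ≠ 0`, so there are exactly
two polar vectors at such a point, the (+) and the (-)transform. The sign of a determinant tells
them apart.

A polar of a minimal surface is again minimal, with the same adapted coordinate, and the relation is
symmetric (`IsPolar.isAdaptedMinimal`, `IsPolar.symm`). By the Codazzi equation `∂f̄₂` is a multiple
of `∂̄G`. Hence `∂K`, and then `∂∂K`, are orthogonal to `∂̄G` and `f̄₂`. Together with orthogonality
to `K`, this puts them in the span of `G`, `∂̄G` and `f̄₂ + i K`, on which the only nonzero product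
is `(G, G)`. Conformality and adaptedness follow from `(∂K, G) = 0` and `(∂∂K, G) = i`. The interior
of the zero set of `a` needs a separate argument, and continuity covers the remaining points.

Comparing the frames of `G` and `K` shows that their determinants differ by a factor `-δ` with `δ ≥
0` (`IsPolar.sixDet_eq`). So `G` is the (-)transform of its (+)transform. An orthogonal map of
determinant `-1` reverses `N` and exchanges the two transforms; conjugation by `A` therefore gives
the other composite. The sequence is thus a chain in which every step forwards is a (+)transform and
every step backwards a (-)transform (`isAdaptedMinimal_sequence`).

Consequently `f^q = A ∘ f^r` propagates to `f^(q-k) = A ∘ f^(r+k)` for all `k`. If `q - r` is even,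
the two indices meet: `f^s = A ∘ f^s`, and `α^s` vanishes since a reflection changes its sign. If `q
- r` is odd, `A` exchanges `f^s` and `f^(s+1)`. Then `γ^(s+1)` is symmetric in the two maps, so it
is half of `∂(f₁^s, f₁^(s+1))`. This product is a quadratic differential whose square is the quartic
differential `(f₂, f₂) = -1`, so its derivative is zero. -/

open Matrix

/-! ### Wirtinger calculus -/

section Wirtinger

variable {V : Type*} [NormedAddCommGroup V] [NormedSpace ℝ V] [NormedSpace ℂ V]

/-- The Wirtinger derivative `∂/∂z`. -/
noncomputable def wirtinger (h : ℂ → V) (w : ℂ) : V :=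
  (1 / 2 : ℂ) • (fderiv ℝ h w 1 - Complex.I • fderiv ℝ h w Complex.I)

/-- The Wirtinger derivative `∂/∂z̄`. -/
noncomputable def wirtingerBar (h : ℂ → V) (w : ℂ) : V :=
  (1 / 2 : ℂ) • (fderiv ℝ h w 1 + Complex.I • fderiv ℝ h w Complex.I)

theorem wirtinger_congr {h k : ℂ → V} {w : ℂ} (e : h =ᶠ[nhds w] k) :
    wirtinger h w = wirtinger k w := by
  unfold wirtinger; rw [e.fderiv_eq]

theorem wirtingerBar_congr {h k : ℂ → V} {w : ℂ} (e : h =ᶠ[nhds w] k) :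
    wirtingerBar h w = wirtingerBar k w := by
  unfold wirtingerBar; rw [e.fderiv_eq]

theorem wirtinger_const (c : V) (w : ℂ) : wirtinger (fun _ => c) w = 0 := by
  simp [wirtinger]

theorem wirtingerBar_const (c : V) (w : ℂ) : wirtingerBar (fun _ => c) w = 0 := by
  simp [wirtingerBar]

/-- Stated for a general bilinear map so that the product rules for scalar multiplication and for
the dot product are both instances. Complex homogeneity in each slot lets the factor `i` in `∂` pass
through. -/
theorem wirtinger_bilin {V₁ V₂ : Type*} [NormedAddCommGroup V₁] [NormedSpace ℝ V₁]
    [NormedSpace ℂ V₁] [NormedAddCommGroup V₂] [NormedSpace ℝ V₂] [NormedSpace ℂ V₂]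
    (b : V₁ →L[ℝ] V₂ →L[ℝ] V) (hb₁ : ∀ (c : ℂ) u v, b (c • u) v = c • b u v)
    (hb₂ : ∀ (c : ℂ) u v, b u (c • v) = c • b u v) {u : ℂ → V₁} {v : ℂ → V₂} {w : ℂ}
    (hu : DifferentiableAt ℝ u w) (hv : DifferentiableAt ℝ v w) :
    wirtinger (fun z => b (u z) (v z)) w = b (wirtinger u w) (v w) + b (u w) (wirtinger v w) := by
  have h := (b.hasFDerivAt_of_bilinear hu.hasFDerivAt hv.hasFDerivAt).fderiv
  simp only [wirtinger, h, hb₁, hb₂, map_sub, _root_.add_apply,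
    ContinuousLinearMap.precompR, ContinuousLinearMap.precompL_apply,
    ContinuousLinearMap.compL_apply, ContinuousLinearMap.comp_apply,
    _root_.sub_apply]
  module

theorem wirtingerBar_bilin {V₁ V₂ : Type*} [NormedAddCommGroup V₁] [NormedSpace ℝ V₁]
    [NormedSpace ℂ V₁] [NormedAddCommGroup V₂] [NormedSpace ℝ V₂] [NormedSpace ℂ V₂]
    (b : V₁ →L[ℝ] V₂ →L[ℝ] V) (hb₁ : ∀ (c : ℂ) u v, b (c • u) v = c • b u v)
    (hb₂ : ∀ (c : ℂ) u v, b u (c • v) = c • b u v) {u : ℂ → V₁} {v : ℂ → V₂} {w : ℂ}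
    (hu : DifferentiableAt ℝ u w) (hv : DifferentiableAt ℝ v w) :
    wirtingerBar (fun z => b (u z) (v z)) w =
      b (wirtingerBar u w) (v w) + b (u w) (wirtingerBar v w) := by
  have h := (b.hasFDerivAt_of_bilinear hu.hasFDerivAt hv.hasFDerivAt).fderiv
  simp only [wirtingerBar, h, hb₁, hb₂, map_add, _root_.add_apply,
    ContinuousLinearMap.precompR, ContinuousLinearMap.precompL_apply,
    ContinuousLinearMap.compL_apply, ContinuousLinearMap.comp_apply]
  module

theorem wirtinger_sub {h k : ℂ → V} {w : ℂ} (hh : DifferentiableAt ℝ h w)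
    (hk : DifferentiableAt ℝ k w) :
    wirtinger (fun z => h z - k z) w = wirtinger h w - wirtinger k w := by
  simp only [wirtinger, fderiv_fun_sub hh hk, _root_.sub_apply]
  module

theorem wirtingerBar_sub {h k : ℂ → V} {w : ℂ} (hh : DifferentiableAt ℝ h w)
    (hk : DifferentiableAt ℝ k w) :
    wirtingerBar (fun z => h z - k z) w = wirtingerBar h w - wirtingerBar k w := by
  simp only [wirtingerBar, fderiv_fun_sub hh hk, _root_.sub_apply]
  module

variable [IsScalarTower ℝ ℂ V]

theorem wirtinger_smul {c : ℂ → ℂ} {h : ℂ → V} {w : ℂ} (hc : DifferentiableAt ℝ c w)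
    (hh : DifferentiableAt ℝ h w) :
    wirtinger (fun z => c z • h z) w = wirtinger c w • h w + c w • wirtinger h w := by
  have := wirtinger_bilin (V := V) (ContinuousLinearMap.lsmul ℝ ℂ)
    (fun c u v => by simp [mul_smul]) (fun c u v => by simp [smul_smul, mul_comm]) hc hh
  simpa using this

theorem wirtingerBar_smul {c : ℂ → ℂ} {h : ℂ → V} {w : ℂ} (hc : DifferentiableAt ℝ c w)
    (hh : DifferentiableAt ℝ h w) :
    wirtingerBar (fun z => c z • h z) w = wirtingerBar c w • h w + c w • wirtingerBar h w := by
  have := wirtingerBar_bilin (V := V) (ContinuousLinearMap.lsmul ℝ ℂ)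
    (fun c u v => by simp [mul_smul]) (fun c u v => by simp [smul_smul, mul_comm]) hc hh
  simpa using this

theorem fderiv_apply_wirtinger (h : ℂ → V) (w X : ℂ) :
    fderiv ℝ h w X = X • wirtinger h w + (starRingEnd ℂ X) • wirtingerBar h w := by
  have : X = X.re • (1 : ℂ) + X.im • Complex.I := by
    simp [Complex.re_add_im]
  have h1 : fderiv ℝ h w X = X.re • fderiv ℝ h w 1 + X.im • fderiv ℝ h w Complex.I := by
    conv_lhs => rw [this]
    rw [map_add, map_smul, map_smul]
  rw [h1, wirtinger, wirtingerBar, ← algebraMap_smul ℂ X.re, ← algebraMap_smul ℂ X.im]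
  simp only [smul_sub, smul_add, smul_smul]
  have e1 : starRingEnd ℂ X = X.re - X.im * Complex.I := by
    apply Complex.ext <;> simp
  have e2 : X = X.re + X.im * Complex.I := by simp [Complex.re_add_im]
  rw [e1]
  simp only [Complex.coe_algebraMap]
  match_scalars
  · linear_combination (-1 / 2 : ℂ) * e2
  · linear_combination (Complex.I / 2) * e2 + (X.im : ℂ) * Complex.I_mul_I
end Wirtinger

/-! ### Smoothness and second-order Wirtinger derivatives -/

section Smooth

variable {V : Type*} [NormedAddCommGroup V] [NormedSpace ℝ V] {U : Set ℂ}

theorem ContDiffOn.diffAt (hU : IsOpen U) {h : ℂ → V} (hh : ContDiffOn ℝ ∞ h U) {w : ℂ}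
    (hw : w ∈ U) : DifferentiableAt ℝ h w :=
  (hh.contDiffAt (hU.mem_nhds hw)).differentiableAt (by simp)

theorem contDiffOn_fderiv (hU : IsOpen U) {h : ℂ → V} (hh : ContDiffOn ℝ ∞ h U) :
    ContDiffOn ℝ ∞ (fderiv ℝ h) U :=
  hh.fderiv_of_isOpen hU (by simp)

theorem contDiffOn_fderiv_apply (hU : IsOpen U) {h : ℂ → V} (hh : ContDiffOn ℝ ∞ h U) (X : ℂ) :
    ContDiffOn ℝ ∞ (fun w => fderiv ℝ h w X) U :=
  (contDiffOn_fderiv hU hh).clm_apply contDiffOn_const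

theorem fderiv_fderiv_apply (hU : IsOpen U) {h : ℂ → V} (hh : ContDiffOn ℝ ∞ h U) {w : ℂ}
    (hw : w ∈ U) (X Y : ℂ) :
    fderiv ℝ (fun u => fderiv ℝ h u X) w Y = fderiv ℝ (fderiv ℝ h) w Y X := by
  have := ((contDiffOn_fderiv hU hh).diffAt hU hw).hasFDerivAt.clm_apply (hasFDerivAt_const X w)
  rw [this.fderiv]; simp

theorem fderiv_fderiv_symm (hU : IsOpen U) {h : ℂ → V} (hh : ContDiffOn ℝ ∞ h U) {w : ℂ}
    (hw : w ∈ U) (X Y : ℂ) :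
    fderiv ℝ (fderiv ℝ h) w X Y = fderiv ℝ (fderiv ℝ h) w Y X :=
  ((hh.contDiffAt (hU.mem_nhds hw)).isSymmSndFDerivAt (by simp only [minSmoothness_of_isRCLikeNormedField]; exact WithTop.coe_le_coe.mpr le_top)) X Y

variable [NormedSpace ℂ V]

theorem ContDiffOn.const_csmul [IsScalarTower ℝ ℂ V] {h : ℂ → V} (hh : ContDiffOn ℝ ∞ h U)
    (c : ℂ) : ContDiffOn ℝ ∞ (fun w => c • h w) U :=
  ContDiff.comp_contDiffOn (ContinuousLinearMap.lsmul ℝ ℂ c : V →L[ℝ] V).contDiff hh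

theorem ContDiffOn.wirtinger [IsScalarTower ℝ ℂ V] (hU : IsOpen U) {h : ℂ → V}
    (hh : ContDiffOn ℝ ∞ h U) : ContDiffOn ℝ ∞ (wirtinger h) U :=
  ((contDiffOn_fderiv_apply hU hh 1).sub
    ((contDiffOn_fderiv_apply hU hh Complex.I).const_csmul _)).const_csmul _

theorem ContDiffOn.wirtingerBar [IsScalarTower ℝ ℂ V] (hU : IsOpen U) {h : ℂ → V}
    (hh : ContDiffOn ℝ ∞ h U) : ContDiffOn ℝ ∞ (wirtingerBar h) U :=
  ((contDiffOn_fderiv_apply hU hh 1).add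
    ((contDiffOn_fderiv_apply hU hh Complex.I).const_csmul _)).const_csmul _

theorem fderiv_const_csmul [IsScalarTower ℝ ℂ V] {h : ℂ → V} {w : ℂ}
    (hh : DifferentiableAt ℝ h w) (c : ℂ) (X : ℂ) :
    fderiv ℝ (fun u => c • h u) w X = c • fderiv ℝ h w X := by
  have := ((ContinuousLinearMap.lsmul ℝ ℂ c : V →L[ℝ] V).hasFDerivAt (x := h w)).comp w
    hh.hasFDerivAt
  exact congrArg (fun T : ℂ →L[ℝ] V => T X) this.fderiv

theorem fderiv_wirtinger [IsScalarTower ℝ ℂ V] (hU : IsOpen U) {h : ℂ → V}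
    (hh : ContDiffOn ℝ ∞ h U) {w : ℂ} (hw : w ∈ U) (X : ℂ) :
    fderiv ℝ (wirtinger h) w X = (1 / 2 : ℂ) • (fderiv ℝ (fderiv ℝ h) w X 1 -
      Complex.I • fderiv ℝ (fderiv ℝ h) w X Complex.I) := by
  have d1 := (contDiffOn_fderiv_apply hU hh 1).diffAt hU hw
  have d2 := (contDiffOn_fderiv_apply hU hh Complex.I)
  have d3 := (d2.const_csmul Complex.I).diffAt hU hw
  change fderiv ℝ (fun w => (1 / 2 : ℂ) • (fderiv ℝ h w 1 - Complex.I • fderiv ℝ h w Complex.I)) w X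
    = _
  rw [fderiv_const_csmul (h := fun w => fderiv ℝ h w 1 - Complex.I • fderiv ℝ h w Complex.I)
    (d1.sub d3), fderiv_fun_sub d1 d3, _root_.sub_apply,
    fderiv_const_csmul (d2.diffAt hU hw), fderiv_fderiv_apply hU hh hw,
    fderiv_fderiv_apply hU hh hw]

theorem fderiv_wirtingerBar [IsScalarTower ℝ ℂ V] (hU : IsOpen U) {h : ℂ → V}
    (hh : ContDiffOn ℝ ∞ h U) {w : ℂ} (hw : w ∈ U) (X : ℂ) :
    fderiv ℝ (wirtingerBar h) w X = (1 / 2 : ℂ) • (fderiv ℝ (fderiv ℝ h) w X 1 +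
      Complex.I • fderiv ℝ (fderiv ℝ h) w X Complex.I) := by
  have d1 := (contDiffOn_fderiv_apply hU hh 1).diffAt hU hw
  have d2 := (contDiffOn_fderiv_apply hU hh Complex.I)
  have d3 := (d2.const_csmul Complex.I).diffAt hU hw
  change fderiv ℝ (fun w => (1 / 2 : ℂ) • (fderiv ℝ h w 1 + Complex.I • fderiv ℝ h w Complex.I)) w X
    = _
  rw [fderiv_const_csmul (h := fun w => fderiv ℝ h w 1 + Complex.I • fderiv ℝ h w Complex.I)
    (d1.add d3), fderiv_fun_add d1 d3, _root_.add_apply,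
    fderiv_const_csmul (d2.diffAt hU hw), fderiv_fderiv_apply hU hh hw,
    fderiv_fderiv_apply hU hh hw]

theorem wirtinger_wirtingerBar_comm [IsScalarTower ℝ ℂ V] (hU : IsOpen U) {h : ℂ → V}
    (hh : ContDiffOn ℝ ∞ h U) {w : ℂ} (hw : w ∈ U) :
    wirtinger (wirtingerBar h) w = wirtingerBar (wirtinger h) w := by
  rw [wirtinger, fderiv_wirtingerBar hU hh hw, fderiv_wirtingerBar hU hh hw,
    wirtingerBar, fderiv_wirtinger hU hh hw, fderiv_wirtinger hU hh hw,
    fderiv_fderiv_symm hU hh hw 1 Complex.I]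
  module

theorem wirtinger_wirtinger [IsScalarTower ℝ ℂ V] (hU : IsOpen U) {h : ℂ → V}
    (hh : ContDiffOn ℝ ∞ h U) {w : ℂ} (hw : w ∈ U) :
    wirtinger (wirtinger h) w = (1 / 4 : ℂ) • (fderiv ℝ (fderiv ℝ h) w 1 1 -
      fderiv ℝ (fderiv ℝ h) w Complex.I Complex.I) -
      (Complex.I * (1 / 2)) • fderiv ℝ (fderiv ℝ h) w 1 Complex.I := by
  rw [wirtinger, fderiv_wirtinger hU hh hw, fderiv_wirtinger hU hh hw,
    fderiv_fderiv_symm hU hh hw Complex.I 1]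
  match_scalars <;> ring_nf; norm_num

theorem wirtingerBar_wirtinger [IsScalarTower ℝ ℂ V] (hU : IsOpen U) {h : ℂ → V}
    (hh : ContDiffOn ℝ ∞ h U) {w : ℂ} (hw : w ∈ U) :
    wirtingerBar (wirtinger h) w = (1 / 4 : ℂ) • (fderiv ℝ (fderiv ℝ h) w 1 1 +
      fderiv ℝ (fderiv ℝ h) w Complex.I Complex.I) := by
  rw [wirtingerBar, fderiv_wirtinger hU hh hw, fderiv_wirtinger hU hh hw,
    fderiv_fderiv_symm hU hh hw Complex.I 1]
  match_scalars <;> ring_nf; norm_num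

end Smooth

/-! ### Calculus in `ℂ⁶` with the complex bilinear product -/

section Dot

variable {U : Set ℂ}

/-- The dot product of `ℂ⁶` as a continuous bilinear map. -/
noncomputable def dotL : (Fin 6 → ℂ) →L[ℝ] (Fin 6 → ℂ) →L[ℝ] ℂ :=
  (LinearMap.mk₂ ℝ (fun u v : Fin 6 → ℂ => u ⬝ᵥ v) add_dotProduct
    (fun c u v => smul_dotProduct c u v) dotProduct_add
    (fun c u v => dotProduct_smul c u v)).toContinuousBilinearMap

theorem dz_eq_wirtinger (h : ℂ → Fin 6 → ℂ) : dz h = wirtinger h := rfl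

theorem wirtinger_dot {u v : ℂ → Fin 6 → ℂ} {w : ℂ} (hu : DifferentiableAt ℝ u w)
    (hv : DifferentiableAt ℝ v w) :
    wirtinger (fun z => u z ⬝ᵥ v z) w = wirtinger u w ⬝ᵥ v w + u w ⬝ᵥ wirtinger v w :=
  wirtinger_bilin dotL (fun c u v => smul_dotProduct c u v) (fun c u v => dotProduct_smul c u v)
    hu hv

theorem wirtingerBar_dot {u v : ℂ → Fin 6 → ℂ} {w : ℂ} (hu : DifferentiableAt ℝ u w)
    (hv : DifferentiableAt ℝ v w) :
    wirtingerBar (fun z => u z ⬝ᵥ v z) w = wirtingerBar u w ⬝ᵥ v w + u w ⬝ᵥ wirtingerBar v w :=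
  wirtingerBar_bilin dotL (fun c u v => smul_dotProduct c u v)
    (fun c u v => dotProduct_smul c u v) hu hv

theorem ContDiffOn.dot {u v : ℂ → Fin 6 → ℂ} (hu : ContDiffOn ℝ ∞ u U) (hv : ContDiffOn ℝ ∞ v U) :
    ContDiffOn ℝ ∞ (fun z => u z ⬝ᵥ v z) U :=
  (dotL.contDiff.comp_contDiffOn hu).clm_apply hv

theorem ContDiffOn.star_pi {u : ℂ → Fin 6 → ℂ} (hu : ContDiffOn ℝ ∞ u U) :
    ContDiffOn ℝ ∞ (fun z => star (u z)) U :=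
  (starL' ℝ : (Fin 6 → ℂ) ≃L[ℝ] (Fin 6 → ℂ)).contDiff.comp_contDiffOn hu

theorem wirtinger_star (u : ℂ → Fin 6 → ℂ) (w : ℂ) :
    wirtinger (fun z => star (u z)) w = star (wirtingerBar u w) := by
  have h := (starL' ℝ : (Fin 6 → ℂ) ≃L[ℝ] (Fin 6 → ℂ)).comp_fderiv (f := u) (x := w)
  have h' : fderiv ℝ (fun z => star (u z)) w =
    ((starL' ℝ : (Fin 6 → ℂ) ≃L[ℝ] (Fin 6 → ℂ)) : (Fin 6 → ℂ) →L[ℝ] (Fin 6 → ℂ)).comp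
      (fderiv ℝ u w) := h
  rw [wirtinger, wirtingerBar, h']
  simp [sub_eq_add_neg]

theorem wirtingerBar_star (u : ℂ → Fin 6 → ℂ) (w : ℂ) :
    wirtingerBar (fun z => star (u z)) w = star (wirtinger u w) := by
  have h := wirtinger_star (fun z => star (u z)) w
  simp only [star_star] at h
  rw [← star_star (wirtingerBar _ _), ← h]

/-- If `u ⬝ᵥ v` is constant, differentiation moves from one factor to the other. -/
theorem wirtinger_dot_of_const (hU : IsOpen U) {u v : ℂ → Fin 6 → ℂ} (hu : ContDiffOn ℝ ∞ u U)
    (hv : ContDiffOn ℝ ∞ v U) {c : ℂ} (h : ∀ w ∈ U, u w ⬝ᵥ v w = c) {w : ℂ} (hw : w ∈ U) :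
    wirtinger u w ⬝ᵥ v w = -(u w ⬝ᵥ wirtinger v w) := by
  have h1 := wirtinger_dot (hu.diffAt hU hw) (hv.diffAt hU hw)
  have h2 : (fun z => u z ⬝ᵥ v z) =ᶠ[nhds w] fun _ => c :=
    Filter.eventually_of_mem (hU.mem_nhds hw) h
  rw [wirtinger_congr h2, wirtinger_const] at h1
  linear_combination -h1

theorem wirtingerBar_dot_of_const (hU : IsOpen U) {u v : ℂ → Fin 6 → ℂ}
    (hu : ContDiffOn ℝ ∞ u U) (hv : ContDiffOn ℝ ∞ v U) {c : ℂ}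
    (h : ∀ w ∈ U, u w ⬝ᵥ v w = c) {w : ℂ} (hw : w ∈ U) :
    wirtingerBar u w ⬝ᵥ v w = -(u w ⬝ᵥ wirtingerBar v w) := by
  have h1 := wirtingerBar_dot (hu.diffAt hU hw) (hv.diffAt hU hw)
  have h2 : (fun z => u z ⬝ᵥ v z) =ᶠ[nhds w] fun _ => c :=
    Filter.eventually_of_mem (hU.mem_nhds hw) h
  rw [wirtingerBar_congr h2, wirtingerBar_const] at h1
  linear_combination -h1

theorem wirtinger_dot_self_of_const (hU : IsOpen U) {u : ℂ → Fin 6 → ℂ}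
    (hu : ContDiffOn ℝ ∞ u U) {c : ℂ} (h : ∀ w ∈ U, u w ⬝ᵥ u w = c) {w : ℂ} (hw : w ∈ U) :
    wirtinger u w ⬝ᵥ u w = 0 := by
  have h1 := wirtinger_dot_of_const hU hu hu h hw
  rw [dotProduct_comm (u w)] at h1
  exact self_eq_neg.mp h1

theorem wirtingerBar_dot_self_of_const (hU : IsOpen U) {u : ℂ → Fin 6 → ℂ}
    (hu : ContDiffOn ℝ ∞ u U) {c : ℂ} (h : ∀ w ∈ U, u w ⬝ᵥ u w = c) {w : ℂ} (hw : w ∈ U) :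
    wirtingerBar u w ⬝ᵥ u w = 0 := by
  have h1 := wirtingerBar_dot_of_const hU hu hu h hw
  rw [dotProduct_comm (u w)] at h1
  exact self_eq_neg.mp h1

/-- Two continuous functions on an open set agree if they agree where a continuous function `a`
does not vanish and in the interior of its zero set. -/
theorem eqOn_of_ne_zero_or_eventually_zero {X Y : Type*} [TopologicalSpace X] [T2Space X]
    [Zero Y] (hU : IsOpen U) {a : ℂ → Y} {p q : ℂ → X}
    (hp : ContinuousOn p U) (hq : ContinuousOn q U)
    (h₁ : ∀ w ∈ U, a w ≠ 0 → p w = q w)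
    (h₂ : ∀ w ∈ U, (∀ᶠ z in nhds w, a z = 0) → p w = q w) {w : ℂ} (hw : w ∈ U) : p w = q w := by
  by_contra hne
  have c1 := hp.continuousAt (hU.mem_nhds hw)
  have c2 := hq.continuousAt (hU.mem_nhds hw)
  -- Disagreement is an open condition, so the first hypothesis forces `a` to vanish on a whole
  -- neighbourhood of `w`, where the second one applies.
  have : ∀ᶠ z in nhds w, p z ≠ q z := (c1.ne_iff_eventually_ne c2).1 hne
  refine hne (h₂ w hw ?_)
  filter_upwards [this, hU.mem_nhds hw] with z hz hzU
  by_contra h0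
  exact hz (h₁ z hzU h0)

end Dot

/-! ### Minimal surfaces in adapted coordinates, in complex notation -/

/-- `G` is the complexification of a conformal immersion of `U` into the unit sphere. -/
structure IsConformalImmersion (U : Set ℂ) (G : ℂ → Fin 6 → ℂ) : Prop where
  smooth : ContDiffOn ℝ ∞ G U
  real : ∀ w ∈ U, star (G w) = G w
  dot_self : ∀ w ∈ U, G w ⬝ᵥ G w = 1
  conformal : ∀ w ∈ U, wirtinger G w ⬝ᵥ wirtinger G w = 0
  ne_zero : ∀ w ∈ U, wirtinger G w ≠ 0

/-- `G` is the complexification of a minimal immersion into the unit sphere given in an adapted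
complex coordinate on `U`. -/
structure IsAdaptedMinimal (U : Set ℂ) (G : ℂ → Fin 6 → ℂ) : Prop extends
    IsConformalImmersion U G where
  minimal : ∀ w ∈ U, wirtingerBar (wirtinger G) w =
    -(wirtinger G w ⬝ᵥ star (wirtinger G w)) • G w
  adapted : ∀ w ∈ U, wirtinger (wirtinger G) w ⬝ᵥ wirtinger (wirtinger G) w = -1

/-- The part of `∂∂G` orthogonal to the surface. -/
noncomputable def normalSecond (G : ℂ → Fin 6 → ℂ) (w : ℂ) : Fin 6 → ℂ :=
  wirtinger (wirtinger G) w -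
    ((wirtinger (wirtinger G) w ⬝ᵥ star (wirtinger G w)) /
      (wirtinger G w ⬝ᵥ star (wirtinger G w))) • wirtinger G w

open scoped ComplexOrder in
theorem dotProduct_star_self_ne_zero {v : Fin 6 → ℂ} (hv : v ≠ 0) : v ⬝ᵥ star v ≠ 0 := by
  rw [dotProduct_comm]; exact fun h => hv (dotProduct_star_self_eq_zero.1 h)

theorem star_dotProduct_star_self (v : Fin 6 → ℂ) : star (v ⬝ᵥ star v) = v ⬝ᵥ star v := by
  rw [← dotProduct_star]

theorem star_dot (u v : Fin 6 → ℂ) : star (u ⬝ᵥ v) = star u ⬝ᵥ star v := by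
  rw [star_dotProduct_star, dotProduct_comm]

theorem wirtinger_dot_star {v : Fin 6 → ℂ} {u : Fin 6 → ℂ} (h : star u = u) :
    u ⬝ᵥ star v = star (u ⬝ᵥ v) := by rw [star_dot, h]

namespace IsConformalImmersion

variable {U : Set ℂ} {G : ℂ → Fin 6 → ℂ} (hG : IsConformalImmersion U G) (hU : IsOpen U) {w : ℂ}
  (hw : w ∈ U)
include hG hU

theorem smooth_one : ContDiffOn ℝ ∞ (wirtinger G) U := hG.smooth.wirtinger hU

theorem smooth_two : ContDiffOn ℝ ∞ (wirtinger (wirtinger G)) U := (hG.smooth_one hU).wirtinger hU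

theorem smooth_normSq : ContDiffOn ℝ ∞ (fun w => wirtinger G w ⬝ᵥ star (wirtinger G w)) U :=
  (hG.smooth_one hU).dot (hG.smooth_one hU).star_pi

omit hU in
theorem normSq_ne (hw : w ∈ U) : wirtinger G w ⬝ᵥ star (wirtinger G w) ≠ 0 :=
  dotProduct_star_self_ne_zero (hG.ne_zero w hw)

theorem smooth_coeff : ContDiffOn ℝ ∞ (fun w => (wirtinger (wirtinger G) w ⬝ᵥ star (wirtinger G w)) /
      (wirtinger G w ⬝ᵥ star (wirtinger G w))) U := by
  simp only [div_eq_mul_inv]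
  exact ((hG.smooth_two hU).dot (hG.smooth_one hU).star_pi).mul ((hG.smooth_normSq hU).inv
    fun _ hw => hG.normSq_ne hw)

theorem smooth_normalSecond : ContDiffOn ℝ ∞ (normalSecond G) U :=
  (hG.smooth_two hU).sub ((hG.smooth_coeff hU).smul (hG.smooth_one hU))

include hw

theorem wirtingerBar_eq : wirtingerBar G w = star (wirtinger G w) := by
  have e : (fun z => star (G z)) =ᶠ[nhds w] G := Filter.eventually_of_mem (hU.mem_nhds hw) hG.real
  rw [← wirtingerBar_congr e, wirtingerBar_star]

theorem one_dot : wirtinger G w ⬝ᵥ G w = 0 :=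
  wirtinger_dot_self_of_const hU hG.smooth hG.dot_self hw

theorem star_one_dot : star (wirtinger G w) ⬝ᵥ G w = 0 := by
  have := congrArg star (hG.one_dot hU hw)
  rwa [star_dot, hG.real w hw, star_zero] at this

theorem two_dot : wirtinger (wirtinger G) w ⬝ᵥ G w = 0 := by
  rw [wirtinger_dot_of_const hU (hG.smooth_one hU) hG.smooth (fun z hz => hG.one_dot hU hz) hw,
    hG.conformal w hw, neg_zero]

theorem two_dot_one : wirtinger (wirtinger G) w ⬝ᵥ wirtinger G w = 0 :=
  wirtinger_dot_self_of_const hU (hG.smooth_one hU) hG.conformal hw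

theorem normalSecond_dot : normalSecond G w ⬝ᵥ G w = 0 := by
  rw [normalSecond, sub_dotProduct, smul_dotProduct, hG.two_dot hU hw, hG.one_dot hU hw]; simp

theorem normalSecond_dot_one : normalSecond G w ⬝ᵥ wirtinger G w = 0 := by
  rw [normalSecond, sub_dotProduct, smul_dotProduct, hG.two_dot_one hU hw, hG.conformal w hw]; simp

omit hU in
theorem normalSecond_dot_star_one : normalSecond G w ⬝ᵥ star (wirtinger G w) = 0 := by
  rw [normalSecond, sub_dotProduct, smul_dotProduct, smul_eq_mul,
    div_mul_cancel₀ _ (hG.normSq_ne hw), sub_self]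

/-- The tangential correction is a multiple of `∂G`, which is null and orthogonal to `∂∂G`; so `(f₂,
f₂)` can be computed with `∂∂G`. -/
theorem normalSecond_dot_self_eq : normalSecond G w ⬝ᵥ normalSecond G w =
    wirtinger (wirtinger G) w ⬝ᵥ wirtinger (wirtinger G) w := by
  have h : normalSecond G w ⬝ᵥ normalSecond G w =
      normalSecond G w ⬝ᵥ wirtinger (wirtinger G) w := by
    conv_lhs => enter [2]; rw [normalSecond]
    rw [dotProduct_sub, dotProduct_smul, hG.normalSecond_dot_one hU hw, smul_zero, sub_zero]
  rw [h, normalSecond, sub_dotProduct, smul_dotProduct,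
    dotProduct_comm (wirtinger G w) (wirtinger (wirtinger G) w), hG.two_dot_one hU hw,
    smul_zero, sub_zero]

end IsConformalImmersion

namespace IsAdaptedMinimal

variable {U : Set ℂ} {G : ℂ → Fin 6 → ℂ} (hG : IsAdaptedMinimal U G) (hU : IsOpen U) {w : ℂ}
  (hw : w ∈ U)
include hG hU

include hw

omit hU in
theorem wirtinger_star_one : wirtinger (fun z => star (wirtinger G z)) w =
    -(wirtinger G w ⬝ᵥ star (wirtinger G w)) • G w := by
  rw [wirtinger_star, hG.minimal w hw, star_smul, hG.real w hw, star_neg, star_dotProduct_star_self]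

theorem normalSecond_dot_self : normalSecond G w ⬝ᵥ normalSecond G w = -1 := by
  rw [hG.normalSecond_dot_self_eq hU hw, hG.adapted w hw]

/-- The Codazzi equation. Commuting derivatives turns `∂̄∂∂G` into `∂(-E G)` with `E = (∂G, ∂̄G)`.
Since `∂E = (∂∂G, ∂̄G)`, its `G`-component cancels the one from the tangential correction, and only
a multiple of `∂G` is left. -/
theorem exists_wirtingerBar_normalSecond :
    ∃ ρ : ℂ, wirtingerBar (normalSecond G) w = ρ • wirtinger G w := by
  have hc := hG.smooth_coeff hU
  have h1 : wirtingerBar (normalSecond G) w = _ :=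
    wirtingerBar_sub ((hG.smooth_two hU).diffAt hU hw) ((hc.smul (hG.smooth_one hU)).diffAt hU hw)
  rw [wirtingerBar_smul (hc.diffAt hU hw) ((hG.smooth_one hU).diffAt hU hw),
    ← wirtinger_wirtingerBar_comm hU (hG.smooth_one hU) hw] at h1
  have e : wirtingerBar (wirtinger G) =ᶠ[nhds w]
      fun z => (fun z => -(wirtinger G z ⬝ᵥ star (wirtinger G z))) z • G z :=
    Filter.eventually_of_mem (hU.mem_nhds hw) hG.minimal
  have hE := hG.smooth_normSq hU
  have hE' : wirtinger (fun w => wirtinger G w ⬝ᵥ star (wirtinger G w)) w =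
      wirtinger (wirtinger G) w ⬝ᵥ star (wirtinger G w) := by
    rw [wirtinger_dot ((hG.smooth_one hU).diffAt hU hw) ((hG.smooth_one hU).star_pi.diffAt hU hw),
      hG.wirtinger_star_one hw, dotProduct_smul, hG.one_dot hU hw, smul_zero, add_zero]
  have hneg : wirtinger (fun w => -(wirtinger G w ⬝ᵥ star (wirtinger G w))) w =
      -wirtinger (fun w => wirtinger G w ⬝ᵥ star (wirtinger G w)) w := by
    have := wirtinger_sub (differentiableAt_const (0 : ℂ)) (hE.diffAt hU hw)
    simpa [wirtinger_const] using this
  rw [wirtinger_congr e, wirtinger_smul (hE.neg.diffAt hU hw) (hG.smooth.diffAt hU hw), hneg, hE',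
    hG.minimal w hw] at h1
  refine ⟨-(wirtinger G w ⬝ᵥ star (wirtinger G w)) - wirtingerBar (fun w =>
    (wirtinger (wirtinger G) w ⬝ᵥ star (wirtinger G w)) /
      (wirtinger G w ⬝ᵥ star (wirtinger G w))) w, h1.trans ?_⟩
  have hn := hG.normSq_ne hw
  rw [smul_smul, mul_neg, div_mul_cancel₀ _ hn]
  module

end IsAdaptedMinimal

/-- The bilinear relations between the vectors `G, ∂G, ∂̄G, f₂, f̄₂` of a minimal surface and a
unit vector `k` with `(k, f₂) = i`. -/
structure IsSixFrame (f p q n m k : Fin 6 → ℂ) (E d : ℂ) : Prop where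
  ff : f ⬝ᵥ f = 1
  fp : f ⬝ᵥ p = 0
  fq : f ⬝ᵥ q = 0
  fn : f ⬝ᵥ n = 0
  fm : f ⬝ᵥ m = 0
  fk : f ⬝ᵥ k = 0
  pp : p ⬝ᵥ p = 0
  pq : p ⬝ᵥ q = E
  pn : p ⬝ᵥ n = 0
  pm : p ⬝ᵥ m = 0
  pk : p ⬝ᵥ k = 0
  qq : q ⬝ᵥ q = 0
  qn : q ⬝ᵥ n = 0
  qm : q ⬝ᵥ m = 0
  qk : q ⬝ᵥ k = 0
  nn : n ⬝ᵥ n = -1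
  nm : n ⬝ᵥ m = d + 1
  nk : n ⬝ᵥ k = Complex.I
  mm : m ⬝ᵥ m = -1
  mk' : m ⬝ᵥ k = -Complex.I
  kk : k ⬝ᵥ k = 1

/-! ### Linear algebra of the frame `G, ∂G, ∂̄G, f₂, f̄₂, K` -/

namespace IsSixFrame

variable {f p q n m k : Fin 6 → ℂ} {E d : ℂ} (h : IsSixFrame f p q n m k E d)
include h

/-- The Gram matrix is invertible when `E` and `d` are nonzero, so the six vectors form a basis of
`ℂ⁶`, and the dot product is nondegenerate. -/
theorem eq_zero (hE : E ≠ 0) (hd : d ≠ 0) {u : Fin 6 → ℂ} (uf : u ⬝ᵥ f = 0) (up : u ⬝ᵥ p = 0)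
    (uq : u ⬝ᵥ q = 0) (un : u ⬝ᵥ n = 0) (um : u ⬝ᵥ m = 0) (uk : u ⬝ᵥ k = 0) : u = 0 := by
  have pf := h.fp; have qf := h.fq; have nf := h.fn; have mf := h.fm; have kf := h.fk
  have qp := h.pq; have np := h.pn; have mp := h.pm; have kp := h.pk
  have nq := h.qn; have mq := h.qm; have kq := h.qk; have mn := h.nm; have kn := h.nk
  have km := h.mk'
  rw [dotProduct_comm] at pf qf nf mf kf qp np mp kp nq mq kq mn kn km
  have hli : LinearIndependent ℂ ![f, p, q, n, m, k] := by
    rw [Fintype.linearIndependent_iff]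
    intro g hg
    simp only [Fin.sum_univ_six, Matrix.cons_val] at hg
    have key : ∀ v : Fin 6 → ℂ, g 0 * (f ⬝ᵥ v) + g 1 * (p ⬝ᵥ v) + g 2 * (q ⬝ᵥ v) + g 3 * (n ⬝ᵥ v)
        + g 4 * (m ⬝ᵥ v) + g 5 * (k ⬝ᵥ v) = 0 := fun v => by
      have := congrArg (fun x => x ⬝ᵥ v) hg
      simpa [add_dotProduct, smul_dotProduct] using this
    have kf' := key f
    have kp' := key p
    have kq' := key q
    have kn' := key n
    have km' := key m
    have kk' := key k
    rw [h.ff, pf, qf, nf, mf, kf] at kf'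
    rw [h.fp, h.pp, qp, np, mp, kp] at kp'
    rw [h.fq, h.pq, h.qq, nq, mq, kq] at kq'
    rw [h.fn, h.pn, h.qn, h.nn, mn, kn] at kn'
    rw [h.fm, h.pm, h.qm, h.nm, h.mm, km] at km'
    rw [h.fk, h.pk, h.qk, h.nk, h.mk', h.kk] at kk'
    have g4 : g 4 = 0 := by
      have : d * g 4 = 0 := by
        linear_combination kn' - Complex.I * kk' + (g 3 - g 4) * Complex.I_mul_I
      exact (mul_eq_zero.1 this).resolve_left hd
    have g3 : g 3 = 0 := by
      have : d * g 3 = 0 := by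
        linear_combination km' + Complex.I * kk' - (g 3 - g 4) * Complex.I_mul_I
      exact (mul_eq_zero.1 this).resolve_left hd
    have g5 : g 5 = 0 := by rw [g3, g4] at kk'; linear_combination kk'
    have g0 : g 0 = 0 := by linear_combination kf'
    have g1 : g 1 = 0 := by
      have : E * g 1 = 0 := by linear_combination kq'
      exact (mul_eq_zero.1 this).resolve_left hE
    have g2 : g 2 = 0 := by
      have : E * g 2 = 0 := by linear_combination kp'
      exact (mul_eq_zero.1 this).resolve_left hE
    intro i
    fin_cases i <;> assumption
  have hspan := hli.span_eq_top_of_card_eq_finrank (by simp)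
  have hker : Submodule.span ℂ (Set.range ![f, p, q, n, m, k]) ≤
      LinearMap.ker (dotProductBilin ℂ ℂ u) := by
    rw [Submodule.span_le]
    rintro _ ⟨i, rfl⟩
    fin_cases i <;> simpa [LinearMap.mem_ker]
  refine dotProduct_eq_zero u fun v => ?_
  have : v ∈ LinearMap.ker (dotProductBilin ℂ ℂ u) := hker (hspan ▸ Submodule.mem_top)
  exact this

/-- A vector orthogonal to `k`, `q` and `m` is a combination of `f`, `q` and the null vector
`m + i k`. -/
theorem exists_eq (hE : E ≠ 0) (hd : d ≠ 0) {u : Fin 6 → ℂ} (uk : u ⬝ᵥ k = 0)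
    (uq : u ⬝ᵥ q = 0) (um : u ⬝ᵥ m = 0) :
    u = (u ⬝ᵥ f) • f + ((u ⬝ᵥ p) / E) • q + ((u ⬝ᵥ n) / d) • (m + Complex.I • k) := by
  have pf := h.fp; have qf := h.fq; have nf := h.fn; have mf := h.fm; have kf := h.fk
  have qp := h.pq; have np := h.pn; have mp := h.pm; have kp := h.pk
  have nq := h.qn; have mq := h.qm; have kq := h.qk; have mn := h.nm; have kn := h.nk
  have km := h.mk'
  rw [dotProduct_comm] at pf qf nf mf kf qp np mp kp nq mq kq mn kn km
  rw [← sub_eq_zero]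
  apply h.eq_zero hE hd <;>
    simp only [sub_dotProduct, add_dotProduct, smul_dotProduct, smul_eq_mul, h.ff, h.fp, h.fq, h.fn,
      h.fm, h.fk, h.qq, h.qn, h.qm, h.qk, h.mm, h.mk', h.kk, qf, mf, kf, qp, mp, kp, mq, kq, mn, kn,
      km, uk, uq, um]
  · ring
  · field_simp; ring
  · ring
  · linear_combination (-1 : ℂ) * div_mul_cancel₀ (u ⬝ᵥ n) hd -
      ((u ⬝ᵥ n) / d) * Complex.I_mul_I
  · linear_combination ((u ⬝ᵥ n) / d) * Complex.I_mul_I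
  · ring

/-- Pairing `u` with its own expansion leaves only the `f`-term, because `u` is orthogonal to `q`,
`m` and `k`. Applied to `∂K` and `∂∂K`, this yields conformality and adaptedness. -/
theorem dot_self_eq (hE : E ≠ 0) (hd : d ≠ 0) {u : Fin 6 → ℂ} (uk : u ⬝ᵥ k = 0)
    (uq : u ⬝ᵥ q = 0) (um : u ⬝ᵥ m = 0) : u ⬝ᵥ u = (u ⬝ᵥ f) ^ 2 := by
  conv_lhs => enter [2]; rw [h.exists_eq hE hd uk uq um]
  simp only [dotProduct_add, dotProduct_smul, smul_eq_mul, uk, uq, um]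
  ring

end IsSixFrame

/-- `K` is a real unit normal field of `G` with `(K, f₂) = i`. -/
structure IsPolar (U : Set ℂ) (G K : ℂ → Fin 6 → ℂ) : Prop where
  smooth : ContDiffOn ℝ ∞ K U
  real : ∀ w ∈ U, star (K w) = K w
  dot_self : ∀ w ∈ U, K w ⬝ᵥ K w = 1
  dot : ∀ w ∈ U, K w ⬝ᵥ G w = 0
  dot_one : ∀ w ∈ U, K w ⬝ᵥ wirtinger G w = 0
  dot_normalSecond : ∀ w ∈ U, K w ⬝ᵥ normalSecond G w = Complex.I

/-! ### Scalar products of the derivatives of a polar field -/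

namespace IsPolar

variable {U : Set ℂ} {G K : ℂ → Fin 6 → ℂ} (hK : IsPolar U G K) (hG : IsAdaptedMinimal U G)
  (hU : IsOpen U) {w : ℂ} (hw : w ∈ U)
include hK hG hU

omit hG in
theorem smooth_one : ContDiffOn ℝ ∞ (wirtinger K) U := hK.smooth.wirtinger hU

omit hG in
theorem smooth_two : ContDiffOn ℝ ∞ (wirtinger (wirtinger K)) U := (hK.smooth_one hU).wirtinger hU

include hw

omit hG in
theorem wirtingerBar_eq : wirtingerBar K w = star (wirtinger K w) := by
  have e : (fun z => star (K z)) =ᶠ[nhds w] K := Filter.eventually_of_mem (hU.mem_nhds hw) hK.real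
  rw [← wirtingerBar_congr e, wirtingerBar_star]

omit hG hU in
theorem dot_star_one : K w ⬝ᵥ star (wirtinger G w) = 0 := by
  rw [wirtinger_dot_star (hK.real w hw), hK.dot_one w hw, star_zero]

omit hG hU in
theorem dot_star_normalSecond : K w ⬝ᵥ star (normalSecond G w) = -Complex.I := by
  rw [wirtinger_dot_star (hK.real w hw), hK.dot_normalSecond w hw]; simp

omit hG in
theorem one_dot_self : wirtinger K w ⬝ᵥ K w = 0 :=
  wirtinger_dot_self_of_const hU hK.smooth hK.dot_self hw

theorem one_dot : wirtinger K w ⬝ᵥ G w = 0 := by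
  rw [wirtinger_dot_of_const hU hK.smooth hG.smooth hK.dot hw, hK.dot_one w hw, neg_zero]

theorem one_dot_star_one : wirtinger K w ⬝ᵥ star (wirtinger G w) = 0 := by
  rw [wirtinger_dot_of_const hU hK.smooth (hG.smooth_one hU).star_pi
    (fun _ hz => hK.dot_star_one hz) hw, hG.wirtinger_star_one hw, dotProduct_smul, hK.dot w hw]
  simp

theorem one_dot_one : wirtinger K w ⬝ᵥ wirtinger G w = -Complex.I := by
  rw [wirtinger_dot_of_const hU hK.smooth (hG.smooth_one hU) hK.dot_one hw]
  have h := hK.dot_normalSecond w hw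
  rw [normalSecond, dotProduct_sub, dotProduct_smul, hK.dot_one w hw, smul_zero, sub_zero] at h
  rw [h]

omit hK in
theorem exists_wirtinger_star_normalSecond :
    ∃ ρ : ℂ, wirtinger (fun z => star (normalSecond G z)) w = ρ • star (wirtinger G w) := by
  obtain ⟨ρ, hρ⟩ := hG.exists_wirtingerBar_normalSecond hU hw
  exact ⟨star ρ, by rw [wirtinger_star, hρ, star_smul]⟩

/-- Differentiating the constant `(K, f̄₂) = -i` moves `∂` to `f̄₂`, and by Codazzi `∂f̄₂` is a
multiple of `∂̄G`, which is orthogonal to `K`. -/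
theorem one_dot_star_normalSecond : wirtinger K w ⬝ᵥ star (normalSecond G w) = 0 := by
  obtain ⟨ρ, hρ⟩ := exists_wirtinger_star_normalSecond hG hU hw
  rw [wirtinger_dot_of_const hU hK.smooth (hG.smooth_normalSecond hU).star_pi
    (fun _ hz => hK.dot_star_normalSecond hz) hw, hρ, dotProduct_smul, hK.dot_star_one hw]
  simp

theorem two_dot : wirtinger (wirtinger K) w ⬝ᵥ G w = Complex.I := by
  rw [wirtinger_dot_of_const hU (hK.smooth_one hU) hG.smooth
    (fun z hz => hK.one_dot hG hU hz) hw, hK.one_dot_one hG hU hw, neg_neg]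

theorem two_dot_star_one : wirtinger (wirtinger K) w ⬝ᵥ star (wirtinger G w) = 0 := by
  rw [wirtinger_dot_of_const hU (hK.smooth_one hU) (hG.smooth_one hU).star_pi
    (fun z hz => hK.one_dot_star_one hG hU hz) hw, hG.wirtinger_star_one hw, dotProduct_smul,
    hK.one_dot hG hU hw]
  simp

theorem two_dot_star_normalSecond :
    wirtinger (wirtinger K) w ⬝ᵥ star (normalSecond G w) = 0 := by
  obtain ⟨ρ, hρ⟩ := exists_wirtinger_star_normalSecond hG hU hw
  rw [wirtinger_dot_of_const hU (hK.smooth_one hU) (hG.smooth_normalSecond hU).star_pi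
    (fun z hz => hK.one_dot_star_normalSecond hG hU hz) hw, hρ, dotProduct_smul,
    hK.one_dot_star_one hG hU hw]
  simp

omit hG in
theorem two_dot_self :
    wirtinger (wirtinger K) w ⬝ᵥ K w = -(wirtinger K w ⬝ᵥ wirtinger K w) :=
  wirtinger_dot_of_const hU (hK.smooth_one hU) hK.smooth (fun _ hz => hK.one_dot_self hU hz) hw

omit hG in
theorem bar_one_dot_self :
    wirtingerBar (wirtinger K) w ⬝ᵥ K w = -(wirtinger K w ⬝ᵥ star (wirtinger K w)) := by
  rw [wirtingerBar_dot_of_const hU (hK.smooth_one hU) hK.smooth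
    (fun z hz => hK.one_dot_self hU hz) hw, hK.wirtingerBar_eq hU hw]

theorem bar_one_dot : wirtingerBar (wirtinger K) w ⬝ᵥ G w = 0 := by
  rw [wirtingerBar_dot_of_const hU (hK.smooth_one hU) hG.smooth
    (fun z hz => hK.one_dot hG hU hz) hw, hG.wirtingerBar_eq hU hw, hK.one_dot_star_one hG hU hw,
    neg_zero]

theorem bar_one_dot_one : wirtingerBar (wirtinger K) w ⬝ᵥ wirtinger G w = 0 := by
  rw [wirtingerBar_dot_of_const hU (hK.smooth_one hU) (hG.smooth_one hU)
    (fun z hz => hK.one_dot_one hG hU hz) hw, hG.minimal w hw, dotProduct_smul,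
    hK.one_dot hG hU hw]
  simp

omit hG in
theorem star_bar_one : star (wirtingerBar (wirtinger K) w) = wirtingerBar (wirtinger K) w := by
  rw [← wirtinger_star, ← wirtinger_wirtingerBar_comm hU hK.smooth hw]
  exact wirtinger_congr (Filter.eventually_of_mem (hU.mem_nhds hw)
    fun z hz => (hK.wirtingerBar_eq hU hz).symm)

omit hK in
theorem one_dot_wirtinger_normalSecond :
    wirtinger (normalSecond G) w ⬝ᵥ wirtinger G w = 1 := by
  rw [wirtinger_dot_of_const hU (hG.smooth_normalSecond hU) (hG.smooth_one hU)
    (fun z hz => hG.normalSecond_dot_one hU hz) hw]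
  have h := hG.normalSecond_dot_self hU hw
  conv at h => lhs; enter [2]; rw [normalSecond]
  rw [dotProduct_sub, dotProduct_smul, hG.normalSecond_dot_one hU hw, smul_zero, sub_zero] at h
  rw [h, neg_neg]

/-- The parameter `d = (f₂, f̄₂) - 1` equals `|a|² + |b|² - 1 = 2|a|²`, so the frame degenerates
exactly where `a = 0`. -/
theorem isSixFrame : IsSixFrame (G w) (wirtinger G w) (star (wirtinger G w)) (normalSecond G w)
    (star (normalSecond G w)) (K w) (wirtinger G w ⬝ᵥ star (wirtinger G w))
    (normalSecond G w ⬝ᵥ star (normalSecond G w) - 1) where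
  ff := hG.dot_self w hw
  fp := by rw [dotProduct_comm, hG.one_dot hU hw]
  fq := by rw [dotProduct_comm, hG.star_one_dot hU hw]
  fn := by rw [dotProduct_comm, hG.normalSecond_dot hU hw]
  fm := by rw [wirtinger_dot_star (hG.real w hw), dotProduct_comm, hG.normalSecond_dot hU hw,
    star_zero]
  fk := by rw [dotProduct_comm, hK.dot w hw]
  pp := hG.conformal w hw
  pq := rfl
  pn := by rw [dotProduct_comm, hG.normalSecond_dot_one hU hw]
  pm := by
    rw [← star_star (wirtinger G w), ← star_dot, dotProduct_comm,
      hG.normalSecond_dot_star_one hw, star_zero]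
  pk := by rw [dotProduct_comm, hK.dot_one w hw]
  qq := by rw [← star_dot, hG.conformal w hw, star_zero]
  qn := by rw [dotProduct_comm, hG.normalSecond_dot_star_one hw]
  qm := by rw [← star_dot, dotProduct_comm, hG.normalSecond_dot_one hU hw, star_zero]
  qk := by rw [dotProduct_comm, hK.dot_star_one hw]
  nn := hG.normalSecond_dot_self hU hw
  nm := by ring
  nk := by rw [dotProduct_comm, hK.dot_normalSecond w hw]
  mm := by rw [← star_dot, hG.normalSecond_dot_self hU hw]; simp
  mk' := by rw [dotProduct_comm, hK.dot_star_normalSecond hw]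
  kk := hK.dot_self w hw

end IsPolar

theorem normalSecond_eq_of_eq_add {G : ℂ → Fin 6 → ℂ} {w : ℂ} {v : Fin 6 → ℂ} {t : ℂ}
    (hne : wirtinger G w ≠ 0) (h : wirtinger (wirtinger G) w = v + t • wirtinger G w)
    (hv : v ⬝ᵥ star (wirtinger G w) = 0) : normalSecond G w = v := by
  have hn := dotProduct_star_self_ne_zero hne
  rw [normalSecond, h, add_dotProduct, hv, smul_dotProduct, zero_add, smul_eq_mul,
    mul_div_cancel_right₀ _ hn, add_sub_cancel_right]

theorem eq_zero_of_real_of_dot_self {v : Fin 6 → ℂ} (hv : star v = v) (h : v ⬝ᵥ v = 0) :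
    v = 0 := by
  by_contra hne
  apply dotProduct_star_self_ne_zero hne
  rw [hv, h]

/-! ### A polar of a minimal surface is a minimal surface -/

namespace IsPolar

variable {U : Set ℂ} {G K : ℂ → Fin 6 → ℂ} (hK : IsPolar U G K) (hG : IsAdaptedMinimal U G)
  (hU : IsOpen U) {w : ℂ} (hw : w ∈ U)
include hK hG hU

include hw

theorem one_ne_zero : wirtinger K w ≠ 0 := by
  intro h
  have := hK.one_dot_one hG hU hw
  rw [h, zero_dotProduct] at this
  exact Complex.I_ne_zero (neg_eq_zero.1 this.symm)

section Generic

omit hK in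
-- The vector `f₂ + f̄₂ = 2a` is real with square `2d`, and a real vector with zero square vanishes.
theorem defect_ne_zero (ha : normalSecond G w + star (normalSecond G w) ≠ 0) :
    normalSecond G w ⬝ᵥ star (normalSecond G w) - 1 ≠ 0 := by
  intro h
  apply ha
  apply eq_zero_of_real_of_dot_self
  · rw [star_add, star_star, add_comm]
  · have h1 := hG.normalSecond_dot_self hU hw
    have h2 : star (normalSecond G w) ⬝ᵥ star (normalSecond G w) = -1 := by
      rw [← star_dot, h1]; simp
    rw [add_dotProduct, dotProduct_add, dotProduct_add, h1, h2,
      dotProduct_comm (star (normalSecond G w)) (normalSecond G w)]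
    linear_combination 2 * h

variable (ha : normalSecond G w + star (normalSecond G w) ≠ 0)
include ha

theorem conformal_of_ne : wirtinger K w ⬝ᵥ wirtinger K w = 0 := by
  rw [(hK.isSixFrame hG hU hw).dot_self_eq (hG.normSq_ne hw) (defect_ne_zero hG hU hw ha)
    (hK.one_dot_self hU hw) (hK.one_dot_star_one hG hU hw) (hK.one_dot_star_normalSecond hG hU hw),
    hK.one_dot hG hU hw]
  simp

theorem one_eq_of_ne : ∃ κ : ℂ, wirtinger K w =
    (-Complex.I / (wirtinger G w ⬝ᵥ star (wirtinger G w))) • star (wirtinger G w) +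
      κ • (star (normalSecond G w) + Complex.I • K w) := by
  have := (hK.isSixFrame hG hU hw).exists_eq (hG.normSq_ne hw) (defect_ne_zero hG hU hw ha)
    (hK.one_dot_self hU hw) (hK.one_dot_star_one hG hU hw) (hK.one_dot_star_normalSecond hG hU hw)
  rw [hK.one_dot hG hU hw, hK.one_dot_one hG hU hw, zero_smul, zero_add] at this
  exact ⟨_, this⟩

theorem two_dot_self_zero : wirtinger (wirtinger K) w ⬝ᵥ K w = 0 := by
  rw [hK.two_dot_self hU hw, hK.conformal_of_ne hG hU hw ha, neg_zero]

theorem adapted_of_ne : wirtinger (wirtinger K) w ⬝ᵥ wirtinger (wirtinger K) w = -1 := by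
  rw [(hK.isSixFrame hG hU hw).dot_self_eq (hG.normSq_ne hw) (defect_ne_zero hG hU hw ha)
    (hK.two_dot_self_zero hG hU hw ha) (hK.two_dot_star_one hG hU hw)
    (hK.two_dot_star_normalSecond hG hU hw), hK.two_dot hG hU hw, Complex.I_sq]

theorem two_eq_of_ne : ∃ s t : ℂ, wirtinger (wirtinger K) w =
    Complex.I • G w + s • star (wirtinger G w) +
      t • (star (normalSecond G w) + Complex.I • K w) := by
  have := (hK.isSixFrame hG hU hw).exists_eq (hG.normSq_ne hw) (defect_ne_zero hG hU hw ha)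
    (hK.two_dot_self_zero hG hU hw ha) (hK.two_dot_star_one hG hU hw)
    (hK.two_dot_star_normalSecond hG hU hw)
  rw [hK.two_dot hG hU hw] at this
  exact ⟨_, _, this⟩

/-- The difference of the two sides is shown to be orthogonal to the whole frame. It is real, so the
products with `∂̄G` and `f₂` are the conjugates of those with `∂G` and `f̄₂`. -/
theorem minimal_of_ne : wirtingerBar (wirtinger K) w =
    -(wirtinger K w ⬝ᵥ star (wirtinger K w)) • K w := by
  have fr := hK.isSixFrame hG hU hw
  have hE := hG.normSq_ne hw
  have hd := defect_ne_zero hG hU hw ha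
  rw [← sub_eq_zero]
  have hreal : star (wirtingerBar (wirtinger K) w - -(wirtinger K w ⬝ᵥ star (wirtinger K w)) • K w)
      = wirtingerBar (wirtinger K) w - -(wirtinger K w ⬝ᵥ star (wirtinger K w)) • K w := by
    rw [star_sub, hK.star_bar_one hU hw, star_smul, hK.real w hw, star_neg,
      star_dotProduct_star_self]
  -- The one product that needs the expansion of `∂K`. Applying `∂̄` to `(∂K, f̄₂) = 0` reduces it
  -- to comparing `(∂K, ∂̄f̄₂)` with `|∂K|²`, both of which are expressed through the coefficient
  -- `κ`.
  have hm : (wirtingerBar (wirtinger K) w - -(wirtinger K w ⬝ᵥ star (wirtinger K w)) • K w) ⬝ᵥ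
      star (normalSecond G w) = 0 := by
    rw [sub_dotProduct, smul_dotProduct, hK.dot_star_normalSecond hw,
      wirtingerBar_dot_of_const hU (hK.smooth_one hU) (hG.smooth_normalSecond hU).star_pi
        (fun z hz => hK.one_dot_star_normalSecond hG hU hz) hw, wirtingerBar_star]
    obtain ⟨κ, hκ⟩ := hK.one_eq_of_ne hG hU hw ha
    have hκn : wirtinger K w ⬝ᵥ normalSecond G w =
        κ * (normalSecond G w ⬝ᵥ star (normalSecond G w) - 1) := by
      rw [hκ]
      simp only [add_dotProduct, smul_dotProduct, smul_eq_mul, fr.qn, hK.dot_normalSecond w hw,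
        dotProduct_comm (star (normalSecond G w)) (normalSecond G w)]
      linear_combination κ * Complex.I_mul_I
    have e1 : star (wirtinger G w) ⬝ᵥ star (wirtinger (normalSecond G) w) = 1 := by
      rw [← star_dot, dotProduct_comm, one_dot_wirtinger_normalSecond hG hU hw, star_one]
    have e2 : star (normalSecond G w) ⬝ᵥ star (wirtinger (normalSecond G) w) = 0 := by
      rw [← star_dot, dotProduct_comm, wirtinger_dot_self_of_const hU (hG.smooth_normalSecond hU)
        (fun z hz => hG.normalSecond_dot_self hU hz) hw, star_zero]
    have e3 : K w ⬝ᵥ wirtinger (normalSecond G) w = -(wirtinger K w ⬝ᵥ normalSecond G w) := by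
      rw [wirtinger_dot_of_const hU hK.smooth (hG.smooth_normalSecond hU)
        hK.dot_normalSecond hw, neg_neg]
    have e4 : K w ⬝ᵥ star (wirtinger (normalSecond G) w) =
        -(star κ * (normalSecond G w ⬝ᵥ star (normalSecond G w) - 1)) := by
      rw [wirtinger_dot_star (hK.real w hw), e3, hκn, star_neg, star_mul', star_sub,
        star_dotProduct_star_self, star_one]
    have e5 : wirtinger K w ⬝ᵥ star (wirtinger (normalSecond G) w) =
        -Complex.I / (wirtinger G w ⬝ᵥ star (wirtinger G w)) -
        Complex.I * (κ * star κ * (normalSecond G w ⬝ᵥ star (normalSecond G w) - 1)) := by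
      rw [hκ]
      simp only [add_dotProduct, smul_dotProduct, smul_eq_mul, e1, e2, e4]
      ring
    have e6 : wirtinger K w ⬝ᵥ star (wirtinger K w) =
        1 / (wirtinger G w ⬝ᵥ star (wirtinger G w)) +
        κ * star κ * (normalSecond G w ⬝ᵥ star (normalSecond G w) - 1) := by
      have e7 : star (wirtinger K w) =
          (Complex.I / (wirtinger G w ⬝ᵥ star (wirtinger G w))) • wirtinger G w +
          star κ • (normalSecond G w - Complex.I • K w) := by
        rw [hκ, star_add, star_smul, star_smul, star_add, star_smul, hK.real w hw, star_star,
          star_star, star_div₀, star_dotProduct_star_self]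
        simp [sub_eq_add_neg]
      rw [e7, dotProduct_add, dotProduct_smul, dotProduct_smul, dotProduct_sub, dotProduct_smul,
        hK.one_dot_one hG hU hw, hκn, hK.one_dot_self hU hw]
      simp only [smul_eq_mul, mul_zero, sub_zero]
      linear_combination (-1 / (wirtinger G w ⬝ᵥ star (wirtinger G w))) * Complex.I_mul_I
    rw [e5, e6, smul_eq_mul]
    ring
  have hp : (wirtingerBar (wirtinger K) w - -(wirtinger K w ⬝ᵥ star (wirtinger K w)) • K w) ⬝ᵥ
      wirtinger G w = 0 := by
    rw [sub_dotProduct, smul_dotProduct, hK.bar_one_dot_one hG hU hw, hK.dot_one w hw]; simp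
  apply fr.eq_zero hE hd
  · rw [sub_dotProduct, smul_dotProduct, hK.bar_one_dot hG hU hw, hK.dot w hw]; simp
  · exact hp
  · rw [wirtinger_dot_star hreal, hp, star_zero]
  · rw [← star_star (normalSecond G w), wirtinger_dot_star hreal, hm, star_zero]
  · exact hm
  · rw [sub_dotProduct, smul_dotProduct, hK.bar_one_dot_self hU hw, hK.dot_self w hw]; simp

end Generic

section Degenerate

omit hU in
-- With `a = 0` one has `f₂ = -i b` with `b` a unit vector, and `(K, b) = -1` for a unit vector `K`
-- forces `K = -b`.
theorem eq_of_zero (hU : IsOpen U) (ha : normalSecond G w + star (normalSecond G w) = 0) :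
    K w = -Complex.I • normalSecond G w := by
  have hs : star (normalSecond G w) = -normalSecond G w := (neg_eq_of_add_eq_zero_right ha).symm
  rw [← sub_eq_zero]
  have h1 : star (-Complex.I • normalSecond G w) = -Complex.I • normalSecond G w := by
    rw [star_smul, hs]; simp
  apply eq_zero_of_real_of_dot_self
  · rw [star_sub, hK.real w hw, h1]
  · simp only [sub_dotProduct, dotProduct_sub, smul_dotProduct, dotProduct_smul, smul_eq_mul,
      hK.dot_self w hw, hK.dot_normalSecond w hw, hG.normalSecond_dot_self hU hw,
      dotProduct_comm (normalSecond G w) (K w)]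
    linear_combination Complex.I_mul_I

variable (ha : ∀ᶠ z in nhds w, normalSecond G z + star (normalSecond G z) = 0)
include ha

/-- Here `K = -i f₂` on a neighbourhood, so Codazzi makes `∂̄K` a multiple of `∂G`. Conjugation and
`(∂K, ∂G) = -i` fix the coefficient. -/
theorem one_eq_of_zero :
    wirtinger K w = (-Complex.I * (wirtinger G w ⬝ᵥ star (wirtinger G w))⁻¹) •
      star (wirtinger G w) := by
  have e : K =ᶠ[nhds w] fun z => (fun _ => -Complex.I) z • normalSecond G z := by
    filter_upwards [ha, hU.mem_nhds hw] with z hz hzU using hK.eq_of_zero hG hzU hU hz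
  obtain ⟨ρ, hρ⟩ := hG.exists_wirtingerBar_normalSecond hU hw
  have h1 := wirtingerBar_congr e
  rw [wirtingerBar_smul (differentiableAt_const _) ((hG.smooth_normalSecond hU).diffAt hU hw),
    wirtingerBar_const, zero_smul, zero_add, hρ, hK.wirtingerBar_eq hU hw, smul_smul] at h1
  have h2 := congrArg star h1
  rw [star_star, star_smul] at h2
  have h3 := hK.one_dot_one hG hU hw
  have hE := hG.normSq_ne hw
  rw [h2, smul_dotProduct, dotProduct_comm, smul_eq_mul] at h3
  rw [h2, (eq_mul_inv_iff_mul_eq₀ hE).2 h3]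

theorem exists_eq_of_zero : ∃ c : ℂ → ℂ, DifferentiableAt ℝ c w ∧
    wirtinger K =ᶠ[nhds w] (fun z => c z • star (wirtinger G z)) ∧
    c w = -Complex.I * (wirtinger G w ⬝ᵥ star (wirtinger G w))⁻¹ := by
  refine ⟨fun z => -Complex.I * (wirtinger G z ⬝ᵥ star (wirtinger G z))⁻¹, ?_, ?_, rfl⟩
  · exact (((hG.smooth_normSq hU).diffAt hU hw).inv (hG.normSq_ne hw)).const_mul _
  · filter_upwards [ha.eventually_nhds, hU.mem_nhds hw] with z hz hzU using
      hK.one_eq_of_zero hG hU hzU hz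

theorem conformal_of_zero : wirtinger K w ⬝ᵥ wirtinger K w = 0 := by
  rw [hK.one_eq_of_zero hG hU hw ha, smul_dotProduct, dotProduct_smul,
    (hK.isSixFrame hG hU hw).qq]
  simp

theorem two_eq_of_zero : ∃ s : ℂ, wirtinger (wirtinger K) w =
    Complex.I • G w + s • star (wirtinger G w) := by
  obtain ⟨c, hc, e, hcw⟩ := hK.exists_eq_of_zero hG hU hw ha
  refine ⟨wirtinger c w, ?_⟩
  rw [wirtinger_congr e, wirtinger_smul hc ((hG.smooth_one hU).star_pi.diffAt hU hw),
    hG.wirtinger_star_one hw, hcw, smul_smul, add_comm]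
  have hE := hG.normSq_ne hw
  congr 2
  field_simp

theorem adapted_of_zero : wirtinger (wirtinger K) w ⬝ᵥ wirtinger (wirtinger K) w = -1 := by
  obtain ⟨s, hs⟩ := hK.two_eq_of_zero hG hU hw ha
  have fr := hK.isSixFrame hG hU hw
  rw [hs]
  simp only [add_dotProduct, dotProduct_add, smul_dotProduct, dotProduct_smul, fr.ff, fr.qq, fr.fq,
    dotProduct_comm (star (wirtinger G w)) (G w)]
  simp

/-- The value is purely imaginary, so the vector `a` of `K` vanishes too. This settles the inversion
of the transforms on the degenerate set. -/
theorem normalSecond_of_zero : normalSecond K w = Complex.I • G w := by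
  obtain ⟨s, hs⟩ := hK.two_eq_of_zero hG hU hw ha
  have h1 := hK.one_eq_of_zero hG hU hw ha
  have hE := hG.normSq_ne hw
  have hc : -Complex.I * (wirtinger G w ⬝ᵥ star (wirtinger G w))⁻¹ ≠ 0 :=
    mul_ne_zero (neg_ne_zero.2 Complex.I_ne_zero) (inv_ne_zero hE)
  refine normalSecond_eq_of_eq_add
    (t := s / (-Complex.I * (wirtinger G w ⬝ᵥ star (wirtinger G w))⁻¹))
    (hK.one_ne_zero hG hU hw) ?_ ?_
  · rw [hs, h1, smul_smul, div_mul_cancel₀ _ hc]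
  · rw [smul_dotProduct, wirtinger_dot_star (hG.real w hw), dotProduct_comm,
      hK.one_dot hG hU hw]
    simp

/-- Since `f₂ = i K` here, differentiating the multiple of `∂̄G` leaves only `∂̄G` and `K`
components. The products with `∂G` and `K` then determine the coefficients. -/
theorem minimal_of_zero : wirtingerBar (wirtinger K) w =
    -(wirtinger K w ⬝ᵥ star (wirtinger K w)) • K w := by
  obtain ⟨c, hc, e, hcw⟩ := hK.exists_eq_of_zero hG hU hw ha
  have fr := hK.isSixFrame hG hU hw
  have hn : normalSecond G w = Complex.I • K w := by
    rw [hK.eq_of_zero hG hw hU ha.self_of_nhds, smul_smul]; simp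
  have hB : ∃ s t : ℂ, wirtingerBar (wirtinger K) w = s • star (wirtinger G w) + t • K w := by
    rw [wirtingerBar_congr e, wirtingerBar_smul hc ((hG.smooth_one hU).star_pi.diffAt hU hw),
      wirtingerBar_star]
    have hV : wirtinger (wirtinger G) w = Complex.I • K w +
      ((wirtinger (wirtinger G) w ⬝ᵥ star (wirtinger G w)) /
      (wirtinger G w ⬝ᵥ star (wirtinger G w))) • wirtinger G w := by
      rw [← hn, normalSecond, sub_add_cancel]
    rw [hV, star_add, star_smul, star_smul, hK.real w hw]
    refine ⟨wirtingerBar c w + c w * star ((wirtinger (wirtinger G) w ⬝ᵥ star (wirtinger G w)) /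
      (wirtinger G w ⬝ᵥ star (wirtinger G w))), c w * star Complex.I, ?_⟩
    module
  obtain ⟨s, t, hst⟩ := hB
  have h1 := hK.bar_one_dot_one hG hU hw
  have h2 := hK.bar_one_dot_self hU hw
  rw [hst, add_dotProduct, smul_dotProduct, smul_dotProduct, hK.dot_one w hw, dotProduct_comm,
    smul_zero, add_zero, smul_eq_mul] at h1
  have hs : s = 0 := (mul_eq_zero.1 h1).resolve_right (hG.normSq_ne hw)
  rw [hst, hs, zero_smul, zero_add, smul_dotProduct, hK.dot_self w hw, smul_eq_mul, mul_one] at h2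
  rw [hst, hs, zero_smul, zero_add, h2]

end Degenerate

omit hw

/-- A unit normal field `K` of a minimal surface `G` with `(K, f₂) = i` is again a minimal surface,
and the coordinate is adapted for it. -/
theorem isAdaptedMinimal : IsAdaptedMinimal U K where
  smooth := hK.smooth
  real := hK.real
  dot_self := hK.dot_self
  conformal _ hw := eqOn_of_ne_zero_or_eventually_zero hU
    ((hK.smooth_one hU).dot (hK.smooth_one hU)).continuousOn continuousOn_const
    (fun _ hz ha => hK.conformal_of_ne hG hU hz ha)
    (fun _ hz ha => hK.conformal_of_zero hG hU hz ha) hw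
  ne_zero _ hw := hK.one_ne_zero hG hU hw
  minimal _ hw := eqOn_of_ne_zero_or_eventually_zero hU
    ((hK.smooth_one hU).wirtingerBar hU).continuousOn
    (((hK.smooth_one hU).dot (hK.smooth_one hU).star_pi).neg.smul hK.smooth).continuousOn
    (fun _ hz ha => hK.minimal_of_ne hG hU hz ha)
    (fun _ hz ha => hK.minimal_of_zero hG hU hz ha) hw
  adapted _ hw := eqOn_of_ne_zero_or_eventually_zero hU
    ((hK.smooth_two hU).dot (hK.smooth_two hU)).continuousOn continuousOn_const
    (fun _ hz ha => hK.adapted_of_ne hG hU hz ha)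
    (fun _ hz ha => hK.adapted_of_zero hG hU hz ha) hw

/-- The relation between a minimal surface and its polar is symmetric. -/
theorem symm : IsPolar U K G where
  smooth := hG.smooth
  real := hG.real
  dot_self := hG.dot_self
  dot w hw := by rw [dotProduct_comm, hK.dot w hw]
  dot_one w hw := by rw [dotProduct_comm, hK.one_dot hG hU hw]
  dot_normalSecond w hw := by
    rw [dotProduct_comm, normalSecond, sub_dotProduct, smul_dotProduct, hK.two_dot hG hU hw,
      hK.one_dot hG hU hw, smul_zero, sub_zero]

end IsPolar

/-- The determinant of six vectors of `ℂ⁶`. -/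
noncomputable def sixDet (M : Fin 6 → Fin 6 → ℂ) : ℂ := (Matrix.of M).det

/-- The coordinate matrix of the frame of `K` in the frame of `G`. The terms in `z` and `z'`, which
come from projecting `∂∂K` to its normal part, drop out as row operations. -/
theorem det_polar_matrix (x x' κ κ' s s' t t' z z' : ℂ) :
    (!![0, 0, 0, 0, 0, 1;
       0, 0, x, 0, κ, Complex.I * κ;
       0, x', 0, κ', 0, -Complex.I * κ';
       Complex.I, 0, s + z * x, 0, t + z * κ, Complex.I * (t + z * κ);
       -Complex.I, s' + z' * x', 0, t' + z' * κ', 0, -Complex.I * (t' + z' * κ');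
       1, 0, 0, 0, 0, 0] : Matrix (Fin 6) (Fin 6) ℂ).det =
      -((x * t - κ * s) * (x' * t' - κ' * s')) := by
  simp [Matrix.det_succ_row_zero, Fin.sum_univ_succ, Fin.succAbove]
  ring

/-- Both `∂K` and the part of `∂∂K` off `G` lie in the span of `∂̄G` and `f̄₂ + i K`. The
change-of-frame determinant is therefore minus a `2 × 2` minor times its conjugate. Its sign is what
makes the inverse of a (+)transform a (-)transform. -/
theorem IsPolar.sixDet_eq {U : Set ℂ} {G K : ℂ → Fin 6 → ℂ} (hK : IsPolar U G K)
    (hG : IsAdaptedMinimal U G) (hU : IsOpen U) {w : ℂ} (hw : w ∈ U)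
    (ha : normalSecond G w + star (normalSecond G w) ≠ 0) :
    ∃ δ : ℝ, 0 ≤ δ ∧
      sixDet ![K w, wirtinger K w, star (wirtinger K w), normalSecond K w,
        star (normalSecond K w), G w] =
      -(δ : ℂ) * sixDet ![G w, wirtinger G w, star (wirtinger G w), normalSecond G w,
        star (normalSecond G w), K w] := by
  obtain ⟨κ, h1⟩ := hK.one_eq_of_ne hG hU hw ha
  obtain ⟨s, t, h2⟩ := hK.two_eq_of_ne hG hU hw ha
  set x := -Complex.I / (wirtinger G w ⬝ᵥ star (wirtinger G w)) with hx
  set z := -((wirtinger (wirtinger K) w ⬝ᵥ star (wirtinger K w)) /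
      (wirtinger K w ⬝ᵥ star (wirtinger K w))) with hz
  have h3 : normalSecond K w = Complex.I • G w + (s + z * x) • star (wirtinger G w) +
      (t + z * κ) • (star (normalSecond G w) + Complex.I • K w) := by
    rw [normalSecond, sub_eq_add_neg, ← neg_smul, ← hz]
    rw [h2]
    nth_rewrite 1 [h1]
    module
  have h1' : star (wirtinger K w) = star x • wirtinger G w +
      star κ • (normalSecond G w - Complex.I • K w) := by
    rw [h1]; simp [hK.real w hw, sub_eq_add_neg]
  have h3' : star (normalSecond K w) = -Complex.I • G w +
      (star s + star z * star x) • wirtinger G w +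
      (star t + star z * star κ) • (normalSecond G w - Complex.I • K w) := by
    rw [h3]; simp [hK.real w hw, hG.real w hw, sub_eq_add_neg]
  refine ⟨Complex.normSq (x * t - κ * s), Complex.normSq_nonneg _, ?_⟩
  have hmul : (Matrix.of ![K w, wirtinger K w, star (wirtinger K w), normalSecond K w,
      star (normalSecond K w), G w]) = !![0, 0, 0, 0, 0, 1;
       0, 0, x, 0, κ, Complex.I * κ;
       0, star x, 0, star κ, 0, -Complex.I * star κ;
       Complex.I, 0, s + z * x, 0, t + z * κ, Complex.I * (t + z * κ);
       -Complex.I, star s + star z * star x, 0, star t + star z * star κ, 0,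
        -Complex.I * (star t + star z * star κ);
       1, 0, 0, 0, 0, 0] * Matrix.of ![G w, wirtinger G w, star (wirtinger G w), normalSecond G w,
        star (normalSecond G w), K w] := by
    ext i j
    rw [Matrix.mul_apply, Fin.sum_univ_six]
    fin_cases i
    · simp
    · simp only [Fin.mk_one, of_apply, cons_val]
      rw [h1]
      simp only [Pi.add_apply, Pi.smul_apply, smul_eq_mul]
      ring
    · simp only [Fin.reduceFinMk, of_apply, cons_val]
      rw [h1']
      simp only [Pi.add_apply, Pi.smul_apply, Pi.sub_apply, smul_eq_mul]
      ring
    · simp only [Fin.reduceFinMk, of_apply, cons_val]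
      rw [h3]
      simp only [Pi.add_apply, Pi.smul_apply, smul_eq_mul]
      ring
    · simp only [Fin.reduceFinMk, of_apply, cons_val]
      rw [h3']
      simp only [Pi.add_apply, Pi.smul_apply, Pi.sub_apply, smul_eq_mul]
      ring
    · simp
  rw [sixDet, hmul, Matrix.det_mul, det_polar_matrix, Complex.normSq_eq_conj_mul_self, sixDet]
  simp only [map_sub, map_mul, starRingEnd_apply]
  ring

/-! ### Complexification of maps into `ℝ⁶` -/

/-- The inclusion `ℝ⁶ → ℂ⁶` as a continuous linear map. -/
noncomputable def toCL : E6 →L[ℝ] (Fin 6 → ℂ) :=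
  LinearMap.toContinuousLinearMap
    { toFun := toC
      map_add' := fun u v => by ext i; simp [toC]
      map_smul' := fun c u => by ext i; simp [toC] }

/-- The real part `ℂ⁶ → ℝ⁶` as a continuous linear map. -/
noncomputable def rePart : (Fin 6 → ℂ) →L[ℝ] E6 :=
  LinearMap.toContinuousLinearMap
    { toFun := fun u => WithLp.toLp 2 fun i => (u i).re
      map_add' := fun u v => by ext i; simp
      map_smul' := fun c u => by ext i; simp }

theorem rePart_apply (u : Fin 6 → ℂ) (i : Fin 6) : rePart u i = (u i).re := rfl

theorem rePart_toC (v : E6) : rePart (toC v) = v := by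
  ext i; simp [rePart_apply, toC]

theorem toC_injective : Function.Injective toC :=
  Function.LeftInverse.injective rePart_toC

theorem toC_add (u v : E6) : toC (u + v) = toC u + toC v := toCL.map_add u v

theorem toC_sub (u v : E6) : toC (u - v) = toC u - toC v := toCL.map_sub u v

theorem toC_smul (c : ℝ) (v : E6) : toC (c • v) = (c : ℂ) • toC v := by
  ext i; simp [toC]

theorem star_toC (v : E6) : star (toC v) = toC v := by
  ext i; simp [toC]

theorem toC_dotProduct_toC (u v : E6) : toC u ⬝ᵥ toC v = (⟪u, v⟫_ℝ : ℂ) := by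
  simp [toC, dotProduct, PiLp.inner_apply, mul_comm]

theorem exists_eq_toC (u : Fin 6 → ℂ) : ∃ a b : E6, u = toC a - Complex.I • toC b := by
  refine ⟨rePart u, -rePart (-Complex.I • u), ?_⟩
  ext i
  apply Complex.ext <;> simp [toC, rePart_apply]

theorem toC_sub_I_dot {a b v : E6} :
    (toC a - Complex.I • toC b) ⬝ᵥ toC v = (⟪a, v⟫_ℝ : ℂ) - Complex.I * (⟪b, v⟫_ℝ : ℂ) := by
  rw [sub_dotProduct, smul_dotProduct, toC_dotProduct_toC, toC_dotProduct_toC, smul_eq_mul]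

theorem toC_sub_I_dot_eq_zero {a b v : E6} (h : (toC a - Complex.I • toC b) ⬝ᵥ toC v = 0) :
    ⟪a, v⟫_ℝ = 0 ∧ ⟪b, v⟫_ℝ = 0 := by
  rw [toC_sub_I_dot] at h
  have h1 := congrArg Complex.re h
  have h2 := congrArg Complex.im h
  simp at h1 h2
  exact ⟨h1, h2⟩

/-- The complexification of a map into `ℝ⁶`. -/
def cplx (g : ℂ → E6) (w : ℂ) : Fin 6 → ℂ := toC (g w)

theorem f1_eq (g : ℂ → E6) : f1 g = wirtinger (cplx g) := rfl

section Bridge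

variable {U : Set ℂ} {g : ℂ → E6}

theorem contDiffOn_cplx (hg : ContDiffOn ℝ ∞ g U) : ContDiffOn ℝ ∞ (cplx g) U :=
  toCL.contDiff.comp_contDiffOn hg

theorem contDiffOn_of_cplx (hg : ContDiffOn ℝ ∞ (cplx g) U) : ContDiffOn ℝ ∞ g U :=
  (rePart.contDiff.comp_contDiffOn hg).congr fun _ _ => (rePart_toC _).symm

theorem fderiv_cplx {w : ℂ} (hg : DifferentiableAt ℝ g w) (X : ℂ) :
    fderiv ℝ (cplx g) w X = toC (fderiv ℝ g w X) := by
  have : HasFDerivAt (cplx g) (toCL.comp (fderiv ℝ g w)) w :=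
    toCL.hasFDerivAt.comp w hg.hasFDerivAt
  rw [this.fderiv]; rfl

theorem fderiv_fderiv_cplx (hU : IsOpen U) (hg : ContDiffOn ℝ ∞ g U) {w : ℂ} (hw : w ∈ U)
    (X Y : ℂ) :
    fderiv ℝ (fderiv ℝ (cplx g)) w X Y = toC (fderiv ℝ (fderiv ℝ g) w X Y) := by
  rw [← fderiv_fderiv_apply hU (contDiffOn_cplx hg) hw, ← fderiv_fderiv_apply hU hg hw,
    ← fderiv_cplx ((contDiffOn_fderiv_apply hU hg Y).diffAt hU hw)]
  refine congrArg (fun T : ℂ →L[ℝ] (Fin 6 → ℂ) => T X) (Filter.EventuallyEq.fderiv_eq ?_)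
  filter_upwards [hU.mem_nhds hw] with z hz using fderiv_cplx (hg.diffAt hU hz) Y

theorem wirtinger_cplx {w : ℂ} (hg : DifferentiableAt ℝ g w) :
    wirtinger (cplx g) w = (1 / 2 : ℂ) • (toC (fderiv ℝ g w 1) -
      Complex.I • toC (fderiv ℝ g w Complex.I)) := by
  rw [wirtinger, fderiv_cplx hg, fderiv_cplx hg]

theorem star_wirtinger_cplx {w : ℂ} (hg : DifferentiableAt ℝ g w) :
    star (wirtinger (cplx g) w) = (1 / 2 : ℂ) • (toC (fderiv ℝ g w 1) +
      Complex.I • toC (fderiv ℝ g w Complex.I)) := by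
  rw [wirtinger_cplx hg]; simp [star_toC]

theorem wirtinger_wirtinger_cplx (hU : IsOpen U) (hg : ContDiffOn ℝ ∞ g U) {w : ℂ} (hw : w ∈ U) :
    wirtinger (wirtinger (cplx g)) w =
      toC ((1 / 4 : ℝ) • (fderiv ℝ (fderiv ℝ g) w 1 1 -
        fderiv ℝ (fderiv ℝ g) w Complex.I Complex.I)) -
      Complex.I • toC ((1 / 2 : ℝ) • fderiv ℝ (fderiv ℝ g) w 1 Complex.I) := by
  rw [wirtinger_wirtinger hU (contDiffOn_cplx hg) hw, fderiv_fderiv_cplx hU hg hw,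
    fderiv_fderiv_cplx hU hg hw, fderiv_fderiv_cplx hU hg hw, toC_smul, toC_smul, toC_sub,
    smul_smul]
  norm_num

theorem wirtingerBar_wirtinger_cplx (hU : IsOpen U) (hg : ContDiffOn ℝ ∞ g U) {w : ℂ}
    (hw : w ∈ U) :
    wirtingerBar (wirtinger (cplx g)) w =
      toC ((1 / 4 : ℝ) • (fderiv ℝ (fderiv ℝ g) w 1 1 +
        fderiv ℝ (fderiv ℝ g) w Complex.I Complex.I)) := by
  rw [wirtingerBar_wirtinger hU (contDiffOn_cplx hg) hw, fderiv_fderiv_cplx hU hg hw,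
    fderiv_fderiv_cplx hU hg hw, toC_smul, toC_add]
  norm_num

theorem fderiv_apply_eq (g : ℂ → E6) (w X : ℂ) :
    fderiv ℝ g w X = X.re • fderiv ℝ g w 1 + X.im • fderiv ℝ g w Complex.I := by
  have : X = X.re • (1 : ℂ) + X.im • Complex.I := by simp [Complex.re_add_im]
  conv_lhs => rw [this]
  rw [map_add, map_smul, map_smul]

/-- The orthogonal projection used in `secondFF`. -/
theorem starProjection_normal_eq {w : ℂ} {u v : E6} (h₀ : ⟪u, g w⟫_ℝ = 0)
    (h₁ : ⟪u, fderiv ℝ g w 1⟫_ℝ = 0) (h₂ : ⟪u, fderiv ℝ g w Complex.I⟫_ℝ = 0) {c : ℝ} {X : ℂ}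
    (h : v - u = c • g w + fderiv ℝ g w X) :
    (Submodule.span ℝ {g w} ⊔ LinearMap.range (fderiv ℝ g w).toLinearMap)ᗮ.starProjection v
      = u := by
  apply Submodule.eq_starProjection_of_mem_orthogonal
  · rw [Submodule.mem_orthogonal']
    intro y hy
    obtain ⟨y₁, hy₁, y₂, ⟨Y, rfl⟩, rfl⟩ := Submodule.mem_sup.1 hy
    obtain ⟨t, rfl⟩ := Submodule.mem_span_singleton.1 hy₁
    change ⟪u, t • g w + fderiv ℝ g w Y⟫_ℝ = 0
    rw [fderiv_apply_eq, inner_add_right, inner_add_right, inner_smul_right, inner_smul_right,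
      inner_smul_right, h₀, h₁, h₂]
    simp
  · rw [h]
    apply Submodule.le_orthogonal_orthogonal
    exact Submodule.add_mem_sup (Submodule.smul_mem _ _ (Submodule.mem_span_singleton_self _))
      ⟨X, rfl⟩

namespace IsConformalImmersion

variable (hg : IsConformalImmersion U (cplx g)) (hU : IsOpen U) {w : ℂ} (hw : w ∈ U)
include hg

include hU hw

theorem real_diffAt : DifferentiableAt ℝ g w := (contDiffOn_of_cplx hg.smooth).diffAt hU hw

theorem toC_fderiv_one : toC (fderiv ℝ g w 1) =
    wirtinger (cplx g) w + star (wirtinger (cplx g) w) := by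
  rw [star_wirtinger_cplx (hg.real_diffAt hU hw), wirtinger_cplx (hg.real_diffAt hU hw)]
  module

theorem toC_fderiv_I : toC (fderiv ℝ g w Complex.I) =
    Complex.I • (wirtinger (cplx g) w - star (wirtinger (cplx g) w)) := by
  rw [star_wirtinger_cplx (hg.real_diffAt hU hw), wirtinger_cplx (hg.real_diffAt hU hw)]
  ext i
  simp only [Pi.smul_apply, Pi.sub_apply, Pi.add_apply, smul_eq_mul]
  linear_combination toC (fderiv ℝ g w Complex.I) i * Complex.I_mul_I

/-- In an isothermal coordinate, the coordinate vectors are orthogonal and of the same length. -/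
theorem inner_fderiv : 0 < ⟪fderiv ℝ g w 1, fderiv ℝ g w 1⟫_ℝ ∧
    ⟪fderiv ℝ g w 1, fderiv ℝ g w Complex.I⟫_ℝ = 0 ∧
    ⟪fderiv ℝ g w Complex.I, fderiv ℝ g w Complex.I⟫_ℝ = ⟪fderiv ℝ g w 1, fderiv ℝ g w 1⟫_ℝ ∧
    ⟪g w, fderiv ℝ g w 1⟫_ℝ = 0 ∧ ⟪g w, fderiv ℝ g w Complex.I⟫_ℝ = 0 := by
  have hx := hg.toC_fderiv_one hU hw
  have hy := hg.toC_fderiv_I hU hw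
  have c1 : star (wirtinger (cplx g) w) ⬝ᵥ star (wirtinger (cplx g) w) = 0 := by
    rw [← star_dot, hg.conformal w hw, star_zero]
  have e := dotProduct_comm (star (wirtinger (cplx g) w)) (wirtinger (cplx g) w)
  have exx : (⟪fderiv ℝ g w 1, fderiv ℝ g w 1⟫_ℝ : ℂ) =
      2 * (wirtinger (cplx g) w ⬝ᵥ star (wirtinger (cplx g) w)) := by
    rw [← toC_dotProduct_toC, hx]
    simp only [add_dotProduct, dotProduct_add, hg.conformal w hw, c1, e]
    ring
  have eyy : (⟪fderiv ℝ g w Complex.I, fderiv ℝ g w Complex.I⟫_ℝ : ℂ) =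
      2 * (wirtinger (cplx g) w ⬝ᵥ star (wirtinger (cplx g) w)) := by
    rw [← toC_dotProduct_toC, hy]
    simp only [sub_dotProduct, dotProduct_sub, smul_dotProduct, dotProduct_smul, smul_eq_mul,
      hg.conformal w hw, c1, e]
    linear_combination (-2 * (wirtinger (cplx g) w ⬝ᵥ star (wirtinger (cplx g) w))) *
      Complex.I_mul_I
  have exy : (⟪fderiv ℝ g w 1, fderiv ℝ g w Complex.I⟫_ℝ : ℂ) = 0 := by
    rw [← toC_dotProduct_toC, hx, hy]
    simp only [add_dotProduct, dotProduct_sub, dotProduct_smul, smul_eq_mul,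
      hg.conformal w hw, c1, e]
    ring
  have efx : (⟪fderiv ℝ g w 1, g w⟫_ℝ : ℂ) = 0 := by
    rw [← toC_dotProduct_toC, hx, add_dotProduct]
    change wirtinger (cplx g) w ⬝ᵥ cplx g w + _ ⬝ᵥ cplx g w = 0
    rw [hg.one_dot hU hw, hg.star_one_dot hU hw, add_zero]
  have efy : (⟪fderiv ℝ g w Complex.I, g w⟫_ℝ : ℂ) = 0 := by
    rw [← toC_dotProduct_toC, hy, smul_dotProduct, sub_dotProduct]
    change _ • (wirtinger (cplx g) w ⬝ᵥ cplx g w - _ ⬝ᵥ cplx g w) = 0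
    rw [hg.one_dot hU hw, hg.star_one_dot hU hw, sub_zero, smul_zero]
  refine ⟨lt_of_le_of_ne real_inner_self_nonneg fun h => hg.normSq_ne hw ?_,
    by exact_mod_cast exy, by exact_mod_cast eyy.trans exx.symm, ?_, ?_⟩
  · rw [← h] at exx
    simpa using exx.symm
  · rw [real_inner_comm]; exact_mod_cast efx
  · rw [real_inner_comm]; exact_mod_cast efy

/-- Minimality is not needed: the Hermitian projection along `∂G` of the complex second derivative
agrees with the real orthogonal projection defining `II`. The lemma can therefore also be used in
coordinates known only to be conformal. -/
theorem f2_eq : f2 g w = normalSecond (cplx g) w := by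
  obtain ⟨a, b, hab⟩ := exists_eq_toC (normalSecond (cplx g) w)
  have n0 : (toC a - Complex.I • toC b) ⬝ᵥ toC (g w) = 0 := by
    rw [← hab]; exact hg.normalSecond_dot hU hw
  have n1 : (toC a - Complex.I • toC b) ⬝ᵥ toC (fderiv ℝ g w 1) = 0 := by
    rw [← hab, hg.toC_fderiv_one hU hw, dotProduct_add, hg.normalSecond_dot_one hU hw,
      hg.normalSecond_dot_star_one hw, add_zero]
  have n2 : (toC a - Complex.I • toC b) ⬝ᵥ toC (fderiv ℝ g w Complex.I) = 0 := by
    rw [← hab, hg.toC_fderiv_I hU hw, dotProduct_smul, dotProduct_sub,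
      hg.normalSecond_dot_one hU hw, hg.normalSecond_dot_star_one hw, sub_zero, smul_zero]
  obtain ⟨a0, b0⟩ := toC_sub_I_dot_eq_zero n0
  obtain ⟨a1, b1⟩ := toC_sub_I_dot_eq_zero n1
  obtain ⟨a2, b2⟩ := toC_sub_I_dot_eq_zero n2
  set μ := (wirtinger (wirtinger (cplx g)) w ⬝ᵥ star (wirtinger (cplx g) w)) /
      (wirtinger (cplx g) w ⬝ᵥ star (wirtinger (cplx g) w)) with hμ
  -- The two tangent directions come from splitting `μ ∂g = μ (∂g/∂x - i ∂g/∂y) / 2` into the form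
  -- `toC _ - i toC _`.
  have key : toC ((1 / 4 : ℝ) • (fderiv ℝ (fderiv ℝ g) w 1 1 -
        fderiv ℝ (fderiv ℝ g) w Complex.I Complex.I) - a) -
      Complex.I • toC ((1 / 2 : ℝ) • fderiv ℝ (fderiv ℝ g) w 1 Complex.I - b) =
      toC (fderiv ℝ g w (⟨μ.re / 2, μ.im / 2⟩ : ℂ)) -
        Complex.I • toC (fderiv ℝ g w (⟨-μ.im / 2, μ.re / 2⟩ : ℂ)) := by
    have e1 : wirtinger (wirtinger (cplx g)) w - normalSecond (cplx g) w =
        μ • wirtinger (cplx g) w := by rw [normalSecond, sub_sub_cancel]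
    rw [wirtinger_wirtinger_cplx hU (contDiffOn_of_cplx hg.smooth) hw, hab,
      wirtinger_cplx (hg.real_diffAt hU hw)] at e1
    rw [toC_sub, toC_sub, fderiv_apply_eq, fderiv_apply_eq g w ⟨-μ.im / 2, μ.re / 2⟩]
    have e2 : μ = μ.re + μ.im * Complex.I := (Complex.re_add_im μ).symm
    rw [e2] at e1
    ext i
    have e := congrFun e1 i
    simp only [toC_add, toC_smul, Pi.smul_apply, Pi.sub_apply, Pi.add_apply, smul_eq_mul] at e ⊢
    push_cast at e ⊢
    linear_combination e - ((μ.im : ℂ) / 2 * toC (fderiv ℝ g w Complex.I) i) * Complex.I_mul_I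
  have inj : ∀ {p q p' q' : E6}, toC p - Complex.I • toC q = toC p' - Complex.I • toC q' →
      p = p' ∧ q = q' := by
    intro p q p' q' h
    constructor
    · ext i
      have := congrArg Complex.re (congrFun h i)
      simpa [toC] using this
    · ext i
      have := congrArg Complex.im (congrFun h i)
      simpa [toC] using this
  obtain ⟨k1, k2⟩ := inj key
  have ea : aVec g w = a := by
    rw [aVec, secondFF, secondFF, ← map_sub, ← map_smul]
    exact starProjection_normal_eq a0 a1 a2 (c := 0) (by rw [zero_smul, zero_add]; exact k1)
  have eb : bVec g w = b := by
    rw [bVec, secondFF, ← map_smul]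
    exact starProjection_normal_eq b0 b1 b2 (c := 0) (by rw [zero_smul, zero_add]; exact k2)
  rw [f2, ea, eb, hab]

end IsConformalImmersion

end Bridge

/-! ### The vector product and the transforms -/

/-- The vector product of five vectors of `ℝ⁶`. -/
noncomputable def cross (a b c d e : E6) : E6 :=
  WithLp.toLp 2 fun k : Fin 6 => Matrix.det (Matrix.of fun i j : Fin 6 =>
    (![a, b, c, d, e, EuclideanSpace.single k (1 : ℝ)] i) j)

theorem crossVec_eq (g : ℂ → E6) (w : ℂ) : crossVec g w = cross (g w) (fderiv ℝ g w 1)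
    (fderiv ℝ g w Complex.I) (secondFF g w 1 1) (secondFF g w 1 Complex.I) := rfl

/-- The matrix with the given rows. -/
def rowMatrix (M : Fin 6 → E6) : Matrix (Fin 6) (Fin 6) ℝ := Matrix.of fun i j => M i j

theorem cross_apply_eq_det (a b c d e : E6) (k : Fin 6) :
    cross a b c d e k = (rowMatrix ![a, b, c, d, e, EuclideanSpace.single k (1 : ℝ)]).det := by
  simp only [cross, rowMatrix]

/-- A determinant is linear in its last row. -/
theorem exists_det_rowMatrix_eq_sum (a b c d e : E6) :
    ∃ m : Fin 6 → ℝ, ∀ v : E6, (rowMatrix ![a, b, c, d, e, v]).det = ∑ j, v j * m j := by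
  -- The cofactors of the last row do not depend on that row, so they are taken with `0` in its
  -- place.
  refine ⟨fun j => (-1) ^ ((Fin.last 5 : ℕ) + (j : ℕ)) * ((rowMatrix ![a, b, c, d, e, 0]).submatrix
    (Fin.succAbove (Fin.last 5)) (Fin.succAbove j)).det, fun v => ?_⟩
  have h1 : ∀ j, (rowMatrix ![a, b, c, d, e, v]).submatrix (Fin.succAbove (Fin.last 5))
      (Fin.succAbove j) = (rowMatrix ![a, b, c, d, e, 0]).submatrix (Fin.succAbove (Fin.last 5))
      (Fin.succAbove j) := by
    intro j
    ext i k
    simp only [submatrix_apply, rowMatrix, of_apply, Fin.succAbove_last]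
    generalize Fin.succAbove j k = l
    fin_cases i <;> simp only [Fin.zero_eta, Fin.mk_one, Fin.reduceFinMk, Fin.reduceCastSucc,
      Fin.castSucc_zero, Fin.castSucc_one, cons_val]
  have h2 : ∀ j, rowMatrix ![a, b, c, d, e, v] (Fin.last 5) j = v j := fun j => by
    simp only [rowMatrix, of_apply, Fin.reduceLast, cons_val]
  rw [Matrix.det_succ_row _ (Fin.last 5)]
  refine Finset.sum_congr rfl fun j _ => ?_
  rw [h1, h2, mul_comm _ (v j), mul_assoc]

theorem inner_cross (a b c d e v : E6) :
    ⟪cross a b c d e, v⟫_ℝ = (rowMatrix ![a, b, c, d, e, v]).det := by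
  obtain ⟨m, hm⟩ := exists_det_rowMatrix_eq_sum a b c d e
  rw [hm, PiLp.inner_apply]
  refine Finset.sum_congr rfl fun k _ => ?_
  rw [cross_apply_eq_det, hm, Finset.sum_eq_single k]
  · simp
  · intro j _ hj
    simp [hj]
  · simp

theorem contDiffOn_cross {U : Set ℂ} {a b c d e : ℂ → E6} (ha : ContDiffOn ℝ ∞ a U)
    (hb : ContDiffOn ℝ ∞ b U) (hc : ContDiffOn ℝ ∞ c U) (hd : ContDiffOn ℝ ∞ d U)
    (he : ContDiffOn ℝ ∞ e U) :
    ContDiffOn ℝ ∞ (fun w => cross (a w) (b w) (c w) (d w) (e w)) U := by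
  rw [contDiffOn_piLp]
  intro k
  simp only [cross_apply_eq_det, Matrix.det_apply]
  refine ContDiffOn.sum fun σ _ => ContDiffOn.const_smul _ (contDiffOn_prod fun i _ => ?_)
  simp only [rowMatrix, of_apply]
  generalize σ i = l
  have h := fun {x : ℂ → E6} (hx : ContDiffOn ℝ ∞ x U) => (contDiffOn_piLp 2).1 hx i
  fin_cases l
  · exact h ha
  · exact h hb
  · exact h hc
  · exact h hd
  · exact h he
  · exact contDiffOn_const

/-- Tested against vectors `A u`: the determinant is multiplied by `det A`, while inner products are
preserved. For `det A = -1` this is the sign change of `N`. -/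
theorem cross_map (A : E6 ≃ₗᵢ[ℝ] E6) (a b c d e : E6) :
    cross (A a) (A b) (A c) (A d) (A e) =
      LinearMap.det (A.toLinearEquiv : E6 →ₗ[ℝ] E6) • A (cross a b c d e) := by
  refine ext_inner_right ℝ fun v => ?_
  obtain ⟨u, rfl⟩ := A.surjective v
  rw [inner_smul_left, A.inner_map_map, inner_cross, inner_cross,
    ← LinearMap.det_toMatrix (EuclideanSpace.basisFun (Fin 6) ℝ).toBasis,
    ← Matrix.det_transpose (LinearMap.toMatrix _ _ _), mul_comm]
  simp only [conj_trivial]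
  rw [← Matrix.det_mul]
  congr 1
  have : ∀ x : E6, ∀ j, A x j = ∑ k, x k * (LinearMap.toMatrix
      (EuclideanSpace.basisFun (Fin 6) ℝ).toBasis (EuclideanSpace.basisFun (Fin 6) ℝ).toBasis
      (A.toLinearEquiv : E6 →ₗ[ℝ] E6))ᵀ k j := by
    intro x j
    have h1 : x = ∑ k, x k • EuclideanSpace.single k (1 : ℝ) := by
      ext i; simp [Pi.single_apply]
    have h2 : A x = ∑ k, x k • A (EuclideanSpace.single k (1 : ℝ)) := by
      conv_lhs => rw [h1]
      simp
    rw [h2]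
    simp [LinearMap.toMatrix_apply]
  ext i j
  rw [Matrix.mul_apply]
  fin_cases i <;> exact this _ j

/-- The orthogonality relations between `g, ∂g/∂x, ∂g/∂y, a, b` in an adapted coordinate. -/
structure IsRealFrame (f x y a b : E6) : Prop where
  ff : ⟪f, f⟫_ℝ = 1
  fx : ⟪f, x⟫_ℝ = 0
  fy : ⟪f, y⟫_ℝ = 0
  fa : ⟪f, a⟫_ℝ = 0
  fb : ⟪f, b⟫_ℝ = 0
  xx : 0 < ⟪x, x⟫_ℝ
  xy : ⟪x, y⟫_ℝ = 0
  xa : ⟪x, a⟫_ℝ = 0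
  xb : ⟪x, b⟫_ℝ = 0
  yy : ⟪y, y⟫_ℝ = ⟪x, x⟫_ℝ
  ya : ⟪y, a⟫_ℝ = 0
  yb : ⟪y, b⟫_ℝ = 0
  ab : ⟪a, b⟫_ℝ = 0
  bb : ⟪b, b⟫_ℝ = 1 + ⟪a, a⟫_ℝ

/-- The square of the determinant is the Gram determinant, and the Gram matrix of orthogonal rows is
diagonal. -/
theorem det_rowMatrix_sq {f x y a b n : E6} (h : IsRealFrame f x y a b) (nf : ⟪f, n⟫_ℝ = 0)
    (nx : ⟪x, n⟫_ℝ = 0) (ny : ⟪y, n⟫_ℝ = 0) (na : ⟪a, n⟫_ℝ = 0) (nb : ⟪b, n⟫_ℝ = 0) :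
    (rowMatrix ![f, x, y, (2 : ℝ) • a, (2 : ℝ) • b, n]).det ^ 2 =
      16 * ⟪x, x⟫_ℝ ^ 2 * ⟪a, a⟫_ℝ * ⟪b, b⟫_ℝ * ⟪n, n⟫_ℝ := by
  have hm : rowMatrix ![f, x, y, (2 : ℝ) • a, (2 : ℝ) • b, n] *
      (rowMatrix ![f, x, y, (2 : ℝ) • a, (2 : ℝ) • b, n])ᵀ =
      Matrix.diagonal ![1, ⟪x, x⟫_ℝ, ⟪x, x⟫_ℝ, 4 * ⟪a, a⟫_ℝ, 4 * ⟪b, b⟫_ℝ, ⟪n, n⟫_ℝ] := by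
    have hin : ∀ M : Fin 6 → E6, ∀ i j, (rowMatrix M * (rowMatrix M)ᵀ) i j = ⟪M i, M j⟫_ℝ := by
      intro M i j
      rw [Matrix.mul_apply, PiLp.inner_apply]
      exact Finset.sum_congr rfl fun k _ => by simp [rowMatrix, mul_comm]
    have xf := h.fx; have yf := h.fy; have af := h.fa; have bf := h.fb; have yx := h.xy
    have ax := h.xa; have bx := h.xb; have ay := h.ya; have by' := h.yb; have ba := h.ab
    have fn := nf; have xn := nx; have yn := ny; have an := na; have bn := nb
    rw [real_inner_comm] at xf yf af bf yx ax bx ay by' ba fn xn yn an bn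
    ext i j
    rw [hin]
    fin_cases i <;> fin_cases j <;>
      simp only [Fin.zero_eta, Fin.mk_one, Fin.reduceFinMk, Matrix.cons_val, Matrix.diagonal_apply,
        Fin.reduceEq, reduceIte, inner_smul_left, inner_smul_right, conj_trivial, mul_zero, h.ff,
        h.fx, h.fy, h.fa, h.fb, h.xy, h.xa, h.xb, h.yy, h.ya, h.yb, h.ab, nf, nx, ny, na, nb, xf,
        yf, af, bf, yx, ax, bx, ay, by', ba, fn, xn, yn, an, bn] <;> ring
  have hd := congrArg Matrix.det hm
  rw [Matrix.det_mul, Matrix.det_transpose, Matrix.det_diagonal, Fin.prod_univ_six] at hd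
  rw [sq, hd]
  simp only [Matrix.cons_val]
  ring

namespace IsRealFrame

variable {f x y a b : E6} (h : IsRealFrame f x y a b)
include h

omit h in
theorem inner_cross_zero (f x y a b : E6) :
    ⟪f, cross f x y ((2 : ℝ) • a) ((2 : ℝ) • b)⟫_ℝ = 0 ∧
    ⟪x, cross f x y ((2 : ℝ) • a) ((2 : ℝ) • b)⟫_ℝ = 0 ∧
    ⟪y, cross f x y ((2 : ℝ) • a) ((2 : ℝ) • b)⟫_ℝ = 0 ∧
    ⟪a, cross f x y ((2 : ℝ) • a) ((2 : ℝ) • b)⟫_ℝ = 0 ∧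
    ⟪b, cross f x y ((2 : ℝ) • a) ((2 : ℝ) • b)⟫_ℝ = 0 := by
  have h2 : ∀ v : E6, ⟪(2 : ℝ) • v, cross f x y ((2 : ℝ) • a) ((2 : ℝ) • b)⟫_ℝ = 0 →
      ⟪v, cross f x y ((2 : ℝ) • a) ((2 : ℝ) • b)⟫_ℝ = 0 := by
    intro v hv
    rw [inner_smul_left] at hv
    simpa using hv
  refine ⟨?_, ?_, ?_, h2 _ ?_, h2 _ ?_⟩ <;> rw [real_inner_comm, inner_cross]
  · exact Matrix.det_zero_of_row_eq (i := 0) (j := 5) (by decide) rfl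
  · exact Matrix.det_zero_of_row_eq (i := 1) (j := 5) (by decide) rfl
  · exact Matrix.det_zero_of_row_eq (i := 2) (j := 5) (by decide) rfl
  · exact Matrix.det_zero_of_row_eq (i := 3) (j := 5) (by decide) rfl
  · exact Matrix.det_zero_of_row_eq (i := 4) (j := 5) (by decide) rfl

/-- The square of the inner product of the vector product with an orthogonal vector. -/
theorem inner_cross_sq {n : E6} (nf : ⟪f, n⟫_ℝ = 0)
    (nx : ⟪x, n⟫_ℝ = 0) (ny : ⟪y, n⟫_ℝ = 0) (na : ⟪a, n⟫_ℝ = 0) (nb : ⟪b, n⟫_ℝ = 0) :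
    ⟪cross f x y ((2 : ℝ) • a) ((2 : ℝ) • b), n⟫_ℝ ^ 2 =
      16 * ⟪x, x⟫_ℝ ^ 2 * ⟪a, a⟫_ℝ * ⟪b, b⟫_ℝ * ⟪n, n⟫_ℝ := by
  rw [inner_cross, det_rowMatrix_sq h nf nx ny na nb]

theorem bb_pos : 0 < ⟪b, b⟫_ℝ := by
  rw [h.bb]; linarith [real_inner_self_nonneg (x := a)]

/-- Taking `n` to be the vector product `X` itself in `inner_cross_sq` gives the claim multiplied by
`⟪X, X⟫`. It remains to cancel this factor. -/
theorem cross_inner_self : ⟪cross f x y ((2 : ℝ) • a) ((2 : ℝ) • b),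
      cross f x y ((2 : ℝ) • a) ((2 : ℝ) • b)⟫_ℝ =
    16 * ⟪x, x⟫_ℝ ^ 2 * ⟪a, a⟫_ℝ * ⟪b, b⟫_ℝ := by
  obtain ⟨c0, c1, c2, c3, c4⟩ := inner_cross_zero f x y a b
  set X := cross f x y ((2 : ℝ) • a) ((2 : ℝ) • b) with hX
  have hsq := h.inner_cross_sq c0 c1 c2 c3 c4
  rw [← hX] at hsq
  by_cases ha : a = 0
  · rw [ha] at hsq ⊢
    simp only [inner_zero_left, mul_zero, zero_mul] at hsq ⊢
    exact pow_eq_zero_iff (two_ne_zero) |>.1 hsq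
  · have hX0 : ⟪X, X⟫_ℝ ≠ 0 := by
      intro h0
      have hX00 : X = 0 := inner_self_eq_zero.1 h0
      -- Five vectors cannot span `ℝ⁶`. A nonzero `n` orthogonal to them has nonzero product with
      -- `X` when `a ≠ 0`, so `X ≠ 0`.
      have : ∃ n : E6, n ≠ 0 ∧ ∀ i : Fin 5, ⟪![f, x, y, a, b] i, n⟫_ℝ = 0 := by
        have hlt : Module.finrank ℝ (Submodule.span ℝ (Set.range ![f, x, y, a, b])) < 6 :=
          lt_of_le_of_lt (finrank_range_le_card ![f, x, y, a, b]) (by simp)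
        have hadd := Submodule.finrank_add_finrank_orthogonal
          (Submodule.span ℝ (Set.range ![f, x, y, a, b]))
        rw [finrank_euclideanSpace_fin] at hadd
        have hpos : 0 < Module.finrank ℝ (Submodule.span ℝ (Set.range ![f, x, y, a, b]))ᗮ := by
          omega
        obtain ⟨n, hn⟩ := Module.finrank_pos_iff_exists_ne_zero.1 hpos
        refine ⟨n, fun hh => hn (Subtype.ext hh), fun i => ?_⟩
        exact (Submodule.mem_orthogonal _ _).1 n.2 _ (Submodule.subset_span ⟨i, rfl⟩)
      obtain ⟨n, hn, hn'⟩ := this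
      have := h.inner_cross_sq (hn' 0) (hn' 1) (hn' 2) (hn' 3) (hn' 4)
      rw [← hX, hX00, inner_zero_left] at this
      have hpos : 0 < 16 * ⟪x, x⟫_ℝ ^ 2 * ⟪a, a⟫_ℝ * ⟪b, b⟫_ℝ * ⟪n, n⟫_ℝ := by
        have := h.xx
        have := h.bb_pos
        have := real_inner_self_pos.2 ha
        have := real_inner_self_pos.2 hn
        positivity
      rw [← this] at hpos
      norm_num at hpos
    refine mul_right_cancel₀ hX0 ?_
    rw [← hsq, sq]

/-- The (-)transform is characterised by its inner products with the frame, up to a sign. -/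
theorem eq_of_inner {v : E6} (vv : ⟪v, v⟫_ℝ = 1) (vf : ⟪f, v⟫_ℝ = 0) (vx : ⟪x, v⟫_ℝ = 0)
    (vy : ⟪y, v⟫_ℝ = 0) (va : ⟪a, v⟫_ℝ = 0) (vb : ⟪b, v⟫_ℝ = -1)
    (hs : ⟪cross f x y ((2 : ℝ) • a) ((2 : ℝ) • b), v⟫_ℝ ≤ 0) :
    v = -((⟪b, b⟫_ℝ)⁻¹ • b) - (4 * ⟪x, x⟫_ℝ * ⟪b, b⟫_ℝ)⁻¹ •
      cross f x y ((2 : ℝ) • a) ((2 : ℝ) • b) := by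
  obtain ⟨c0, c1, c2, c3, c4⟩ := inner_cross_zero f x y a b
  have hXX := h.cross_inner_self
  have hBp := h.bb_pos
  have hxp := h.xx
  -- The summand removes the `b`-component of `v`, since `⟪b, v⟫ = -1`; the rest is orthogonal to
  -- the frame, and its product with `X` is known up to sign.
  have hsq := h.inner_cross_sq (n := v + (⟪b, b⟫_ℝ)⁻¹ • b)
    (by rw [inner_add_right, inner_smul_right, vf, h.fb]; simp)
    (by rw [inner_add_right, inner_smul_right, vx, h.xb]; simp)
    (by rw [inner_add_right, inner_smul_right, vy, h.yb]; simp)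
    (by rw [inner_add_right, inner_smul_right, va, h.ab]; simp)
    (by rw [inner_add_right, inner_smul_right, vb, inv_mul_cancel₀ hBp.ne']; simp)
  set X := cross f x y ((2 : ℝ) • a) ((2 : ℝ) • b) with hX
  have haa : ⟪a, a⟫_ℝ = ⟪b, b⟫_ℝ - 1 := by rw [h.bb]; ring
  have haa0 : 0 ≤ ⟪b, b⟫_ℝ - 1 := haa ▸ real_inner_self_nonneg
  rw [haa] at hXX hsq
  have c4' : ⟪X, b⟫_ℝ = 0 := by rw [real_inner_comm, c4]
  have vb' : ⟪v, b⟫_ℝ = -1 := by rw [real_inner_comm, vb]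
  have vX : ⟪v, X⟫_ℝ = ⟪X, v⟫_ℝ := real_inner_comm _ _
  rw [inner_add_right, inner_smul_right, c4', mul_zero, add_zero] at hsq
  simp only [inner_add_left, inner_add_right, inner_smul_left, inner_smul_right, vb, vb', vv,
    conj_trivial] at hsq
  have hX1 : ⟪X, v⟫_ℝ = -(4 * ⟪x, x⟫_ℝ * (⟪b, b⟫_ℝ - 1)) := by
    have e : ⟪X, v⟫_ℝ ^ 2 = (4 * ⟪x, x⟫_ℝ * (⟪b, b⟫_ℝ - 1)) ^ 2 := by
      rw [hsq]; field_simp; ring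
    rcases sq_eq_sq_iff_eq_or_eq_neg.1 e with e | e
    · have : 0 ≤ 4 * ⟪x, x⟫_ℝ * (⟪b, b⟫_ℝ - 1) := by positivity
      linarith
    · exact e
  -- Showing that the difference has norm zero treats `a = 0`, where `X = 0`, together with the
  -- general case.
  rw [← sub_eq_zero, ← inner_self_eq_zero (𝕜 := ℝ)]
  simp only [inner_sub_left, inner_sub_right, inner_neg_left, inner_neg_right, inner_smul_left,
    inner_smul_right, conj_trivial, vv, vb, vb', c4, c4', hXX, vX, hX1]
  field_simp
  ring

end IsRealFrame

namespace IsAdaptedMinimal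

variable {U : Set ℂ} {g : ℂ → E6} (hg : IsAdaptedMinimal U (cplx g)) (hU : IsOpen U) {w : ℂ}
  (hw : w ∈ U)
include hg hU hw

theorem f2_eq : toC (aVec g w) - Complex.I • toC (bVec g w) = normalSecond (cplx g) w :=
  hg.toIsConformalImmersion.f2_eq hU hw

theorem isRealFrame : IsRealFrame (g w) (fderiv ℝ g w 1) (fderiv ℝ g w Complex.I) (aVec g w)
    (bVec g w) := by
  have hab := hg.f2_eq hU hw
  have hx := hg.toC_fderiv_one hU hw
  have hy := hg.toC_fderiv_I hU hw
  obtain ⟨hxx, hxy, hyy, hfx, hfy⟩ := hg.inner_fderiv hU hw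
  have n0 : (toC (aVec g w) - Complex.I • toC (bVec g w)) ⬝ᵥ toC (g w) = 0 := by
    rw [hab]; exact hg.normalSecond_dot hU hw
  have n1 : (toC (aVec g w) - Complex.I • toC (bVec g w)) ⬝ᵥ toC (fderiv ℝ g w 1) = 0 := by
    rw [hab, hx, dotProduct_add, hg.normalSecond_dot_one hU hw,
      hg.normalSecond_dot_star_one hw, add_zero]
  have n2 : (toC (aVec g w) - Complex.I • toC (bVec g w)) ⬝ᵥ toC (fderiv ℝ g w Complex.I) = 0 := by
    rw [hab, hy, dotProduct_smul, dotProduct_sub,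
      hg.normalSecond_dot_one hU hw, hg.normalSecond_dot_star_one hw, sub_zero, smul_zero]
  obtain ⟨a0, b0⟩ := toC_sub_I_dot_eq_zero n0
  obtain ⟨a1, b1⟩ := toC_sub_I_dot_eq_zero n1
  obtain ⟨a2, b2⟩ := toC_sub_I_dot_eq_zero n2
  have eff : (⟪g w, g w⟫_ℝ : ℂ) = 1 := by
    rw [← toC_dotProduct_toC]; exact hg.dot_self w hw
  have enn := hg.normalSecond_dot_self hU hw
  rw [← hab, dotProduct_sub, dotProduct_smul, toC_sub_I_dot, toC_sub_I_dot, smul_eq_mul,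
    real_inner_comm (bVec g w) (aVec g w)] at enn
  have enn1 := congrArg Complex.re enn
  have enn2 := congrArg Complex.im enn
  simp only [Complex.sub_re, Complex.mul_re, Complex.I_re, Complex.I_im, Complex.ofReal_re,
    Complex.ofReal_im, Complex.sub_im, Complex.mul_im, Complex.neg_re, Complex.one_re,
    Complex.neg_im, Complex.one_im] at enn1 enn2
  constructor
  · exact_mod_cast eff
  · exact hfx
  · exact hfy
  · rw [real_inner_comm]; exact a0
  · rw [real_inner_comm]; exact b0
  · exact hxx
  · exact hxy
  · rw [real_inner_comm]; exact a1
  · rw [real_inner_comm]; exact b1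
  · exact hyy
  · rw [real_inner_comm]; exact a2
  · rw [real_inner_comm]; exact b2
  · rw [real_inner_comm]; linarith
  · linarith

/-- Minimality makes `∂²g/∂x² + ∂²g/∂y²` a multiple of `g`, whose normal projection is zero; hence
`II(∂y, ∂y) = -II(∂x, ∂x)`. -/
theorem secondFF_one_one : secondFF g w 1 1 = (2 : ℝ) • aVec g w := by
  have hfr := hg.isRealFrame hU hw
  have h1 := hg.minimal w hw
  have hE : ∃ r : ℝ, -(wirtinger (cplx g) w ⬝ᵥ star (wirtinger (cplx g) w)) = (r : ℂ) := by
    have := star_dotProduct_star_self (wirtinger (cplx g) w)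
    exact ⟨-(wirtinger (cplx g) w ⬝ᵥ star (wirtinger (cplx g) w)).re, by
      rw [Complex.ofReal_neg, Complex.conj_eq_iff_re.1 this]⟩
  obtain ⟨r, hr⟩ := hE
  rw [wirtingerBar_wirtinger_cplx hU (contDiffOn_of_cplx hg.smooth) hw, hr] at h1
  have h2 : (1 / 4 : ℝ) • (fderiv ℝ (fderiv ℝ g) w 1 1 +
      fderiv ℝ (fderiv ℝ g) w Complex.I Complex.I) = r • g w := by
    apply toC_injective
    rw [h1, toC_smul]; rfl
  have h3 : (1 / 4 : ℝ) • (secondFF g w 1 1 + secondFF g w Complex.I Complex.I) = 0 := by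
    rw [secondFF, secondFF, ← map_add, ← map_smul, h2]
    exact starProjection_normal_eq (by simp) (by simp) (by simp) (c := r) (X := 0) (by simp)
  have h4 : secondFF g w Complex.I Complex.I = -secondFF g w 1 1 := by
    have := (smul_eq_zero.1 h3).resolve_left (by norm_num)
    exact (neg_eq_of_add_eq_zero_right this).symm
  rw [aVec, h4]
  module

omit hg hU hw in
theorem _root_.secondFF_one_I (g : ℂ → E6) (w : ℂ) :
    secondFF g w 1 Complex.I = (2 : ℝ) • bVec g w := by
  rw [bVec]; module

theorem crossVec_eq_cross : crossVec g w = cross (g w) (fderiv ℝ g w 1)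
    (fderiv ℝ g w Complex.I) ((2 : ℝ) • aVec g w) ((2 : ℝ) • bVec g w) := by
  rw [crossVec_eq, hg.secondFF_one_one hU hw, secondFF_one_I]

theorem cosh_phi : Real.cosh (phi g w) = ‖bVec g w‖ := by
  have := (hg.isRealFrame hU hw).bb
  rw [real_inner_self_eq_norm_sq, real_inner_self_eq_norm_sq] at this
  rw [phi, Real.cosh_arsinh, ← this, Real.sqrt_sq (norm_nonneg _)]

theorem smul_bVec_eq : (1 / Real.cosh (phi g w)) • (‖bVec g w‖⁻¹ • bVec g w) =
    (⟪bVec g w, bVec g w⟫_ℝ)⁻¹ • bVec g w := by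
  rw [hg.cosh_phi hU hw, smul_smul, real_inner_self_eq_norm_sq, one_div, sq, mul_inv]

/-- The vector product has length `4 |∂g/∂x|² |a| |b|`, and `tanh φ = |a| / |b|`, so `|a|` cancels.
The right-hand side is smooth across the zeros of `a`, where `N` itself is not defined
geometrically. -/
theorem tanh_smul_normal_eq : Real.tanh (phi g w) • normal g w =
    (4 * ⟪fderiv ℝ g w 1, fderiv ℝ g w 1⟫_ℝ * ⟪bVec g w, bVec g w⟫_ℝ)⁻¹ • crossVec g w := by
  have hfr := hg.isRealFrame hU hw
  have hb := hg.cosh_phi hU hw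
  have ha : Real.sinh (phi g w) = ‖aVec g w‖ := Real.sinh_arsinh _
  have hX := hfr.cross_inner_self
  rw [← hg.crossVec_eq_cross hU hw] at hX
  have hbp := hfr.bb_pos
  have hxp := hfr.xx
  have hbn : 0 < ‖bVec g w‖ := by
    rw [real_inner_self_eq_norm_sq] at hbp
    exact lt_of_le_of_ne (norm_nonneg _) fun h => by simp [← h] at hbp
  have hX' : ‖crossVec g w‖ = 4 * ⟪fderiv ℝ g w 1, fderiv ℝ g w 1⟫_ℝ * ‖aVec g w‖ *
      ‖bVec g w‖ := by
    rw [← sq_eq_sq₀ (norm_nonneg _) (by positivity), ← real_inner_self_eq_norm_sq, hX,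
      real_inner_self_eq_norm_sq (aVec g w), real_inner_self_eq_norm_sq (bVec g w)]
    ring
  rw [Real.tanh_eq_sinh_div_cosh, ha, hb, normal, smul_smul, real_inner_self_eq_norm_sq (bVec g w)]
  rcases eq_or_ne ‖aVec g w‖ 0 with h0 | h0
  · rw [h0, mul_zero, zero_mul] at hX'
    rw [norm_eq_zero.1 hX', smul_zero, smul_zero]
  · rw [hX']
    congr 1
    field_simp

theorem plusTransform_eq : plusTransform g w = -((⟪bVec g w, bVec g w⟫_ℝ)⁻¹ • bVec g w) +
    (4 * ⟪fderiv ℝ g w 1, fderiv ℝ g w 1⟫_ℝ * ⟪bVec g w, bVec g w⟫_ℝ)⁻¹ • crossVec g w := by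
  rw [plusTransform, hg.smul_bVec_eq hU hw, hg.tanh_smul_normal_eq hU hw]

theorem minusTransform_eq : minusTransform g w = -((⟪bVec g w, bVec g w⟫_ℝ)⁻¹ • bVec g w) -
    (4 * ⟪fderiv ℝ g w 1, fderiv ℝ g w 1⟫_ℝ * ⟪bVec g w, bVec g w⟫_ℝ)⁻¹ • crossVec g w := by
  rw [minusTransform, hg.smul_bVec_eq hU hw, hg.tanh_smul_normal_eq hU hw]

omit hw

theorem contDiffOn_aVec : ContDiffOn ℝ ∞ (aVec g) U := by
  have hn := hg.smooth_normalSecond hU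
  refine (rePart.contDiff.comp_contDiffOn hn).congr fun w hw => ?_
  change aVec g w = rePart (normalSecond (cplx g) w)
  rw [← hg.f2_eq hU hw]
  ext i
  simp [rePart_apply, toC]

theorem contDiffOn_bVec : ContDiffOn ℝ ∞ (bVec g) U := by
  have hn := (hg.smooth_normalSecond hU).const_csmul Complex.I
  refine (rePart.contDiff.comp_contDiffOn hn).congr fun w hw => ?_
  change bVec g w = rePart (Complex.I • normalSecond (cplx g) w)
  rw [← hg.f2_eq hU hw]
  ext i
  simp [rePart_apply, toC]

theorem contDiffOn_crossVec : ContDiffOn ℝ ∞ (crossVec g) U := by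
  have hs := contDiffOn_of_cplx hg.smooth
  exact (contDiffOn_cross hs (contDiffOn_fderiv_apply hU hs 1)
    (contDiffOn_fderiv_apply hU hs Complex.I) ((hg.contDiffOn_aVec hU).const_smul _)
    ((hg.contDiffOn_bVec hU).const_smul _)).congr fun w hw => hg.crossVec_eq_cross hU hw

theorem contDiffOn_inv_bVec_smul :
    ContDiffOn ℝ ∞ (fun w => (⟪bVec g w, bVec g w⟫_ℝ)⁻¹ • bVec g w) U := by
  have hb := hg.contDiffOn_bVec hU
  exact ((hb.inner ℝ hb).inv fun w hw => (hg.isRealFrame hU hw).bb_pos.ne').smul hb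

theorem contDiffOn_inv_smul_crossVec : ContDiffOn ℝ ∞ (fun w =>
    (4 * ⟪fderiv ℝ g w 1, fderiv ℝ g w 1⟫_ℝ * ⟪bVec g w, bVec g w⟫_ℝ)⁻¹ • crossVec g w) U := by
  have hb := hg.contDiffOn_bVec hU
  have hx := contDiffOn_fderiv_apply hU (contDiffOn_of_cplx hg.smooth) 1
  refine (((contDiffOn_const.mul (hx.inner ℝ hx)).mul (hb.inner ℝ hb)).inv fun w hw => ?_).smul
    (hg.contDiffOn_crossVec hU)
  have h1 := (hg.isRealFrame hU hw).bb_pos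
  have h2 := (hg.isRealFrame hU hw).xx
  positivity

theorem contDiffOn_plusTransform : ContDiffOn ℝ ∞ (plusTransform g) U :=
  ((hg.contDiffOn_inv_bVec_smul hU).neg.add (hg.contDiffOn_inv_smul_crossVec hU)).congr
    fun _ hw => hg.plusTransform_eq hU hw

theorem contDiffOn_minusTransform : ContDiffOn ℝ ∞ (minusTransform g) U :=
  ((hg.contDiffOn_inv_bVec_smul hU).neg.sub (hg.contDiffOn_inv_smul_crossVec hU)).congr
    fun _ hw => hg.minusTransform_eq hU hw

/-- The (+)transform is a polar of the surface. -/
theorem isPolar_plusTransform : IsPolar U (cplx g) (cplx (plusTransform g)) := by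
  have key : ∀ w ∈ U, ⟪plusTransform g w, plusTransform g w⟫_ℝ = 1 ∧
      ⟪g w, plusTransform g w⟫_ℝ = 0 ∧ ⟪fderiv ℝ g w 1, plusTransform g w⟫_ℝ = 0 ∧
      ⟪fderiv ℝ g w Complex.I, plusTransform g w⟫_ℝ = 0 ∧
      ⟪aVec g w, plusTransform g w⟫_ℝ = 0 ∧ ⟪bVec g w, plusTransform g w⟫_ℝ = -1 := by
    intro w hw
    have hfr := hg.isRealFrame hU hw
    obtain ⟨c0, c1, c2, c3, c4⟩ := IsRealFrame.inner_cross_zero (g w) (fderiv ℝ g w 1)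
      (fderiv ℝ g w Complex.I) (aVec g w) (bVec g w)
    have hXX := hfr.cross_inner_self
    rw [← hg.crossVec_eq_cross hU hw] at c0 c1 c2 c3 c4 hXX
    have hB := hfr.bb_pos
    have hx := hfr.xx
    have c4' : ⟪crossVec g w, bVec g w⟫_ℝ = 0 := by rw [real_inner_comm, c4]
    have haa : ⟪aVec g w, aVec g w⟫_ℝ = ⟪bVec g w, bVec g w⟫_ℝ - 1 := by rw [hfr.bb]; ring
    rw [hg.plusTransform_eq hU hw]
    simp only [inner_add_left, inner_add_right, inner_neg_left, inner_neg_right, inner_smul_left,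
      inner_smul_right, conj_trivial, c0, c1, c2, c3, c4, c4', hXX, hfr.fb, hfr.xb, hfr.yb,
      hfr.ab, haa, mul_zero, neg_zero, add_zero, true_and]
    constructor
    · field_simp; ring
    · field_simp
  refine ⟨contDiffOn_cplx (hg.contDiffOn_plusTransform hU), fun w _ => star_toC _,
    fun w hw => ?_, fun w hw => ?_, fun w hw => ?_, fun w hw => ?_⟩ <;>
    obtain ⟨k0, k1, k2, k3, k4, k5⟩ := key w hw
  · rw [cplx, toC_dotProduct_toC, k0, Complex.ofReal_one]
  · rw [cplx, cplx, dotProduct_comm, toC_dotProduct_toC, k1, Complex.ofReal_zero]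
  · rw [cplx, wirtinger_cplx ((contDiffOn_of_cplx hg.smooth).diffAt hU hw), dotProduct_smul,
      dotProduct_sub, dotProduct_smul, dotProduct_comm, dotProduct_comm _ (toC (fderiv ℝ g w _)),
      toC_dotProduct_toC, toC_dotProduct_toC, k2, k3]
    simp
  · rw [cplx, ← hg.f2_eq hU hw, dotProduct_comm, toC_sub_I_dot, k4, k5]
    simp

theorem inner_crossVec_plusTransform {w : ℂ} (hw : w ∈ U) :
    0 ≤ ⟪crossVec g w, plusTransform g w⟫_ℝ := by
  have hfr := hg.isRealFrame hU hw
  have c4 := (IsRealFrame.inner_cross_zero (g w) (fderiv ℝ g w 1)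
    (fderiv ℝ g w Complex.I) (aVec g w) (bVec g w)).2.2.2.2
  rw [← hg.crossVec_eq_cross hU hw] at c4
  have c4' : ⟪crossVec g w, bVec g w⟫_ℝ = 0 := by rw [real_inner_comm, c4]
  have h1 := hfr.bb_pos
  have h2 := hfr.xx
  rw [hg.plusTransform_eq hU hw, inner_add_right, inner_neg_right, inner_smul_right,
    inner_smul_right, c4', mul_zero, neg_zero, zero_add]
  exact mul_nonneg (inv_nonneg.2 (by positivity)) real_inner_self_nonneg

end IsAdaptedMinimal

/-- The matrix expresses `g, ∂g, ∂̄g, f₂, f̄₂, v` through `g, ∂g/∂x, ∂g/∂y, 2a, 2b, v`; each of its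
two `2 × 2` blocks has determinant `i / 2`. -/
theorem det_realification :
    (!![1, 0, 0, 0, 0, 0;
       0, 1 / 2, -Complex.I / 2, 0, 0, 0;
       0, 1 / 2, Complex.I / 2, 0, 0, 0;
       0, 0, 0, 1 / 2, -Complex.I / 2, 0;
       0, 0, 0, 1 / 2, Complex.I / 2, 0;
       0, 0, 0, 0, 0, 1] : Matrix (Fin 6) (Fin 6) ℂ).det = -1 / 4 := by
  simp [Matrix.det_succ_row_zero, Fin.sum_univ_succ, Fin.succAbove]
  linear_combination (1 / 4 : ℂ) * Complex.I_mul_I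

namespace IsAdaptedMinimal

variable {U : Set ℂ} {g : ℂ → E6} (hg : IsAdaptedMinimal U (cplx g)) (hU : IsOpen U)
include hg hU

theorem inner_crossVec_eq_sixDet {w : ℂ} (hw : w ∈ U) (v : E6) :
    (⟪crossVec g w, v⟫_ℝ : ℂ) = -4 * sixDet ![cplx g w, wirtinger (cplx g) w,
      star (wirtinger (cplx g) w), normalSecond (cplx g) w, star (normalSecond (cplx g) w),
      toC v] := by
  have hmul : (Matrix.of ![cplx g w, wirtinger (cplx g) w,
      star (wirtinger (cplx g) w), normalSecond (cplx g) w, star (normalSecond (cplx g) w),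
      toC v]) = !![1, 0, 0, 0, 0, 0;
       0, 1 / 2, -Complex.I / 2, 0, 0, 0;
       0, 1 / 2, Complex.I / 2, 0, 0, 0;
       0, 0, 0, 1 / 2, -Complex.I / 2, 0;
       0, 0, 0, 1 / 2, Complex.I / 2, 0;
       0, 0, 0, 0, 0, 1] * (rowMatrix ![g w, fderiv ℝ g w 1, fderiv ℝ g w Complex.I,
        (2 : ℝ) • aVec g w, (2 : ℝ) • bVec g w, v]).map Complex.ofRealHom := by
    have hd := (contDiffOn_of_cplx hg.smooth).diffAt hU hw
    ext i j
    rw [Matrix.mul_apply, Fin.sum_univ_six]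
    fin_cases i
    · simp [rowMatrix, cplx, toC]
    · simp only [Fin.mk_one, of_apply, cons_val]
      rw [wirtinger_cplx hd]
      simp [rowMatrix, toC]
      ring
    · simp only [Fin.reduceFinMk, of_apply, cons_val]
      rw [star_wirtinger_cplx hd]
      simp [rowMatrix, toC]
      ring
    · simp only [Fin.reduceFinMk, of_apply, cons_val]
      rw [← hg.f2_eq hU hw]
      simp [rowMatrix, toC]
      ring
    · simp only [Fin.reduceFinMk, of_apply, cons_val]
      rw [← hg.f2_eq hU hw]
      simp [rowMatrix, toC]
      ring
    · simp [rowMatrix, toC]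
  rw [hg.crossVec_eq_cross hU hw, inner_cross, sixDet, hmul, Matrix.det_mul, det_realification,
    ← RingHom.mapMatrix_apply, ← RingHom.map_det]
  simp only [Complex.ofRealHom_eq_coe]
  ring

/-- A vector field with the algebraic properties of the (-)transform and the right orientation is
the (-)transform. -/
theorem eq_minusTransform {v : ℂ → E6} (hv : IsPolar U (cplx g) (cplx v)) {w : ℂ} (hw : w ∈ U)
    (hs : ⟪crossVec g w, v w⟫_ℝ ≤ 0) : v w = minusTransform g w := by
  have hfr := hg.isRealFrame hU hw
  have e := hg.crossVec_eq_cross hU hw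
  have hn := hv.dot_normalSecond w hw
  rw [← hg.f2_eq hU hw, cplx, dotProduct_comm, toC_sub_I_dot] at hn
  have hn1 := congrArg Complex.re hn
  have hn2 := congrArg Complex.im hn
  simp only [Complex.sub_re, Complex.mul_re, Complex.I_re, Complex.I_im, Complex.ofReal_re,
    Complex.ofReal_im, Complex.sub_im, Complex.mul_im] at hn1 hn2
  have hx : (⟪fderiv ℝ g w 1, v w⟫_ℝ : ℂ) = 0 := by
    rw [← toC_dotProduct_toC, hg.toC_fderiv_one hU hw, dotProduct_comm]
    change cplx v w ⬝ᵥ _ = 0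
    rw [dotProduct_add, hv.dot_one w hw, hv.dot_star_one hw, add_zero]
  have hy : (⟪fderiv ℝ g w Complex.I, v w⟫_ℝ : ℂ) = 0 := by
    rw [← toC_dotProduct_toC, hg.toC_fderiv_I hU hw, dotProduct_comm]
    change cplx v w ⬝ᵥ _ = 0
    rw [dotProduct_smul, dotProduct_sub, hv.dot_one w hw, hv.dot_star_one hw, sub_zero, smul_zero]
  have hf : (⟪g w, v w⟫_ℝ : ℂ) = 0 := by
    rw [← toC_dotProduct_toC, dotProduct_comm]; exact hv.dot w hw
  have hvv : (⟪v w, v w⟫_ℝ : ℂ) = 1 := by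
    rw [← toC_dotProduct_toC]; exact hv.dot_self w hw
  rw [hg.minusTransform_eq hU hw, e]
  rw [e] at hs
  exact hfr.eq_of_inner (by exact_mod_cast hvv) (by exact_mod_cast hf) (by exact_mod_cast hx)
    (by exact_mod_cast hy) (by linarith) (by linarith) hs

theorem isAdaptedMinimal_plusTransform : IsAdaptedMinimal U (cplx (plusTransform g)) :=
  (hg.isPolar_plusTransform hU).isAdaptedMinimal hg hU

/-- The (-)transform inverts the (+)transform. -/
theorem minusTransform_plusTransform {w : ℂ} (hw : w ∈ U) :
    minusTransform (plusTransform g) w = g w := by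
  have hK := hg.isPolar_plusTransform hU
  have hh := hg.isAdaptedMinimal_plusTransform hU
  have hs := hK.symm hg hU
  refine eqOn_of_ne_zero_or_eventually_zero hU
    (a := fun w => normalSecond (cplx g) w + star (normalSecond (cplx g) w))
    (hh.contDiffOn_minusTransform hU).continuousOn (contDiffOn_of_cplx hg.smooth).continuousOn
    (fun z hz ha => ?_) (fun z hz ha => ?_) hw
  -- By symmetry `g` is a polar of its (+)transform, so it is one of the two transforms there; the
  -- frame determinants supply the sign.
  · refine (hh.eq_minusTransform hU hs hz ?_).symm
    obtain ⟨δ, hδ, h⟩ := hK.sixDet_eq hg hU hz ha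
    have h1 := hh.inner_crossVec_eq_sixDet hU hz (g z)
    have h2 := hg.inner_crossVec_eq_sixDet hU hz (plusTransform g z)
    change _ = -4 * sixDet ![_, _, _, _, _, cplx g z] at h1
    change _ = -4 * sixDet ![_, _, _, _, _, cplx (plusTransform g) z] at h2
    have h3 : (⟪crossVec (plusTransform g) z, g z⟫_ℝ : ℂ) =
        -(δ : ℂ) * (⟪crossVec g z, plusTransform g z⟫_ℝ : ℂ) := by
      rw [h1, h, h2]; ring
    have h4 : ⟪crossVec (plusTransform g) z, g z⟫_ℝ =
        -δ * ⟪crossVec g z, plusTransform g z⟫_ℝ := by exact_mod_cast h3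
    rw [h4, neg_mul]
    exact neg_nonpos.2 (mul_nonneg hδ (hg.inner_crossVec_plusTransform hU hz))
  · refine (hh.eq_minusTransform hU hs hz ?_).symm
    have h1 := hK.normalSecond_of_zero hg hU hz ha
    rw [← hh.f2_eq hU hz] at h1
    -- With this vector zero the vector product vanishes, so the sign condition holds as `0 ≤ 0`.
    have h2 : aVec (plusTransform g) z = 0 := by
      ext i
      have := congrArg Complex.re (congrFun h1 i)
      simpa [toC, cplx] using this
    have h3 := (hh.isRealFrame hU hz).cross_inner_self
    rw [← hh.crossVec_eq_cross hU hz, h2, inner_zero_left, mul_zero, zero_mul,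
      inner_self_eq_zero] at h3
    rw [h3, inner_zero_left]

end IsAdaptedMinimal

/-! ### Equivariance under orthogonal maps -/

section Equivariance

variable (A : E6 ≃ₗᵢ[ℝ] E6) (g : ℂ → E6) (w : ℂ)

theorem fderiv_isometry_comp : fderiv ℝ (fun z => A (g z)) w =
    (A.toContinuousLinearEquiv : E6 →L[ℝ] E6).comp (fderiv ℝ g w) :=
  A.toContinuousLinearEquiv.comp_fderiv

theorem fderiv_isometry_comp_apply (X : ℂ) :
    fderiv ℝ (fun z => A (g z)) w X = A (fderiv ℝ g w X) := by
  rw [fderiv_isometry_comp]; rfl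

theorem fderiv_fderiv_isometry_comp (X Y : ℂ) :
    fderiv ℝ (fderiv ℝ (fun z => A (g z))) w X Y = A (fderiv ℝ (fderiv ℝ g) w X Y) := by
  have h : fderiv ℝ (fun z => A (g z)) = fun z =>
      ((ContinuousLinearEquiv.refl ℝ ℂ).arrowCongr A.toContinuousLinearEquiv) (fderiv ℝ g z) := by
    funext z
    rw [fderiv_isometry_comp]
    ext1 x
    simp
  rw [h]
  have := ((ContinuousLinearEquiv.refl ℝ ℂ).arrowCongr A.toContinuousLinearEquiv).comp_fderiv
    (f := fderiv ℝ g) (x := w)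
  have h2 := congrArg (fun T : ℂ →L[ℝ] ℂ →L[ℝ] E6 => T X Y) this
  exact h2.trans (by simp)

theorem secondFF_isometry_comp (X Y : ℂ) :
    secondFF (fun z => A (g z)) w X Y = A (secondFF g w X Y) := by
  rw [secondFF, secondFF, fderiv_fderiv_isometry_comp]
  set K := Submodule.span ℝ {g w} ⊔ LinearMap.range (fderiv ℝ g w).toLinearMap with hK
  have hmap : Submodule.span ℝ {A (g w)} ⊔
      LinearMap.range (fderiv ℝ (fun z => A (g z)) w).toLinearMap =
      K.map (A.toLinearEquiv : E6 →ₗ[ℝ] E6) := by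
    rw [hK, Submodule.map_sup, Submodule.map_span, Set.image_singleton, ← LinearMap.range_comp,
      fderiv_isometry_comp]
    rfl
  apply Submodule.eq_starProjection_of_mem_orthogonal
  · rw [hmap, Submodule.mem_orthogonal]
    rintro _ ⟨u, hu, rfl⟩
    change ⟪A u, A _⟫_ℝ = 0
    rw [A.inner_map_map]
    exact (Submodule.mem_orthogonal _ _).1 (Submodule.starProjection_apply_mem _ _) u hu
  · rw [← map_sub, hmap]
    apply Submodule.le_orthogonal_orthogonal
    refine ⟨_, ?_, rfl⟩
    have := Submodule.sub_starProjection_mem_orthogonal (K := Kᗮ) (fderiv ℝ (fderiv ℝ g) w X Y)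
    rwa [Submodule.orthogonal_orthogonal] at this

theorem aVec_isometry_comp : aVec (fun z => A (g z)) w = A (aVec g w) := by
  simp only [aVec, secondFF_isometry_comp, map_sub, map_smul]

theorem bVec_isometry_comp : bVec (fun z => A (g z)) w = A (bVec g w) := by
  simp only [bVec, secondFF_isometry_comp, map_smul]

theorem phi_isometry_comp : phi (fun z => A (g z)) w = phi g w := by
  simp only [phi, aVec_isometry_comp, A.norm_map]

variable {A} (hA : LinearMap.det (A.toLinearEquiv : E6 →ₗ[ℝ] E6) = -1)
include hA

theorem crossVec_reflection_comp : crossVec (fun z => A (g z)) w = -A (crossVec g w) := by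
  rw [crossVec_eq, crossVec_eq, fderiv_isometry_comp_apply, fderiv_isometry_comp_apply,
    secondFF_isometry_comp, secondFF_isometry_comp, cross_map, hA, neg_one_smul]

theorem normal_reflection_comp : normal (fun z => A (g z)) w = -A (normal g w) := by
  rw [normal, normal, crossVec_reflection_comp g w hA, norm_neg, A.norm_map, smul_neg, map_smul]

/-- A reflection carries `b` and `φ` along but reverses `N`, so the two transforms are exchanged. -/
theorem plusTransform_reflection_comp :
    plusTransform (fun z => A (g z)) w = A (minusTransform g w) := by
  rw [plusTransform, minusTransform, phi_isometry_comp, bVec_isometry_comp, A.norm_map,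
    normal_reflection_comp g w hA]
  simp only [map_sub, map_neg, map_smul, smul_neg, ← sub_eq_add_neg]

theorem minusTransform_reflection_comp :
    minusTransform (fun z => A (g z)) w = A (plusTransform g w) := by
  rw [plusTransform, minusTransform, phi_isometry_comp, bVec_isometry_comp, A.norm_map,
    normal_reflection_comp g w hA]
  simp only [map_add, map_neg, map_smul, smul_neg, sub_neg_eq_add]

end Equivariance

/-! ### Complex linear extension of isometries and the invariants `α`, `γ` -/

section Complexification

/-- The complex linear extension of an isometry of `ℝ⁶`. -/
noncomputable def complexify (A : E6 ≃ₗᵢ[ℝ] E6) : (Fin 6 → ℂ) →ₗ[ℂ] (Fin 6 → ℂ) :=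
  Matrix.toLin' (Matrix.of fun i j => ((A (EuclideanSpace.single j (1 : ℝ)) i : ℝ) : ℂ))

variable (A : E6 ≃ₗᵢ[ℝ] E6)

theorem complexify_toC (v : E6) : complexify A (toC v) = toC (A v) := by
  have h1 : v = ∑ k, v k • EuclideanSpace.single k (1 : ℝ) := by
    ext i; simp [Pi.single_apply]
  have h2 : A v = ∑ k, v k • A (EuclideanSpace.single k (1 : ℝ)) := by
    conv_lhs => rw [h1]
    simp
  ext i
  rw [h2]
  simp [complexify, Matrix.toLin'_apply, Matrix.mulVec, dotProduct, toC, mul_comm]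

theorem complexify_dot (u v : Fin 6 → ℂ) : complexify A u ⬝ᵥ complexify A v = u ⬝ᵥ v := by
  obtain ⟨a, b, rfl⟩ := exists_eq_toC u
  obtain ⟨c, d, rfl⟩ := exists_eq_toC v
  simp only [map_sub, map_smul, complexify_toC, sub_dotProduct, dotProduct_sub, smul_dotProduct,
    dotProduct_smul, toC_dotProduct_toC, A.inner_map_map]

theorem complexify_star (u : Fin 6 → ℂ) : star (complexify A u) = complexify A (star u) := by
  obtain ⟨a, b, rfl⟩ := exists_eq_toC u
  simp only [map_sub, map_smul, complexify_toC, star_sub, star_smul, star_toC]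

theorem complexify_symm (u : Fin 6 → ℂ) : complexify A.symm (complexify A u) = u := by
  obtain ⟨a, b, rfl⟩ := exists_eq_toC u
  simp only [map_sub, map_smul, complexify_toC, A.symm_apply_apply]

theorem complexify_symm' (u : Fin 6 → ℂ) : complexify A (complexify A.symm u) = u := by
  obtain ⟨a, b, rfl⟩ := exists_eq_toC u
  simp only [map_sub, map_smul, complexify_toC, A.apply_symm_apply]

/-- `complexify` as a continuous real linear equivalence. -/
noncomputable def complexifyEquiv : (Fin 6 → ℂ) ≃L[ℝ] (Fin 6 → ℂ) :=
  ContinuousLinearEquiv.equivOfInverse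
    ((complexify A).restrictScalars ℝ).toContinuousLinearMap
    ((complexify A.symm).restrictScalars ℝ).toContinuousLinearMap
    (complexify_symm A) (complexify_symm' A)

theorem fderiv_complexify_comp (h : ℂ → Fin 6 → ℂ) (w X : ℂ) :
    fderiv ℝ (fun z => complexify A (h z)) w X = complexify A (fderiv ℝ h w X) :=
  congrArg (fun T : ℂ →L[ℝ] (Fin 6 → ℂ) => T X)
    ((complexifyEquiv A).comp_fderiv (f := h) (x := w))

theorem wirtinger_complexify_comp (h : ℂ → Fin 6 → ℂ) (w : ℂ) :
    wirtinger (fun z => complexify A (h z)) w = complexify A (wirtinger h w) := by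
  simp only [wirtinger, fderiv_complexify_comp, map_smul, map_sub]

theorem wirtingerBar_complexify_comp (h : ℂ → Fin 6 → ℂ) (w : ℂ) :
    wirtingerBar (fun z => complexify A (h z)) w = complexify A (wirtingerBar h w) := by
  simp only [wirtingerBar, fderiv_complexify_comp, map_smul, map_add]

theorem cplx_isometry_comp (g : ℂ → E6) :
    cplx (fun z => A (g z)) = fun z => complexify A (cplx g z) := by
  funext z
  rw [cplx, ← complexify_toC]; rfl

theorem f1_isometry_comp (g : ℂ → E6) :
    f1 (fun z => A (g z)) = fun z => complexify A (f1 g z) := by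
  funext z
  rw [f1_eq, f1_eq, cplx_isometry_comp, wirtinger_complexify_comp]

theorem f2_isometry_comp (g : ℂ → E6) :
    f2 (fun z => A (g z)) = fun z => complexify A (f2 g z) := by
  funext z
  rw [f2, f2, aVec_isometry_comp, bVec_isometry_comp, map_sub, map_smul, complexify_toC,
    complexify_toC]

theorem gamma_isometry_comp (g h : ℂ → E6) (w : ℂ) :
    gamma (fun z => A (g z)) (fun z => A (h z)) w = gamma g h w := by
  rw [gamma, gamma, f1_isometry_comp, f1_isometry_comp, dz_eq_wirtinger,
    wirtinger_complexify_comp, complexify_dot]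
  rfl

/-- The bilinear product is invariant under `A`, so the sign comes from `N` alone. -/
theorem alpha_reflection_comp (hA : LinearMap.det (A.toLinearEquiv : E6 →ₗ[ℝ] E6) = -1)
    (g : ℂ → E6) (w : ℂ) : alpha (fun z => A (g z)) w = -alpha g w := by
  rw [alpha, alpha, f2_isometry_comp, normal_reflection_comp g w hA, dz_eq_wirtinger,
    wirtinger_complexify_comp, ← map_neg, ← complexify_toC, complexify_dot, dz_eq_wirtinger]
  have : toC (-normal g w) = -toC (normal g w) := toCL.map_neg _
  rw [this, dotProduct_neg]

theorem IsAdaptedMinimal.isometry_comp {U : Set ℂ} {g : ℂ → E6}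
    (hg : IsAdaptedMinimal U (cplx g)) : IsAdaptedMinimal U (cplx fun z => A (g z)) := by
  have h1 : wirtinger (fun z => complexify A (cplx g z)) =
      fun z => complexify A (wirtinger (cplx g) z) :=
    funext (wirtinger_complexify_comp A _)
  rw [cplx_isometry_comp]
  refine ⟨⟨?_, ?_, ?_, ?_, ?_⟩, ?_, ?_⟩
  · exact (complexifyEquiv A).contDiff.comp_contDiffOn hg.smooth
  · intro w hw
    rw [complexify_star, hg.real w hw]
  · intro w hw
    rw [complexify_dot, hg.dot_self w hw]
  · intro w hw
    rw [h1, complexify_dot, hg.conformal w hw]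
  · intro w hw h
    rw [h1] at h
    change complexify A (wirtinger (cplx g) w) = 0 at h
    apply hg.ne_zero w hw
    rw [← complexify_symm A (wirtinger (cplx g) w), h, map_zero]
  · intro w hw
    rw [h1, wirtingerBar_complexify_comp, hg.minimal w hw, map_smul, complexify_star,
      complexify_dot]
  · intro w hw
    rw [h1, wirtinger_complexify_comp, complexify_dot, hg.adapted w hw]

end Complexification

/-! ### Transforms depend only on germs -/

section Locality

variable {g k : ℂ → E6} {w : ℂ}

theorem secondFF_congr (e : g =ᶠ[nhds w] k) (X Y : ℂ) : secondFF g w X Y = secondFF k w X Y := by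
  rw [secondFF, secondFF]
  simp only [e.eq_of_nhds, e.fderiv_eq, e.fderiv.fderiv_eq]

theorem plusTransform_congr (e : g =ᶠ[nhds w] k) : plusTransform g w = plusTransform k w := by
  simp only [plusTransform, phi, aVec, bVec, normal, crossVec, secondFF_congr e, e.eq_of_nhds,
    e.fderiv_eq]

theorem minusTransform_congr (e : g =ᶠ[nhds w] k) : minusTransform g w = minusTransform k w := by
  simp only [minusTransform, phi, aVec, bVec, normal, crossVec, secondFF_congr e, e.eq_of_nhds,
    e.fderiv_eq]

theorem IsAdaptedMinimal.congr {U : Set ℂ} (hU : IsOpen U) {G K : ℂ → Fin 6 → ℂ}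
    (hG : IsAdaptedMinimal U G) (e : ∀ w ∈ U, K w = G w) : IsAdaptedMinimal U K := by
  have e0 : ∀ w ∈ U, K =ᶠ[nhds w] G := fun w hw => Filter.eventually_of_mem (hU.mem_nhds hw) e
  have e1 : ∀ w ∈ U, wirtinger K w = wirtinger G w := fun w hw => wirtinger_congr (e0 w hw)
  have e2 : ∀ w ∈ U, wirtinger K =ᶠ[nhds w] wirtinger G := fun w hw =>
    Filter.eventually_of_mem (hU.mem_nhds hw) e1
  refine ⟨⟨hG.smooth.congr e, ?_, ?_, ?_, ?_⟩, ?_, ?_⟩ <;> intro w hw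
  · rw [e w hw, hG.real w hw]
  · rw [e w hw, hG.dot_self w hw]
  · rw [e1 w hw, hG.conformal w hw]
  · rw [e1 w hw]; exact hG.ne_zero w hw
  · rw [wirtingerBar_congr (e2 w hw), e1 w hw, e w hw, hG.minimal w hw]
  · rw [wirtinger_congr (e2 w hw), hG.adapted w hw]

end Locality

/-! ### The sequence of transforms in one coordinate -/

section Sequence

variable {A : E6 ≃ₗᵢ[ℝ] E6} (hA : LinearMap.det (A.toLinearEquiv : E6 →ₗ[ℝ] E6) = -1)
  {U : Set ℂ} (hU : IsOpen U) {g : ℂ → E6}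
include hA hU

/-- The (-)transform is the (+)transform conjugated by a reflection, so no second computation is
needed. -/
theorem IsAdaptedMinimal.isAdaptedMinimal_minusTransform (hg : IsAdaptedMinimal U (cplx g)) :
    IsAdaptedMinimal U (cplx (minusTransform g)) := by
  have h := (((hg.isometry_comp A).isAdaptedMinimal_plusTransform hU).isometry_comp A.symm)
  simpa only [plusTransform_reflection_comp _ _ hA, A.symm_apply_apply] using h

/-- The (+)transform inverts the (-)transform. -/
theorem IsAdaptedMinimal.plusTransform_minusTransform (hg : IsAdaptedMinimal U (cplx g)) {w : ℂ}
    (hw : w ∈ U) : plusTransform (minusTransform g) w = g w := by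
  have h := (hg.isometry_comp A).minusTransform_plusTransform hU hw
  have e : plusTransform (fun z => A (g z)) = fun z => A (minusTransform g z) :=
    funext fun z => plusTransform_reflection_comp g z hA
  rw [e, minusTransform_reflection_comp _ _ hA] at h
  exact A.injective h

/-- In a sequence of transforms of a minimal surface, all terms are minimal, and consecutive terms
are related by both transforms. -/
theorem isAdaptedMinimal_sequence {h : ℤ → ℂ → E6} (h0 : IsAdaptedMinimal U (cplx (h 0)))
    (hp : ∀ p : ℕ, ∀ w ∈ U, h ((p : ℤ) + 1) w = plusTransform (h (p : ℤ)) w)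
    (hm : ∀ p : ℕ, ∀ w ∈ U, h (-(p : ℤ) - 1) w = minusTransform (h (-(p : ℤ))) w) (p : ℤ) :
    IsAdaptedMinimal U (cplx (h p)) ∧ ∀ w ∈ U, h (p + 1) w = plusTransform (h p) w ∧
      h (p - 1) w = minusTransform (h p) w := by
  have pos : ∀ n : ℕ, IsAdaptedMinimal U (cplx (h (n : ℤ))) := by
    intro n
    induction n with
    | zero => exact h0
    | succ n ih =>
      push_cast
      exact (ih.isAdaptedMinimal_plusTransform hU).congr hU fun w hw =>
        congrArg toC (hp n w hw)
  have neg : ∀ n : ℕ, IsAdaptedMinimal U (cplx (h (-(n : ℤ)))) := by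
    intro n
    induction n with
    | zero => exact h0
    | succ n ih =>
      push_cast
      rw [neg_add']
      exact (ih.isAdaptedMinimal_minusTransform hA hU).congr hU fun w hw =>
        congrArg toC (hm n w hw)
  obtain ⟨n, rfl | rfl⟩ := p.eq_nat_or_neg
  · refine ⟨pos n, fun w hw => ⟨hp n w hw, ?_⟩⟩
    cases n with
    | zero => exact hm 0 w hw
    | succ n =>
      push_cast
      -- The hypotheses give only (+)steps at nonnegative indices and (-)steps at nonpositive ones.
      -- The missing directions come from the inversion theorems.
      rw [add_sub_cancel_right, minusTransform_congr
        (Filter.eventually_of_mem (hU.mem_nhds hw) (hp n))]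
      exact ((pos n).minusTransform_plusTransform hU hw).symm
  · refine ⟨neg n, fun w hw => ⟨?_, hm n w hw⟩⟩
    cases n with
    | zero => exact hp 0 w hw
    | succ n =>
      push_cast
      rw [neg_add', sub_add_cancel, plusTransform_congr
        (Filter.eventually_of_mem (hU.mem_nhds hw) (hm n))]
      exact ((neg n).plusTransform_minusTransform hA hU hw).symm

end Sequence

/-! ### Change of complex coordinate -/

section Transition

theorem wirtinger_comp {V : Type*} [NormedAddCommGroup V] [NormedSpace ℝ V] [NormedSpace ℂ V]
    [IsScalarTower ℝ ℂ V] {h : ℂ → V} {τ : ℂ → ℂ} {w : ℂ}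
    (hh : DifferentiableAt ℝ h (τ w)) (hτ : DifferentiableAt ℝ τ w) :
    wirtinger (fun z => h (τ z)) w = wirtinger τ w • wirtinger h (τ w) +
      (starRingEnd ℂ (wirtingerBar τ w)) • wirtingerBar h (τ w) := by
  have e : fderiv ℝ (fun z => h (τ z)) w = (fderiv ℝ h (τ w)).comp (fderiv ℝ τ w) :=
    fderiv_comp w hh hτ
  rw [wirtinger, e, ContinuousLinearMap.comp_apply, ContinuousLinearMap.comp_apply,
    fderiv_apply_wirtinger h, fderiv_apply_wirtinger h (τ w) (fderiv ℝ τ w Complex.I)]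
  simp only [wirtinger, wirtingerBar, smul_eq_mul, map_mul, map_add, map_div₀, map_one,
    Complex.conj_I, map_ofNat]
  module

theorem det_eq_re_im (T : ℂ →ₗ[ℝ] ℂ) : LinearMap.det T =
    (T 1).re * (T Complex.I).im - (T Complex.I).re * (T 1).im := by
  rw [← LinearMap.det_toMatrix Complex.basisOneI, Matrix.det_fin_two]
  simp [LinearMap.toMatrix_apply]

/-- The Jacobian determinant is `|∂τ|² - |∂̄τ|²`. -/
theorem wirtinger_ne_zero_of_det_pos {τ : ℂ → ℂ} {w : ℂ}
    (h : 0 < LinearMap.det (fderiv ℝ τ w).toLinearMap) : wirtinger τ w ≠ 0 := by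
  intro h0
  rw [det_eq_re_im] at h
  change 0 < (fderiv ℝ τ w 1).re * (fderiv ℝ τ w Complex.I).im -
    (fderiv ℝ τ w Complex.I).re * (fderiv ℝ τ w 1).im at h
  rw [fderiv_apply_wirtinger τ w 1, fderiv_apply_wirtinger τ w Complex.I, h0] at h
  simp at h
  nlinarith [sq_nonneg (wirtingerBar τ w).re, sq_nonneg (wirtingerBar τ w).im]

variable {U V : Set ℂ} (hU : IsOpen U) (hV : IsOpen V) {τ : ℂ → ℂ} (hτ : ContDiffOn ℝ ∞ τ V)
  (hmap : ∀ w ∈ V, τ w ∈ U) (hdet : ∀ w ∈ V, 0 < LinearMap.det (fderiv ℝ τ w).toLinearMap)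
  {G K G₀ K₀ : ℂ → Fin 6 → ℂ} (hG₀ : IsAdaptedMinimal U G₀) (hGτ : ∀ w ∈ V, G w = G₀ (τ w))
include hU hV hτ hmap hdet hG₀ hGτ

/-- The chain rule gives `(∂G, ∂G) = 2 ∂τ · conj(∂̄τ) · E₀`, with `E₀ = (∂G₀, ∂̄G₀) ≠ 0` taken at `τ
w`. Conformality in both coordinates, with `∂τ ≠ 0` from the orientation, makes `τ` holomorphic. -/
theorem wirtingerBar_transition_eq_zero
    (hconf : ∀ w ∈ V, wirtinger G w ⬝ᵥ wirtinger G w = 0) {w : ℂ} (hw : w ∈ V) :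
    wirtingerBar τ w = 0 := by
  have h1 : wirtinger G w = _ :=
    (wirtinger_congr (Filter.eventually_of_mem (hV.mem_nhds hw) hGτ)).trans
      (wirtinger_comp (hG₀.smooth.diffAt hU (hmap w hw)) (hτ.diffAt hV hw))
  have h2 := hconf w hw
  have hu := hmap w hw
  have c1 : star (wirtinger G₀ (τ w)) ⬝ᵥ star (wirtinger G₀ (τ w)) = 0 := by
    rw [← star_dot, hG₀.conformal _ hu, star_zero]
  rw [h1, hG₀.wirtingerBar_eq hU hu] at h2
  simp only [add_dotProduct, dotProduct_add, smul_dotProduct, dotProduct_smul, smul_eq_mul,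
    hG₀.conformal _ hu, c1, dotProduct_comm (star (wirtinger G₀ (τ w))) (wirtinger G₀ (τ w))] at h2
  have h3 : 2 * wirtinger τ w * (starRingEnd ℂ (wirtingerBar τ w)) *
      (wirtinger G₀ (τ w) ⬝ᵥ star (wirtinger G₀ (τ w))) = 0 := by
    linear_combination h2
  have h4 := (mul_eq_zero.1 h3).resolve_right (hG₀.normSq_ne hu)
  have h5 := (mul_eq_zero.1 h4).resolve_left
    (mul_ne_zero two_ne_zero (wirtinger_ne_zero_of_det_pos (hdet w hw)))
  simpa using h5

theorem wirtinger_transition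
    (hconf : ∀ w ∈ V, wirtinger G w ⬝ᵥ wirtinger G w = 0) {w : ℂ} (hw : w ∈ V)
    {H H₀ : ℂ → Fin 6 → ℂ} (hH₀ : ContDiffOn ℝ ∞ H₀ U) (hHτ : ∀ w ∈ V, H w = H₀ (τ w)) :
    wirtinger H w = wirtinger τ w • wirtinger H₀ (τ w) := by
  rw [wirtinger_congr (Filter.eventually_of_mem (hV.mem_nhds hw) hHτ),
    wirtinger_comp (hH₀.diffAt hU (hmap w hw)) (hτ.diffAt hV hw),
    wirtingerBar_transition_eq_zero hU hV hτ hmap hdet hG₀ hGτ hconf hw, map_zero, zero_smul,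
    add_zero]

/-- The quadratic differential `(∂G, ∂K)` squares to the quartic differential `(f₂, f₂)`. -/
theorem dot_sq_of_transition
    (hconf : ∀ w ∈ V, wirtinger G w ⬝ᵥ wirtinger G w = 0)
    (hquart : ∀ w ∈ V, wirtinger (wirtinger G) w ⬝ᵥ wirtinger (wirtinger G) w = -1)
    (hK₀ : IsPolar U G₀ K₀) (hKτ : ∀ w ∈ V, K w = K₀ (τ w)) {w : ℂ} (hw : w ∈ V) :
    (wirtinger G w ⬝ᵥ wirtinger K w) ^ 2 = -1 := by
  have hu := hmap w hw
  have hG1 : ∀ z ∈ V, wirtinger G z = wirtinger τ z • wirtinger G₀ (τ z) := fun z hz =>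
    wirtinger_transition hU hV hτ hmap hdet hG₀ hGτ hconf hz hG₀.smooth hGτ
  have hK1 := wirtinger_transition hU hV hτ hmap hdet hG₀ hGτ hconf hw hK₀.smooth hKτ
  have hG₀τ : ContDiffOn ℝ ∞ (fun z => wirtinger G₀ (τ z)) V :=
    (hG₀.smooth_one hU).comp hτ hmap
  have hG2 : wirtinger (wirtinger G) w = wirtinger (wirtinger τ) w • wirtinger G₀ (τ w) +
      wirtinger τ w • (wirtinger τ w • wirtinger (wirtinger G₀) (τ w)) := by
    rw [wirtinger_congr (Filter.eventually_of_mem (hV.mem_nhds hw) hG1),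
      wirtinger_smul ((hτ.wirtinger hV).diffAt hV hw) (hG₀τ.diffAt hV hw),
      wirtinger_transition hU hV hτ hmap hdet hG₀ hGτ hconf hw (hG₀.smooth_one hU)
        (H := fun z => wirtinger G₀ (τ z)) fun _ _ => rfl]
  -- Adaptedness in both coordinates amounts to `(∂τ)⁴ = 1`, while `(∂G, ∂K) = -i (∂τ)²`.
  have h4 := hquart w hw
  rw [hG2] at h4
  simp only [add_dotProduct, dotProduct_add, smul_dotProduct, dotProduct_smul, smul_eq_mul,
    hG₀.conformal _ hu, hG₀.two_dot_one hU hu, hG₀.adapted _ hu,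
    dotProduct_comm (wirtinger G₀ (τ w)) (wirtinger (wirtinger G₀) (τ w))] at h4
  rw [hG1 w hw, hK1, smul_dotProduct, dotProduct_smul, dotProduct_comm,
    hK₀.one_dot_one hG₀ hU hu, smul_eq_mul, smul_eq_mul]
  linear_combination h4 + wirtinger τ w ^ 4 * Complex.I_mul_I

end Transition

/-! ### From the surface to coordinate domains -/

section Surface

variable {S : Type*} [TopologicalSpace S] [ChartedSpace ℂ S]

theorem contDiffOn_comp_symm {f : S → E6} (hf : ContMDiff 𝓘(ℝ, ℂ) 𝓘(ℝ, E6) ∞ f)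
    {z : OpenPartialHomeomorph S ℂ} (hz : z ∈ IsManifold.maximalAtlas 𝓘(ℝ, ℂ) ∞ S) :
    ContDiffOn ℝ ∞ (f ∘ z.symm) z.target :=
  (hf.comp_contMDiffOn (contMDiffOn_symm_of_mem_maximalAtlas hz)).contDiffOn

theorem contDiffOn_transition {z z₀ : OpenPartialHomeomorph S ℂ}
    (hz : z ∈ IsManifold.maximalAtlas 𝓘(ℝ, ℂ) ∞ S)
    (hz₀ : z₀ ∈ IsManifold.maximalAtlas 𝓘(ℝ, ℂ) ∞ S) :
    ContDiffOn ℝ ∞ (z.symm.trans z₀) (z.symm.trans z₀).source := by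
  rw [← contMDiffOn_iff_contDiffOn]
  exact (contMDiffOn_of_mem_maximalAtlas hz₀).comp
    ((contMDiffOn_symm_of_mem_maximalAtlas hz).mono fun w hw => hw.1) fun w hw => hw.2

theorem differentiableAt_of_det_ne_zero {T : ℂ → ℂ} {w : ℂ}
    (h : LinearMap.det (fderiv ℝ T w).toLinearMap ≠ 0) : DifferentiableAt ℝ T w := by
  by_contra hT
  rw [fderiv_zero_of_not_differentiableAt hT, det_eq_re_im] at h
  simp at h

/-- The transition map between two oriented coordinates preserves the orientation. -/
theorem det_transition_pos {z z₀ : OpenPartialHomeomorph S ℂ} (hz : IsOrientedCoordinate z)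
    (hz₀ : IsOrientedCoordinate z₀) {w : ℂ} (hw : w ∈ (z.symm.trans z₀).source) :
    0 < LinearMap.det (fderiv ℝ (z.symm.trans z₀) w).toLinearMap := by
  set x := z.symm w with hx
  -- Orientation compatibility is defined only against charts of the given atlas, so the transition
  -- map is compared with both coordinates through such a chart and the chain rule.
  set e := chartAt ℂ x with he
  have hxe : x ∈ e.source := mem_chart_source ℂ x
  have hwz : w ∈ z.target := hw.1
  have hxz : x ∈ z.source := z.map_target hwz
  have hxz₀ : x ∈ z₀.source := hw.2
  have hzx : z x = w := z.right_inv hwz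
  have hu : e.symm (e x) = x := e.left_inv hxe
  have m : e x ∈ (e.symm.trans z).source :=
    ⟨e.map_source hxe, by change e.symm (e x) ∈ z.source; rwa [hu]⟩
  have m₀ : e x ∈ (e.symm.trans z₀).source :=
    ⟨e.map_source hxe, by change e.symm (e x) ∈ z₀.source; rwa [hu]⟩
  have d := hz.2 e (chart_mem_atlas ℂ x) _ m
  have d₀ := hz₀.2 e (chart_mem_atlas ℂ x) _ m₀
  have hval : (e.symm.trans z) (e x) = w := by
    change z (e.symm (e x)) = w
    rw [hu, hzx]
  have hT : DifferentiableAt ℝ (z.symm.trans z₀) ((e.symm.trans z) (e x)) := by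
    rw [hval]
    exact (contDiffOn_transition hz.1 hz₀.1).diffAt (z.symm.trans z₀).open_source hw
  have hcomp := fderiv_comp (e x) hT (differentiableAt_of_det_ne_zero d.ne')
  have hev : (z.symm.trans z₀) ∘ (e.symm.trans z) =ᶠ[nhds (e x)] (e.symm.trans z₀) := by
    filter_upwards [(e.symm.trans z).open_source.mem_nhds m] with u hu
    change z₀ (z.symm (z (e.symm u))) = z₀ (e.symm u)
    exact congrArg z₀ (z.left_inv hu.2)
  rw [hev.fderiv_eq, hval] at hcomp
  have hd : LinearMap.det (fderiv ℝ (e.symm.trans z₀) (e x)).toLinearMap =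
      LinearMap.det (fderiv ℝ (z.symm.trans z₀) w).toLinearMap *
        LinearMap.det (fderiv ℝ (e.symm.trans z) (e x)).toLinearMap := by
    rw [hcomp, ← LinearMap.det_comp]; rfl
  rw [hd] at d₀
  exact pos_of_mul_pos_left d₀ d.le

theorem isConformalImmersion_of_adapted {g : ℂ → E6} {U : Set ℂ} (hs : ContDiffOn ℝ ∞ g U)
    (h1 : ∀ w ∈ U, ‖g w‖ = 1) (hc : ∀ w ∈ U, f1 g w ⬝ᵥ f1 g w = 0) (hn : ∀ w ∈ U, f1 g w ≠ 0) :
    IsConformalImmersion U (cplx g) where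
  smooth := contDiffOn_cplx hs
  real _ _ := star_toC _
  dot_self w hw := by
    rw [cplx, toC_dotProduct_toC, real_inner_self_eq_norm_sq, h1 w hw]; simp
  conformal := hc
  ne_zero := hn

/-- An adapted coordinate of a minimal immersion in the sense of the definitions. -/
theorem isAdaptedMinimal_of_isAdapted {f : S → E6} (hf : IsMinimalImmersion f)
    {z : OpenPartialHomeomorph S ℂ} (hz : IsAdapted f z) :
    IsAdaptedMinimal z.target (cplx (f ∘ z.symm)) := by
  have hU := z.open_target
  set g := f ∘ z.symm with hgdef
  have hs : ContDiffOn ℝ ∞ g z.target := contDiffOn_comp_symm hf.smooth hz.1.1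
  have hconf : IsConformalImmersion z.target (cplx g) := by
    refine isConformalImmersion_of_adapted hs (fun w _ => hf.norm_eq_one _)
      (fun w hw => (hz.2 w hw).1) fun w hw h => ?_
    have hinj := hf.immersion z hz.1.1 w hw
    rw [f1_eq, wirtinger_cplx (hs.diffAt hU hw)] at h
    have h0 : fderiv ℝ g w 1 = 0 := by
      ext i
      have := congrArg Complex.re (congrFun h i)
      simpa [toC] using this
    exact one_ne_zero (hinj (h0.trans (map_zero _).symm))
  refine ⟨hconf, fun w hw => ?_, fun w hw => ?_⟩
  · have hx := hconf.toC_fderiv_one hU hw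
    have hy := hconf.toC_fderiv_I hU hw
    have hF := hconf.smooth_one hU
    have b1 : wirtingerBar (wirtinger (cplx g)) w ⬝ᵥ wirtinger (cplx g) w = 0 :=
      wirtingerBar_dot_self_of_const hU hF hconf.conformal hw
    have b0 : wirtingerBar (wirtinger (cplx g)) w ⬝ᵥ cplx g w =
        -(wirtinger (cplx g) w ⬝ᵥ star (wirtinger (cplx g) w)) := by
      rw [wirtingerBar_dot_of_const hU hF hconf.smooth (fun _ hz => hconf.one_dot hU hz) hw,
        hconf.wirtingerBar_eq hU hw]
    set s := fderiv ℝ (fderiv ℝ g) w 1 1 + fderiv ℝ (fderiv ℝ g) w Complex.I Complex.I with hsdef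
    have hB := wirtingerBar_wirtinger_cplx hU hs hw
    rw [← hsdef] at hB
    have b2 : wirtingerBar (wirtinger (cplx g)) w ⬝ᵥ star (wirtinger (cplx g) w) = 0 := by
      have hst : star (wirtingerBar (wirtinger (cplx g)) w) = wirtingerBar (wirtinger (cplx g)) w :=
        by rw [hB, star_toC]
      rw [wirtinger_dot_star hst, b1, star_zero]
    have sx : ⟪s, fderiv ℝ g w 1⟫_ℝ = 0 := by
      have : toC ((1 / 4 : ℝ) • s) ⬝ᵥ toC (fderiv ℝ g w 1) = 0 := by
        rw [← hB, hx, dotProduct_add, b1, b2, add_zero]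
      rw [toC_dotProduct_toC, inner_smul_left] at this
      simpa using this
    have sy : ⟪s, fderiv ℝ g w Complex.I⟫_ℝ = 0 := by
      have : toC ((1 / 4 : ℝ) • s) ⬝ᵥ toC (fderiv ℝ g w Complex.I) = 0 := by
        rw [← hB, hy, dotProduct_smul, dotProduct_sub, b1, b2, sub_zero, smul_zero]
      rw [toC_dotProduct_toC, inner_smul_left] at this
      simpa using this
    obtain ⟨hxx, hxy, hyy, hfx, hfy⟩ := hconf.inner_fderiv hU hw
    set c : ℝ := ‖fderiv ℝ g w 1‖⁻¹ with hc
    have hx0 : ‖fderiv ℝ g w 1‖ ≠ 0 := by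
      rw [real_inner_self_eq_norm_sq] at hxx
      exact fun h => by simp [h] at hxx
    have hc0 : c ≠ 0 := inv_ne_zero hx0
    have hyn : ‖fderiv ℝ g w Complex.I‖ = ‖fderiv ℝ g w 1‖ := by
      rw [real_inner_self_eq_norm_sq, real_inner_self_eq_norm_sq] at hyy
      exact (sq_eq_sq₀ (norm_nonneg _) (norm_nonneg _)).1 hyy
    -- The factor `c` makes the orthogonal coordinate vectors unit vectors. The hypothesis then says
    -- that the Laplacian `s` has no normal component.
    have hmin := hf.minimal z hz.1.1 w hw (c • 1) (c • Complex.I)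
      (by rw [map_smul, norm_smul, hc, norm_inv, norm_norm]; exact inv_mul_cancel₀ hx0)
      (by rw [map_smul, norm_smul, hc, norm_inv, norm_norm, ← hgdef, hyn]
          exact inv_mul_cancel₀ hx0)
      (by rw [map_smul, map_smul, inner_smul_left, inner_smul_right, ← hgdef, hxy]; simp)
    rw [← hgdef, secondFF, secondFF] at hmin
    simp only [map_smul, _root_.smul_apply, ← smul_add, ← map_add] at hmin
    have hP := (smul_eq_zero.1 ((smul_eq_zero.1 hmin).resolve_left hc0)).resolve_left hc0
    rw [Submodule.starProjection_apply_eq_zero_iff, Submodule.orthogonal_orthogonal,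
      Submodule.mem_sup] at hP
    obtain ⟨y₁, hy₁, y₂, ⟨Y, rfl⟩, hY⟩ := hP
    obtain ⟨t, rfl⟩ := Submodule.mem_span_singleton.1 hy₁
    change t • g w + fderiv ℝ g w Y = s at hY
    have hsY : ⟪s, fderiv ℝ g w Y⟫_ℝ = 0 := by
      rw [fderiv_apply_eq, inner_add_right, inner_smul_right, inner_smul_right, sx, sy]; simp
    have hgY : ⟪g w, fderiv ℝ g w Y⟫_ℝ = 0 := by
      rw [fderiv_apply_eq, inner_add_right, inner_smul_right, inner_smul_right, hfx, hfy]; simp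
    -- Conformality makes `s` orthogonal to the tangent plane, so its tangential part vanishes and
    -- `s` is a multiple of `g`; the coefficient is read off from `b0`.
    have hY0 : fderiv ℝ g w Y = 0 := by
      rw [← hY, inner_add_left, inner_smul_left, hgY, mul_zero, zero_add] at hsY
      exact inner_self_eq_zero.1 hsY
    rw [hY0, add_zero] at hY
    have hBt : wirtingerBar (wirtinger (cplx g)) w = ((1 / 4 * t : ℝ) : ℂ) • cplx g w := by
      rw [hB, ← hY, smul_smul, toC_smul]; rfl
    rw [hBt, smul_dotProduct, hconf.dot_self w hw, smul_eq_mul, mul_one] at b0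
    rw [hBt, b0]
  · rw [← hconf.normalSecond_dot_self_eq hU hw, ← hconf.f2_eq hU hw]
    exact (hz.2 w hw).2

end Surface

theorem IsPolar.congr {U : Set ℂ} {G K H : ℂ → Fin 6 → ℂ} (hK : IsPolar U G K)
    (e : ∀ w ∈ U, H w = K w) : IsPolar U G H where
  smooth := hK.smooth.congr e
  real w hw := by rw [e w hw, hK.real w hw]
  dot_self w hw := by rw [e w hw, hK.dot_self w hw]
  dot w hw := by rw [e w hw, hK.dot w hw]
  dot_one w hw := by rw [e w hw, hK.dot_one w hw]
  dot_normalSecond w hw := by rw [e w hw, hK.dot_normalSecond w hw]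

/-! ### Vanishing of a symmetric `γ` -/

section Symmetry

/-- If `gamma g k` is symmetric and `(∂g, ∂k)` is locally a square root of `-1`, then `gamma g k`
vanishes. -/
theorem gamma_eq_zero_of_symm {V : Set ℂ} (hV : IsOpen V) {g k : ℂ → E6}
    (hg : ContDiffOn ℝ ∞ (cplx g) V) (hk : ContDiffOn ℝ ∞ (cplx k) V)
    (hQ : ∀ w ∈ V, (wirtinger (cplx g) w ⬝ᵥ wirtinger (cplx k) w) ^ 2 = -1) {w : ℂ} (hw : w ∈ V)
    (hsymm : gamma g k w = gamma k g w) : gamma g k w = 0 := by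
  have sg := hg.wirtinger hV
  have sk := hk.wirtinger hV
  have sQ := sg.dot sk
  have hQw := hQ w hw
  have h1 := wirtinger_smul (sQ.diffAt hV hw) (sQ.diffAt hV hw)
  rw [wirtinger_congr (k := fun _ => (-1 : ℂ)) (Filter.eventually_of_mem (hV.mem_nhds hw)
    fun z hz => by rw [← hQ z hz, smul_eq_mul, sq]), wirtinger_const,
    wirtinger_dot (sg.diffAt hV hw) (sk.diffAt hV hw)] at h1
  have h2 : wirtinger (wirtinger (cplx g)) w ⬝ᵥ wirtinger (cplx k) w = gamma g k w := rfl
  have h3 : wirtinger (cplx g) w ⬝ᵥ wirtinger (wirtinger (cplx k)) w = gamma g k w := by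
    rw [hsymm, dotProduct_comm]; rfl
  -- With `Q = (∂g, ∂k)`, symmetry gives `∂Q = 2γ`, so differentiating `Q² = -1` yields `4Qγ = 0`;
  -- multiplication by `Q` removes the factor.
  rw [h2, h3, smul_eq_mul, smul_eq_mul] at h1
  linear_combination (1 / 4 * (wirtinger (cplx g) w ⬝ᵥ wirtinger (cplx k) w)) * h1 +
    gamma g k w * hQw

end Symmetry

/-! ### Reflections acting on the sequence -/

section Main

variable {S : Type*} [TopologicalSpace S] [ChartedSpace ℂ S] {f : S → E6}
  (hf : IsMinimalImmersion f) {F : ℤ → S → E6} (hF : IsTransformSequence f F)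
  {A : E6 ≃ₗᵢ[ℝ] E6} (hA : LinearMap.det (A.toLinearEquiv : E6 →ₗ[ℝ] E6) = -1)
include hf hF hA

/-- Near each point there is a coordinate in which all terms of a transform sequence are minimal
and consecutive terms are related by both transforms. -/
theorem MinimalSphere.IsTransformSequence.exists_coordinate (x : S) :
    ∃ z : OpenPartialHomeomorph S ℂ, x ∈ z.source ∧ IsOrientedCoordinate z ∧ ∀ p : ℤ,
      IsAdaptedMinimal z.target (cplx (F p ∘ z.symm)) ∧ ∀ w ∈ z.target,
        (F (p + 1) ∘ z.symm) w = plusTransform (F p ∘ z.symm) w ∧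
        (F (p - 1) ∘ z.symm) w = minusTransform (F p ∘ z.symm) w := by
  obtain ⟨z, hx, hz, hzF⟩ := hF.2 x
  refine ⟨z, hx, hz.1, isAdaptedMinimal_sequence hA z.open_target
    (h := fun p => F p ∘ z.symm) ?_ ?_ ?_⟩
  · rw [hF.1]
    exact isAdaptedMinimal_of_isAdapted hf hz
  · intro p w hw
    have := (hzF p (z.symm w) (z.map_target hw)).1
    rwa [z.right_inv hw] at this
  · intro p w hw
    have := (hzF p (z.symm w) (z.map_target hw)).2
    rwa [z.right_inv hw] at this

/-- As `A` exchanges the two transforms, a step forwards from `q` corresponds to a step backwards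
from `r`, and conversely. -/
theorem MinimalSphere.IsTransformSequence.reflection_step {q r : ℤ} (h : ∀ x, F q x = A (F r x)) :
    (∀ x, F (q + 1) x = A (F (r - 1) x)) ∧ ∀ x, F (q - 1) x = A (F (r + 1) x) := by
  refine forall_and.1 fun x => ?_
  obtain ⟨z, hx, -, hz⟩ := hF.exists_coordinate hf hA x
  have hw := z.map_source hx
  have e : F q ∘ z.symm = fun w => A ((F r ∘ z.symm) w) := funext fun w => h _
  have h1 := ((hz q).2 _ hw).1
  have h2 := ((hz q).2 _ hw).2
  rw [e, plusTransform_reflection_comp _ _ hA, ← ((hz r).2 _ hw).2] at h1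
  rw [e, minusTransform_reflection_comp _ _ hA, ← ((hz r).2 _ hw).1] at h2
  simp only [Function.comp_apply, z.left_inv hx] at h1 h2
  exact ⟨h1, h2⟩

/-- A reflection exchanging two terms of a transform sequence reverses the sequence. -/
theorem MinimalSphere.IsTransformSequence.reflection {q r : ℤ} (h : ∀ x, F q x = A (F r x)) (k : ℤ) (x : S) :
    F (q - k) x = A (F (r + k) x) := by
  revert x
  induction k using Int.induction_on with
  | zero => simpa using h
  | succ n ih =>
    rw [← sub_sub, ← add_assoc]
    exact (hF.reflection_step hf hA ih).2
  | pred n ih =>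
    rw [← sub_add, ← add_sub_assoc]
    exact (hF.reflection_step hf hA ih).1

/-- The coordinate `z` is adapted for `F s` but need not be the one that generates the sequence.
Near each point it is compared with a generating coordinate `z₀`, in which `F (s + 1)` is known to
be a polar of `F s`. -/
theorem MinimalSphere.IsTransformSequence.gamma_eq_zero {s : ℤ} (h₁ : ∀ x, F (s + 1) x = A (F s x))
    (h₂ : ∀ x, F s x = A (F (s + 1) x)) {z : OpenPartialHomeomorph S ℂ} (hz : IsAdapted (F s) z)
    {w : ℂ} (hw : w ∈ z.target) : gamma (F s ∘ z.symm) (F (s + 1) ∘ z.symm) w = 0 := by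
  obtain ⟨z₀, hx, hz₀, hF₀⟩ := hF.exists_coordinate hf hA (z.symm w)
  set g := F s ∘ z.symm with hg
  set k := F (s + 1) ∘ z.symm with hk
  set τ := z.symm.trans z₀ with hτ
  have hV : IsOpen τ.source := τ.open_source
  have hwV : w ∈ τ.source := ⟨hw, hx⟩
  have hVz : ∀ w ∈ τ.source, w ∈ z.target := fun _ hu => hu.1
  have hmap : ∀ w ∈ τ.source, τ w ∈ z₀.target := fun _ hu => z₀.map_source hu.2
  have sτ := contDiffOn_transition hz.1.1 hz₀.1
  have hdet : ∀ w ∈ τ.source, 0 < LinearMap.det (fderiv ℝ τ w).toLinearMap := fun w hw =>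
    det_transition_pos hz.1 hz₀ hw
  have hG₀ := (hF₀ s).1
  have hK₀ : IsPolar z₀.target (cplx (F s ∘ z₀.symm)) (cplx (F (s + 1) ∘ z₀.symm)) :=
    (hG₀.isPolar_plusTransform z₀.open_target).congr fun w hw =>
      congrArg toC ((hF₀ s).2 w hw).1
  have hcomp : ∀ p, ∀ u ∈ τ.source, cplx (F p ∘ z.symm) u = cplx (F p ∘ z₀.symm) (τ u) :=
    fun p u hu => congrArg (fun y => toC (F p y)) (z₀.left_inv hu.2).symm
  have sg : ContDiffOn ℝ ∞ (cplx g) τ.source := (hG₀.smooth.comp sτ hmap).congr (hcomp s)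
  have sk : ContDiffOn ℝ ∞ (cplx k) τ.source := (hK₀.smooth.comp sτ hmap).congr (hcomp (s + 1))
  have hconf : ∀ u ∈ τ.source, wirtinger (cplx g) u ⬝ᵥ wirtinger (cplx g) u = 0 :=
    fun u hu => (hz.2 u (hVz u hu)).1
  have himm : IsConformalImmersion τ.source (cplx g) := by
    refine ⟨sg, fun _ _ => star_toC _, fun u hu => ?_, hconf, fun u hu => ?_⟩
    · rw [hcomp s u hu, hG₀.dot_self _ (hmap u hu)]
    · rw [wirtinger_transition z₀.open_target hV sτ hmap hdet hG₀ (hcomp s) hconf hu hG₀.smooth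
        (hcomp s)]
      exact smul_ne_zero (wirtinger_ne_zero_of_det_pos (hdet u hu)) (hG₀.ne_zero _ (hmap u hu))
  have hquart : ∀ u ∈ τ.source,
      wirtinger (wirtinger (cplx g)) u ⬝ᵥ wirtinger (wirtinger (cplx g)) u = -1 := by
    intro u hu
    rw [← himm.normalSecond_dot_self_eq hV hu, ← himm.f2_eq hV hu]
    exact (hz.2 u (hVz u hu)).2
  refine gamma_eq_zero_of_symm hV sg sk (fun u hu => dot_sq_of_transition z₀.open_target hV sτ hmap
    hdet hG₀ (hcomp s) hconf hquart hK₀ (hcomp (s + 1)) hu) hwV ?_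
  -- Applying `A` to both arguments of `gamma` swaps `g` and `k` without changing the value; this is
  -- the required symmetry.
  have e₁ : k = fun u => A (g u) := funext fun u => h₁ _
  have e₂ : g = fun u => A (k u) := funext fun u => h₂ _
  calc gamma g k w = gamma (fun u => A (k u)) (fun u => A (g u)) w := by rw [← e₁, ← e₂]
    _ = gamma k g w := gamma_isometry_comp A k g w

end Main

theorem theorem5 {S : Type*} [TopologicalSpace S] [ChartedSpace ℂ S]
    [IsManifold 𝓘(ℝ, ℂ) ∞ S] (hS : IsOrientedAtlas S)
    (f : S → E6) (hf : IsMinimalImmersion f) (hE : HasNondegenerateNoncircularEllipse f)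
    (F : ℤ → S → E6) (hF : IsTransformSequence f F)
    (q r : ℤ) (A : E6 ≃ₗᵢ[ℝ] E6)
    (hA : LinearMap.det (A.toLinearEquiv : E6 →ₗ[ℝ] E6) = -1)
    (hqr : ∀ x, F q x = A (F r x)) :
    (Even (q - r) → ∃ s : ℤ, ∀ z : OpenPartialHomeomorph S ℂ, IsAdapted (F s) z →
      ∀ w ∈ z.target, alpha (F s ∘ z.symm) w = 0) ∧
    (Odd (q - r) → ∃ s : ℤ, ∀ z : OpenPartialHomeomorph S ℂ, IsAdapted (F s) z →
      ∀ w ∈ z.target, gamma (F s ∘ z.symm) (F (s + 1) ∘ z.symm) w = 0) := by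
  have key := hF.reflection hf hA hqr
  constructor
  · rintro ⟨m, hm⟩
    -- With `q - r = 2m`, taking `k = m` steps brings both indices to the midpoint `r + m`.
    refine ⟨r + m, fun z _ w _ => ?_⟩
    have h : ∀ x, F (r + m) x = A (F (r + m) x) := fun x => by
      have := key m x
      rwa [show q - m = r + m by lia] at this
    have e : F (r + m) ∘ z.symm = fun u => A ((F (r + m) ∘ z.symm) u) := funext fun u => h _
    have h2 := alpha_reflection_comp A hA (F (r + m) ∘ z.symm) w
    rw [← e] at h2
    exact self_eq_neg.1 h2
  · rintro ⟨m, hm⟩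
    -- With `q - r = 2m + 1`, the steps `k = m` and `k = m + 1` show that `A` maps each of the two
    -- middle terms to the other.
    refine ⟨r + m, fun z hz w hw => hF.gamma_eq_zero hf hA (fun x => ?_) (fun x => ?_) hz hw⟩
    · have := key m x
      rwa [show q - m = r + m + 1 by lia] at this
    · have := key (m + 1) x
      rwa [show q - (m + 1) = r + m by lia, ← add_assoc] at this
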